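/- Let $p,\sigma>0$ and $0<\theta_{\min}\le\theta_{\max}$, and write $\Omega=(0,\infty)\times(0,\infty)$ for the set of pairs $(y,\theta)$. For a compactly supported probability measure $\rho$ on $\Omega$ put $$u(\rho)(y,\theta)=\int_\Omega (z-y)\,d\rho(z,\eta)+\sigma(\theta-y^p)\,y=\partial_y\,(W*\rho+\sigma V),\qquad W(y)=-\tfrac12y^2,\quad V(y,\theta)=\tfrac12\theta y^2-\tfrac1{p+2}y^{p+2}.$$ A (global, measure-valued) solution of $\partial_t\mu+\partial_y(u(\mu)\mu)=0$ with initial data $\mu_0$ is a weakly-$*$ continuous family $(\mu_t)_{t\ge0}$ of probability measures on $\Omega$, with supports contained, locally uniformly in $t$, in compact subsets of $\Omega$, that starts at $\mu_0$ and satisfies, for all $\varphi\in C_0^\infty([0,\infty)\times\Omega)$ and $t>0$, $$\int_\Omega\varphi(t,\cdot)\,d\mu_t=\int_\Omega\varphi(0,\cdot)\,d\mu_0+\int_0^t\int_\Omega\big[\partial_s\varphi+u(\mu_s)\,\partial_y\varphi\big]\,d\mu_s\,ds.$$ Let $\operatorname{supp}\mu_0\subset[y_{\min},y_{\max}]\times[\theta_{\min},\theta_{\max}]$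 with $y_{\min}>0$, let $\pi$ be the $\theta$-marginal of $\mu_0$ (it is conserved), let $\mu_t=\mu_t^\theta\otimes d\pi(\theta)$ be the disintegration of $\mu_t$ into probability measures $\mu_t^\theta$ in $y$, and let $\mathcal W_1$ be the Wasserstein-1 distance. A characteristic for $\theta$ is a function $Y:[0,\infty)\to(0,\infty)$ with $Y'(t)=u(\mu_t)(Y(t),\theta)$ for $t\ge 0$. **Theorem.** (1) There are a strictly increasing, positive $g\in C^\infty([\theta_{\min},\theta_{\max}])$ and constants $C,c>0$, depending only on $\mu_0$, the box and the parameters, such that for every solution $\mu$ with initial data $\mu_0$: for every $\theta\in[\theta_{\min},\theta_{\max}]$ (also for $\theta\notin\operatorname{supp}\pi$) each characteristic for $\theta$ that starts in $[y_{\min},y_{\max}]$ converges to $g(\theta)$ as $t\to\infty$; and $$\sup_{\theta\in\operatorname{supp}\pi}\mathcal W_1(\mu_t^\theta,\delta_{g(\theta)})\le Ce^{-ct},\qquad t>0.$$ The last bound holds for any slices $\mu_t^\theta$ if, for each $t>0$, the supremum is read as a $\pi$-essential supremum. It holds with the supremum over all of $\operatorname{supp}\pi$ for any choice of slices such that, for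 each $\theta\in\operatorname{supp}\pi$, $\mu_0^\theta$ is supported in $[y_{\min},y_{\max}]$ and $t\mapsto\mu^\theta_t$ is a measure-valued solution (in the same sense, on $(0,\infty)$) of $\partial_t\mu^\theta+\partial_y(u(\mu_t)(\cdot,\theta)\,\mu^\theta)=0$; such a choice exists. (2) Suppose moreover that $$\sigma\theta_{\min}>\frac{p+1}p\qquad\text{or}\qquad\frac{\theta_{\max}}{\theta_{\min}}<p+1 .$$ Then the map $\pi\mapsto g$ is Lipschitz: there is $L>0$ depending only on $p,\sigma,\theta_{\min},\theta_{\max}$ such that for any two solutions with initial data supported in $[y_{\min},y_{\max}]\times[\theta_{\min},\theta_{\max}]$ and $[y_{\min}',y_{\max}']\times[\theta_{\min},\theta_{\max}]$ ($y_{\min},y_{\min}'>0$), with conviction marginals $\pi,\tilde\pi$, and with limits $g,\tilde g$ of their characteristics on $[\theta_{\min},\theta_{\max}]$ as in (1), $$\sup_{\theta\in[\theta_{\min},\theta_{\max}]}|g(\theta)-\tilde g(\theta)|\le L\,\mathcal W_1(\pi,\tilde\pi).$$ In particular $g$ is unique for each $\pi$: if $\pi=\tilde\pi$ then $g=\tilde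 g$ on $[\theta_{\min},\theta_{\max}]$. -/

import Mathlib

open MeasureTheory ProbabilityTheory Set Filter Topology
open scoped ENNReal ContDiff

namespace OpinionModel

noncomputable section

/-- The open quadrant of pairs `(y, θ)` (opinion, conviction). -/
def Quadrant : Set (ℝ × ℝ) := Ioi 0 ×ˢ Ioi 0

/-- The Wasserstein-1 distance on the real line: the infimum of the transport cost
`∫ |x - y| dγ` over all couplings `γ` of the two measures. -/
def W1 (μ ν : Measure ℝ) : ℝ≥0∞ :=
  ⨅ (γ : Measure (ℝ × ℝ)) (_ : γ.map Prod.fst = μ) (_ : γ.map Prod.snd = ν),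
    ∫⁻ z, edist z.1 z.2 ∂γ

/-- The velocity `u(ρ)(y, θ) = ∂_y (W ∗ ρ + σ V)`, with `W(y) = - y² / 2` and
`V(y, θ) = θ y² / 2 - y^(p+2) / (p+2)`, written out. -/
def velocity (p σ : ℝ) (ρ : Measure (ℝ × ℝ)) (y θ : ℝ) : ℝ :=
  (∫ z, (z.1 - y) ∂ρ) + σ * (θ - y ^ p) * y

/-- `μ` is a global measure-valued solution of `∂_t μ + ∂_y (u(μ) μ) = 0` with initial
data `μ₀`. Points of `ℝ × ℝ` are `(y, θ)`; only the times `t ≥ 0` matter. -/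
structure IsSolution (p σ : ℝ) (μ₀ : Measure (ℝ × ℝ)) (μ : ℝ → Measure (ℝ × ℝ)) : Prop where
  prob : ∀ t, 0 ≤ t → IsProbabilityMeasure (μ t)
  /-- The supports stay, locally uniformly in time, in compact subsets of the open quadrant. -/
  supp : ∀ T, ∃ K, IsCompact K ∧ K ⊆ Quadrant ∧ ∀ t ∈ Icc 0 T, (μ t).support ⊆ K
  /-- Weak-star continuity in time. -/
  weakStar : ∀ φ : ℝ × ℝ → ℝ, Continuous φ → HasCompactSupport φ → tsupport φ ⊆ Quadrant →
    ContinuousOn (fun t => ∫ x, φ x ∂(μ t)) (Ici 0)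
  initial : μ 0 = μ₀
  /-- The weak form of the equation. The test functions are the restrictions to `[0, ∞)` of
  smooth functions of `(s, y, θ)` with compact support in `ℝ × Quadrant`. -/
  weak : ∀ φ : ℝ × ℝ × ℝ → ℝ, ContDiff ℝ ∞ φ → HasCompactSupport φ →
    tsupport φ ⊆ univ ×ˢ Quadrant → ∀ t, 0 < t →
    ∫ x, φ (t, x.1, x.2) ∂(μ t) = ∫ x, φ (0, x.1, x.2) ∂μ₀ +
      ∫ s in (0 : ℝ)..t, ∫ x, (deriv (fun r => φ (r, x.1, x.2)) s +
        velocity p σ (μ s) x.1 x.2 * deriv (fun y => φ (s, y, x.2)) x.1) ∂(μ s)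

/-- `Y` is a characteristic of the solution `μ` for the conviction value `θ`:
`Y' = u(μ_t)(Y, θ)` for `t ≥ 0`, inside the open half-line. -/
structure IsCharacteristic (p σ : ℝ) (μ : ℝ → Measure (ℝ × ℝ)) (θ : ℝ) (Y : ℝ → ℝ) : Prop where
  pos : ∀ t, 0 ≤ t → 0 < Y t
  ode : ∀ t, 0 ≤ t → HasDerivWithinAt Y (velocity p σ (μ t) (Y t) θ) (Ici 0) t

/-- `g` is the limiting opinion profile of the solution `μ` on the whole conviction interval:
for each `θ ∈ [θmin, θmax]`, also outside the support of the conviction marginal, every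
characteristic that starts in `[ymin, ymax]` converges to `g θ`. -/
def IsLimitProfile (p σ ymin ymax θmin θmax : ℝ) (μ : ℝ → Measure (ℝ × ℝ)) (g : ℝ → ℝ) : Prop :=
  ∀ θ ∈ Icc θmin θmax, ∀ Y : ℝ → ℝ, IsCharacteristic p σ μ θ Y → Y 0 ∈ Icc ymin ymax →
    Tendsto Y atTop (𝓝 (g θ))

/-- `κ` is a family of slices of the measure `ρ` on pairs `(y, θ)`:
`ρ(dy dθ) = κ θ (dy) π(dθ)`, where `π` is the `θ`-marginal. -/
def IsDisintegration (ρ : Measure (ℝ × ℝ)) (π : Measure ℝ) (κ : Kernel ℝ ℝ) : Prop :=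
  IsMarkovKernel κ ∧ ρ.map Prod.swap = π ⊗ₘ κ

/-- `ν` is a measure-valued solution, on the open half-line, of the slice equation
`∂_t ν + ∂_y (u(μ)(·, θ) ν) = 0` for the fixed conviction value `θ`; the velocity is that of
the solution `μ`. -/
structure IsSliceSolution (p σ : ℝ) (μ : ℝ → Measure (ℝ × ℝ)) (θ : ℝ) (ν : ℝ → Measure ℝ) :
    Prop where
  prob : ∀ t, 0 ≤ t → IsProbabilityMeasure (ν t)
  supp : ∀ T, ∃ K, IsCompact K ∧ K ⊆ Ioi 0 ∧ ∀ t ∈ Icc 0 T, (ν t).support ⊆ K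
  weakStar : ∀ φ : ℝ → ℝ, Continuous φ → HasCompactSupport φ → tsupport φ ⊆ Ioi 0 →
    ContinuousOn (fun t => ∫ y, φ y ∂(ν t)) (Ici 0)
  weak : ∀ φ : ℝ × ℝ → ℝ, ContDiff ℝ ∞ φ → HasCompactSupport φ →
    tsupport φ ⊆ univ ×ˢ Ioi 0 → ∀ t, 0 < t →
    ∫ y, φ (t, y) ∂(ν t) = ∫ y, φ (0, y) ∂(ν 0) +
      ∫ s in (0 : ℝ)..t, ∫ y, (deriv (fun r => φ (r, y)) s +
        velocity p σ (μ s) y θ * deriv (fun z => φ (s, z)) y) ∂(ν s)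

/-- `κ t θ` is a version of the slices `μ_t^θ` that is consistent in time: it disintegrates
`μ_t` for each `t ≥ 0`, and for each (not only almost each) `θ` in the support of the
conviction marginal `π` it starts in `[ymin, ymax]` and solves the slice equation. -/
structure IsTransportedSlicing (p σ ymin ymax : ℝ) (μ : ℝ → Measure (ℝ × ℝ)) (π : Measure ℝ)
    (κ : ℝ → Kernel ℝ ℝ) : Prop where
  disintegration : ∀ t, 0 ≤ t → IsDisintegration (μ t) π (κ t)
  start : ∀ θ ∈ π.support, (κ 0 θ).support ⊆ Icc ymin ymax
  slice : ∀ θ ∈ π.support, IsSliceSolution p σ μ θ (fun t => κ t θ)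

end

end OpinionModel

namespace OpinionModel

/-! ### Transport by the velocity field with a prescribed mean -/

/-! The population acts on an individual only through its mean opinion `m(t)`: the velocity is
`field p σ m y θ = m - y + σ (θ - y ^ p) y`. For a constant mean `M > 0` this field has exactly one
positive zero, `equilibrium p σ M θ`, and relative to a zero `g` it reads `-(M / g) (y - g) - σ y (y
^ p - g ^ p)` (`field_eq_of_zero`). Both terms push towards `g`, whatever the parameters are.

Since the means of interest lie between the `p`-th roots `lo`, `hi` of the extreme convictions, the
intermediate value theorem gives `M` with `∫ equilibrium p σ M dπ = M`
(`exists_integral_equilibrium_eq`). The profile is `g = equilibrium p σ M`. Let `E(t) = ∫ (y -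
g(θ))² dμ_t` and `d = m - M = ∫ (y - g) dμ_t`. Differentiation of `E` produces the bad term `2 d²`,
and Cauchy–Schwarz gives `d² ≤ M ∫ (y - g)² / g`, so the linear part of the dissipation absorbs it.
The power part is at least a multiple of `E`, because opinions stay in a fixed compact interval.
Hence `E`, and with it `d² ≤ E`, decays exponentially (`IsTransport.sq_mean_sub_le`). Afterwards
every characteristic and every slice follows a contracting field with an exponentially small
perturbation.

A bound for every `θ`, and not only almost every one, needs slices that are consistent in time. They
are obtained by pushing initial slices along the flow of characteristics. That the flow reproduces
`μ_t` is a uniqueness statement for the linear transport equation with given mean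
(`IsTransport.eq_of_initial_eq`). It is proved with moments: the moments of the difference of two
transports satisfy a closed linear hierarchy that forces them to vanish.

For the dependence on `π`, `equilibrium p σ m θ / m` decreases in `m` at a uniform rate
(`exists_equilibrium_div_le`). The condition `∫ equilibrium p σ M θ / M dπ = 1` thus pins down `M`,
and testing the difference of two marginals with this Lipschitz function bounds `|M - M'|` by their
Wasserstein distance. -/

lemma isOpen_quadrant : IsOpen Quadrant := isOpen_Ioi.prod isOpen_Ioi

/-- The velocity field of a population with mean opinion `m`. -/
noncomputable def field (p σ m y θ : ℝ) : ℝ := m - y + σ * (θ - y ^ p) * y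

/-- Weak solutions of `∂_t ρ + ∂_y (field(m(t), ·) ρ) = 0` on the quadrant. -/
structure IsTransport (p σ : ℝ) (m : ℝ → ℝ) (ρ : ℝ → Measure (ℝ × ℝ)) : Prop where
  prob : ∀ t, 0 ≤ t → IsProbabilityMeasure (ρ t)
  supp : ∀ T, ∃ K, IsCompact K ∧ K ⊆ Quadrant ∧ ∀ t ∈ Icc 0 T, (ρ t).support ⊆ K
  weakStar : ∀ φ : ℝ × ℝ → ℝ, Continuous φ → HasCompactSupport φ → tsupport φ ⊆ Quadrant →
    ContinuousOn (fun t => ∫ x, φ x ∂(ρ t)) (Ici 0)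
  weak : ∀ φ : ℝ × ℝ × ℝ → ℝ, ContDiff ℝ ∞ φ → HasCompactSupport φ →
    tsupport φ ⊆ univ ×ˢ Quadrant → ∀ t, 0 < t →
    ∫ x, φ (t, x.1, x.2) ∂(ρ t) = ∫ x, φ (0, x.1, x.2) ∂(ρ 0) +
      ∫ s in (0 : ℝ)..t, ∫ x, (deriv (fun r => φ (r, x.1, x.2)) s +
        field p σ (m s) x.1 x.2 * deriv (fun y => φ (s, y, x.2)) x.1) ∂(ρ s)

lemma ae_mem_of_support_subset {X : Type*} [TopologicalSpace X] [MeasurableSpace X]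
    [HereditarilyLindelofSpace X] {μ : Measure X} {s : Set X} (h : μ.support ⊆ s) :
    ∀ᵐ x ∂μ, x ∈ s :=
  mem_of_superset Measure.support_mem_ae h

/-- The cutoff equals one in a neighbourhood of `K`, not merely on `K`, so that derivatives are
unaffected on `K`. -/
lemma exists_smooth_cutoff {E : Type*} [NormedAddCommGroup E] [NormedSpace ℝ E]
    [FiniteDimensional ℝ E] {K U : Set E} (hK : IsCompact K) (hU : IsOpen U) (hKU : K ⊆ U) :
    ∃ χ : E → ℝ, ContDiff ℝ ∞ χ ∧ HasCompactSupport χ ∧ tsupport χ ⊆ U ∧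
      ∀ᶠ x in 𝓝ˢ K, χ x = 1 := by
  obtain ⟨K', hK', hKK', hK'U⟩ := exists_compact_between hK hU hKU
  have : ProperSpace E := FiniteDimensional.proper ℝ E
  obtain ⟨χ, h1, h0, -⟩ := exists_contMDiffMap_one_nhds_of_subset_interior (n := (⊤ : ℕ∞))
    (modelWithCornersSelf ℝ E) hK.isClosed hKK'
  have hsub : tsupport χ ⊆ K' := closure_minimal
    (fun x hx => by by_contra hx'; exact hx (h0 x hx')) hK'.isClosed
  exact ⟨χ, χ.contMDiff.contDiff, hK'.of_isClosed_subset (isClosed_tsupport _) hsub,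
    hsub.trans hK'U, h1⟩

lemma contDiff_mul_of_tsupport_subset {E : Type*} [NormedAddCommGroup E] [NormedSpace ℝ E]
    {U : Set E} (hU : IsOpen U) {χ ψ : E → ℝ} {n : WithTop ℕ∞} (hχ : ContDiff ℝ n χ)
    (hs : tsupport χ ⊆ U) (hψ : ContDiffOn ℝ n ψ U) : ContDiff ℝ n (fun x => χ x * ψ x) := by
  rw [contDiff_iff_contDiffAt]
  intro x
  by_cases hx : x ∈ U
  · exact hχ.contDiffAt.mul (hψ.contDiffAt (hU.mem_nhds hx))
  · have h0 : χ =ᶠ[𝓝 x] 0 := notMem_tsupport_iff_eventuallyEq.mp (fun h => hx (hs h))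
    refine (contDiffAt_const (c := (0 : ℝ))).congr_of_eventuallyEq ?_
    filter_upwards [h0] with z hz
    simp [hz]

lemma continuousOn_Ici_of_Icc {f : ℝ → ℝ} (h : ∀ T, 0 ≤ T → ContinuousOn f (Icc 0 T)) :
    ContinuousOn f (Ici 0) := by
  intro t ht
  have ht0 : (0 : ℝ) ≤ t := ht
  refine ((h (t + 1) (by linarith)) t ⟨ht, by linarith⟩).mono_of_mem_nhdsWithin ?_
  rw [← Ici_inter_Iic]
  exact inter_mem self_mem_nhdsWithin (mem_nhdsWithin_of_mem_nhds (Iic_mem_nhds (by linarith)))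

/-- Extension of a smooth function on the quadrant beyond a compact set, together with its
`y`-derivative. -/
lemma exists_test_extension {K : Set (ℝ × ℝ)} (hK : IsCompact K) (hKQ : K ⊆ Quadrant)
    {ψ ψ' : ℝ × ℝ → ℝ} (hψ : ContDiffOn ℝ ∞ ψ Quadrant)
    (hψ' : ∀ x ∈ Quadrant, HasDerivAt (fun y => ψ (y, x.2)) (ψ' x) x.1) :
    ∃ f : ℝ × ℝ → ℝ, ContDiff ℝ ∞ f ∧ HasCompactSupport f ∧ tsupport f ⊆ Quadrant ∧
      (∀ x ∈ K, f x = ψ x) ∧ (∀ x ∈ K, fderiv ℝ f x (1, 0) = ψ' x) := by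
  obtain ⟨χ, hχ, hχc, hχs, hχ1⟩ := exists_smooth_cutoff hK isOpen_quadrant hKQ
  have hf := contDiff_mul_of_tsupport_subset isOpen_quadrant hχ hχs hψ
  refine ⟨fun x => χ x * ψ x, hf, hχc.mul_right, (tsupport_mul_subset_left).trans hχs, ?_, ?_⟩
  · intro x hx
    simp [hχ1.self_of_nhdsSet x hx]
  · intro x hx
    have h1 : ∀ᶠ z in 𝓝 x, χ z = 1 := (mem_nhdsSet_iff_forall.mp hχ1) x hx
    have h2 : HasDerivAt (fun y : ℝ => ((y, x.2) : ℝ × ℝ)) (1, 0) x.1 :=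
      (hasDerivAt_id x.1).prodMk (hasDerivAt_const _ _)
    have h3 := ((hf.differentiable (by simp)) x).hasFDerivAt.comp_hasDerivAt (f := fun y : ℝ => ((y, x.2) : ℝ × ℝ)) x.1 h2
    have h4 : HasDerivAt (fun y : ℝ => χ (y, x.2) * ψ (y, x.2)) (ψ' x) x.1 := by
      refine (hψ' x (hKQ hx)).congr_of_eventuallyEq ?_
      have := h2.continuousAt.tendsto.eventually (p := fun z => χ z = 1) h1
      filter_upwards [this] with y hy
      simp [hy]
    exact h3.unique h4

lemma deriv_section_eq_fderiv {f : ℝ × ℝ → ℝ} (hf : Differentiable ℝ f) (x : ℝ × ℝ) :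
    deriv (fun y => f (y, x.2)) x.1 = fderiv ℝ f x (1, 0) := by
  have h2 : HasDerivAt (fun y : ℝ => ((y, x.2) : ℝ × ℝ)) (1, 0) x.1 :=
    (hasDerivAt_id x.1).prodMk (hasDerivAt_const _ _)
  exact ((hf x).hasFDerivAt.comp_hasDerivAt (f := fun y : ℝ => ((y, x.2) : ℝ × ℝ)) x.1 h2).deriv

namespace IsTransport

variable {p σ : ℝ} {m : ℝ → ℝ} {ρ : ℝ → Measure (ℝ × ℝ)}

/-- A time-independent function is not compactly supported in time. It becomes an admissible test
function after multiplication by a cutoff that is one near `[0, t]`, whose time derivative vanishes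
there. -/
lemma weak_of_stationary (h : IsTransport p σ m ρ) {f : ℝ × ℝ → ℝ} (hf : ContDiff ℝ ∞ f)
    (hfc : HasCompactSupport f) (hfs : tsupport f ⊆ Quadrant) {t : ℝ} (ht : 0 < t) :
    ∫ x, f x ∂(ρ t) = ∫ x, f x ∂(ρ 0) +
      ∫ s in (0 : ℝ)..t, ∫ x, field p σ (m s) x.1 x.2 * fderiv ℝ f x (1, 0) ∂(ρ s) := by
  obtain ⟨η, hη, hηc, -, hη1⟩ := exists_smooth_cutoff (isCompact_Icc (a := (0 : ℝ)) (b := t))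
    isOpen_univ (subset_univ _)
  have hts : tsupport (fun z : ℝ × ℝ × ℝ => η z.1 * f z.2) ⊆ tsupport η ×ˢ tsupport f := by
    refine closure_minimal ?_ ((isClosed_tsupport _).prod (isClosed_tsupport _))
    rintro ⟨a, b⟩ hz
    have hz' := mul_ne_zero_iff.mp hz
    exact ⟨subset_tsupport _ hz'.1, subset_tsupport _ hz'.2⟩
  have key := h.weak (fun z => η z.1 * f z.2) ((hη.comp contDiff_fst).mul (hf.comp contDiff_snd))
    ((hηc.prod hfc).of_isClosed_subset (isClosed_tsupport _) hts)
    (hts.trans (prod_mono (subset_univ _) hfs)) t ht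
  have e (s : ℝ) (hs : s ∈ Icc 0 t) : η s = 1 := hη1.self_of_nhdsSet s hs
  simp only [e t ⟨ht.le, le_rfl⟩, e 0 ⟨le_rfl, ht.le⟩, one_mul, Prod.mk.eta] at key
  rw [key]
  congr 1
  refine intervalIntegral.integral_congr fun s hs => ?_
  rw [uIcc_of_le ht.le] at hs
  have h1 : ∀ᶠ r in 𝓝 s, η r = 1 := (mem_nhdsSet_iff_forall.mp hη1) s hs
  have hd : deriv η s = 0 := by
    rw [(show η =ᶠ[𝓝 s] fun _ => 1 from h1).deriv_eq]; simp
  refine integral_congr_ae (Eventually.of_forall fun x => ?_)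
  have h5 : deriv (fun r => η r * f x) s = 0 := by
    rw [deriv_mul_const ((hη.differentiable (by simp)) s), hd, zero_mul]
  simp only [h5, e s hs, one_mul, zero_add, deriv_section_eq_fderiv (hf.differentiable (by simp))]

lemma ae_mem (h : IsTransport p σ m ρ) (T : ℝ) : ∃ K, IsCompact K ∧ K ⊆ Quadrant ∧
    ∀ t ∈ Icc 0 T, ∀ᵐ x ∂(ρ t), x ∈ K := by
  obtain ⟨K, h1, h2, h3⟩ := h.supp T
  exact ⟨K, h1, h2, fun t ht => ae_mem_of_support_subset (h3 t ht)⟩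

lemma ae_mem_quadrant (h : IsTransport p σ m ρ) {t : ℝ} (ht : 0 ≤ t) :
    ∀ᵐ x ∂(ρ t), x ∈ Quadrant := by
  obtain ⟨K, h1, h2, h3⟩ := h.ae_mem t
  filter_upwards [h3 t ⟨ht, le_rfl⟩] with x hx using h2 hx

lemma integrable (h : IsTransport p σ m ρ) {f : ℝ × ℝ → ℝ} (hf : ContinuousOn f Quadrant)
    {t : ℝ} (ht : 0 ≤ t) : Integrable f (ρ t) := by
  obtain ⟨K, h1, h2, h3⟩ := h.ae_mem t
  have := h.prob t ht
  have := (hf.mono h2).integrableOn_compact (μ := ρ t) h1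
  rwa [IntegrableOn, Measure.restrict_eq_self_of_ae_mem (h3 t ⟨ht, le_rfl⟩)] at this

/-- Up to time `T` all supports lie in one compact set, so a spatial cutoff removes the compact
support condition from weak-star continuity. -/
lemma continuousOn_integral (h : IsTransport p σ m ρ) {f : ℝ × ℝ → ℝ}
    (hf : ContinuousOn f Quadrant) : ContinuousOn (fun t => ∫ x, f x ∂(ρ t)) (Ici 0) := by
  refine continuousOn_Ici_of_Icc fun T hT => ?_
  obtain ⟨K, hK, hKQ, hae⟩ := h.ae_mem T
  obtain ⟨χ, hχ, hχc, hχs, hχ1⟩ := exists_smooth_cutoff hK isOpen_quadrant hKQ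
  have hc : Continuous fun x => χ x * f x := by
    rw [continuous_iff_continuousAt]
    intro x
    by_cases hx : x ∈ Quadrant
    · exact hχ.continuous.continuousAt.mul (hf.continuousAt (isOpen_quadrant.mem_nhds hx))
    · have h0 : χ =ᶠ[𝓝 x] 0 := notMem_tsupport_iff_eventuallyEq.mp (fun h => hx (hχs h))
      refine (continuousAt_const (y := (0 : ℝ))).congr ?_
      filter_upwards [h0] with z hz
      simp [hz]
  refine ((h.weakStar _ hc hχc.mul_right (tsupport_mul_subset_left.trans hχs)).mono
    Icc_subset_Ici_self).congr fun t ht => ?_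
  refine integral_congr_ae ?_
  filter_upwards [hae t ht] with x hx
  simp [hχ1.self_of_nhdsSet x hx]

/-- The evolution of the integral of a smooth function of `(y, θ)` under the transport. -/
lemma integral_eq (h : IsTransport p σ m ρ) {ψ ψ' : ℝ × ℝ → ℝ}
    (hψ : ContDiffOn ℝ ∞ ψ Quadrant)
    (hψ' : ∀ x ∈ Quadrant, HasDerivAt (fun y => ψ (y, x.2)) (ψ' x) x.1) {t : ℝ} (ht : 0 ≤ t) :
    ∫ x, ψ x ∂(ρ t) = ∫ x, ψ x ∂(ρ 0) +
      ∫ s in (0 : ℝ)..t, ∫ x, field p σ (m s) x.1 x.2 * ψ' x ∂(ρ s) := by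
  rcases ht.eq_or_lt with rfl | ht'
  · simp
  obtain ⟨K, hK, hKQ, hae⟩ := h.ae_mem t
  obtain ⟨f, hf, hfc, hfs, hf1, hf2⟩ := exists_test_extension hK hKQ hψ hψ'
  have e (s : ℝ) (hs : s ∈ Icc 0 t) : ∫ x, f x ∂(ρ s) = ∫ x, ψ x ∂(ρ s) := by
    refine integral_congr_ae ?_
    filter_upwards [hae s hs] with x hx using hf1 x hx
  rw [← e t ⟨ht, le_rfl⟩, ← e 0 ⟨le_rfl, ht⟩, h.weak_of_stationary hf hfc hfs ht']
  congr 1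
  refine intervalIntegral.integral_congr fun s hs => ?_
  rw [uIcc_of_le ht] at hs
  refine integral_congr_ae ?_
  filter_upwards [hae s hs] with x hx
  rw [hf2 x hx]

lemma field_eq (p σ m y θ : ℝ) : field p σ m y θ = m + field p σ 0 y θ := by
  simp only [field]; ring

lemma continuousOn_field (p σ m : ℝ) :
    ContinuousOn (fun x : ℝ × ℝ => field p σ m x.1 x.2) Quadrant := by
  have h1 : ContinuousOn (fun x : ℝ × ℝ => x.1 ^ p) Quadrant :=
    continuous_fst.continuousOn.rpow_const fun x hx => Or.inl (ne_of_gt hx.1)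
  simp only [field]
  fun_prop

/-- The mean enters the field additively, so the integral splits into `m t` times one continuous
function of time plus another. -/
lemma continuousOn_integral_field_mul (h : IsTransport p σ m ρ) (hm : ContinuousOn m (Ici 0))
    {f : ℝ × ℝ → ℝ} (hf : ContinuousOn f Quadrant) :
    ContinuousOn (fun t => ∫ x, field p σ (m t) x.1 x.2 * f x ∂(ρ t)) (Ici 0) := by
  have h0 : ContinuousOn (fun x : ℝ × ℝ => field p σ 0 x.1 x.2 * f x) Quadrant :=
    (continuousOn_field p σ 0).mul hf
  refine ((hm.mul (h.continuousOn_integral hf)).add (h.continuousOn_integral h0)).congr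
    fun t ht => ?_
  change _ = m t * ∫ x, f x ∂(ρ t) + ∫ x, field p σ 0 x.1 x.2 * f x ∂(ρ t)
  rw [← integral_const_mul, ← integral_add ((h.integrable hf ht).const_mul _) (h.integrable h0 ht)]
  refine integral_congr_ae (Eventually.of_forall fun x => ?_)
  simp only [field_eq p σ (m t)]
  ring

/-- Right derivatives suffice for the Grönwall arguments and avoid a separate treatment of `t = 0`.
-/
lemma hasDerivWithinAt_integral (h : IsTransport p σ m ρ) (hm : ContinuousOn m (Ici 0))
    {ψ ψ' : ℝ × ℝ → ℝ} (hψ : ContDiffOn ℝ ∞ ψ Quadrant) (hc : ContinuousOn ψ' Quadrant)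
    (hψ' : ∀ x ∈ Quadrant, HasDerivAt (fun y => ψ (y, x.2)) (ψ' x) x.1) {t : ℝ} (ht : 0 ≤ t) :
    HasDerivWithinAt (fun t => ∫ x, ψ x ∂(ρ t))
      (∫ x, field p σ (m t) x.1 x.2 * ψ' x ∂(ρ t)) (Ici t) t := by
  have hJ := h.continuousOn_integral_field_mul hm hc
  set J := fun t => ∫ x, field p σ (m t) x.1 x.2 * ψ' x ∂(ρ t) with hJdef
  have hint : IntervalIntegrable J volume 0 t :=
    (hJ.mono (by rw [uIcc_of_le ht]; exact Icc_subset_Ici_self)).intervalIntegrable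
  have hd : HasDerivWithinAt (fun u => ∫ s in (0 : ℝ)..u, J s) (J t) (Ici t) t := by
    refine intervalIntegral.integral_hasDerivWithinAt_right hint ?_
      ((hJ t ht).mono (Ioi_subset_Ici ht))
    exact (hJ.mono (Ioi_subset_Ici ht)).stronglyMeasurableAtFilter_nhdsWithin measurableSet_Ioi t
  refine (hd.const_add (∫ x, ψ x ∂(ρ 0))).congr (fun s hs => ?_) ?_
  · exact h.integral_eq hψ hψ' (ht.trans hs)
  · exact h.integral_eq hψ hψ' ht

end IsTransport

/-! ### Equilibria of the velocity field -/

/-- The positive zero of the velocity field with mean `m`. -/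
noncomputable def equilibrium (p σ m θ : ℝ) : ℝ :=
  Classical.epsilon fun y => 0 < y ∧ field p σ m y θ = 0

variable {p σ m θ : ℝ}

lemma exists_equilibrium (hp : 0 < p) (hσ : 0 < σ) (hm : 0 < m) (θ : ℝ) :
    ∃ y, 0 < y ∧ field p σ m y θ = 0 := by
  obtain ⟨M, hM1, hM2⟩ : ∃ M, m < M ∧ θ ≤ M ^ p :=
    (((eventually_gt_atTop m)).and ((tendsto_rpow_atTop hp).eventually_ge_atTop θ)).exists
  have hc : ContinuousOn (fun y => field p σ m y θ) (Icc 0 M) := by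
    have h1 : Continuous fun y : ℝ => y ^ p := Real.continuous_rpow_const hp.le
    simp only [field]
    fun_prop
  have hM0 : 0 < M := hm.trans hM1
  have h0 : field p σ m 0 θ = m := by simp [field]
  have hneg : field p σ m M θ ≤ 0 := by
    have : σ * (θ - M ^ p) * M ≤ 0 :=
      mul_nonpos_of_nonpos_of_nonneg (mul_nonpos_of_nonneg_of_nonpos hσ.le (by linarith)) hM0.le
    simp only [field]; linarith
  obtain ⟨y, hy, hy0⟩ := intermediate_value_Icc' hM0.le hc (show (0 : ℝ) ∈ _ from ⟨hneg, by
    rw [h0]; exact hm.le⟩)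
  refine ⟨y, hy.1.lt_of_ne ?_, hy0⟩
  rintro rfl
  exact hm.ne' (h0.symm.trans hy0)

lemma equilibrium_pos (hp : 0 < p) (hσ : 0 < σ) (hm : 0 < m) (θ : ℝ) :
    0 < equilibrium p σ m θ :=
  (Classical.epsilon_spec (exists_equilibrium hp hσ hm θ)).1

lemma field_equilibrium (hp : 0 < p) (hσ : 0 < σ) (hm : 0 < m) (θ : ℝ) :
    field p σ m (equilibrium p σ m θ) θ = 0 :=
  (Classical.epsilon_spec (exists_equilibrium hp hσ hm θ)).2

/-- The velocity field relative to a zero `g`. -/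
lemma field_eq_of_zero {y g : ℝ} (hg : 0 < g) (h : field p σ m g θ = 0) :
    field p σ m y θ = -(m / g) * (y - g) - σ * y * (y ^ p - g ^ p) := by
  -- Divided by `g` this is `m / g = 1 - σ (θ - g ^ p)`, which eliminates the conviction in favour
  -- of the zero.
  have h' : m = g - σ * (θ - g ^ p) * g := by simp only [field] at h; linarith
  rw [field]
  field_simp
  linear_combination y * h'

lemma rpow_sub_mul_sub_nonneg (hp : 0 < p) {x y : ℝ} (hx : 0 < x) (hy : 0 < y) :
    0 ≤ (x ^ p - y ^ p) * (x - y) := by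
  rcases le_total x y with h | h
  · exact mul_nonneg_of_nonpos_of_nonpos
      (sub_nonpos.mpr (Real.rpow_le_rpow hx.le h hp.le)) (sub_nonpos.mpr h)
  · exact mul_nonneg (sub_nonneg.mpr (Real.rpow_le_rpow hy.le h hp.le)) (sub_nonneg.mpr h)

/-- By `field_eq_of_zero` the field is negative above a positive zero, and likewise positive below
it. This sign test yields uniqueness, bounds and monotonicity of the equilibrium. -/
lemma le_zero_of_field_nonneg (hp : 0 < p) (hσ : 0 < σ) (hm : 0 < m) {c g : ℝ} (hc : 0 < c)
    (hg : 0 < g) (h : field p σ m g θ = 0) (hf : 0 ≤ field p σ m c θ) : c ≤ g := by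
  by_contra! hlt
  rw [field_eq_of_zero hg h] at hf
  have h1 : 0 < m / g * (c - g) := mul_pos (div_pos hm hg) (by linarith)
  have h2 : 0 ≤ σ * c * (c ^ p - g ^ p) := mul_nonneg (mul_pos hσ hc).le
    (sub_nonneg.mpr (Real.rpow_le_rpow hg.le hlt.le hp.le))
  linarith

lemma zero_le_of_field_nonpos (hp : 0 < p) (hσ : 0 < σ) (hm : 0 < m) {c g : ℝ} (hc : 0 < c)
    (hg : 0 < g) (h : field p σ m g θ = 0) (hf : field p σ m c θ ≤ 0) : g ≤ c := by
  by_contra! hlt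
  rw [field_eq_of_zero hg h] at hf
  have h1 : m / g * (c - g) < 0 := mul_neg_of_pos_of_neg (div_pos hm hg) (by linarith)
  have h2 : σ * c * (c ^ p - g ^ p) ≤ 0 := mul_nonpos_of_nonneg_of_nonpos (mul_pos hσ hc).le
    (sub_nonpos.mpr (Real.rpow_le_rpow hc.le hlt.le hp.le))
  linarith

lemma eq_equilibrium (hp : 0 < p) (hσ : 0 < σ) (hm : 0 < m) {y : ℝ} (hy : 0 < y)
    (h : field p σ m y θ = 0) : y = equilibrium p σ m θ :=
  le_antisymm
    (le_zero_of_field_nonneg hp hσ hm hy (equilibrium_pos hp hσ hm θ)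
      (field_equilibrium hp hσ hm θ) h.ge)
    (zero_le_of_field_nonpos hp hσ hm hy (equilibrium_pos hp hσ hm θ)
      (field_equilibrium hp hσ hm θ) h.le)

lemma le_equilibrium (hp : 0 < p) (hσ : 0 < σ) (hm : 0 < m) {c : ℝ} (hc : 0 < c) (hcm : c ≤ m)
    (hcθ : c ^ p ≤ θ) : c ≤ equilibrium p σ m θ := by
  refine le_zero_of_field_nonneg hp hσ hm hc (equilibrium_pos hp hσ hm θ)
    (field_equilibrium hp hσ hm θ) ?_
  have : 0 ≤ σ * (θ - c ^ p) * c := mul_nonneg (mul_nonneg hσ.le (by linarith)) hc.le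
  simp only [field]; linarith

lemma equilibrium_le (hp : 0 < p) (hσ : 0 < σ) (hm : 0 < m) {c : ℝ} (hc : 0 < c) (hcm : m ≤ c)
    (hcθ : θ ≤ c ^ p) : equilibrium p σ m θ ≤ c := by
  refine zero_le_of_field_nonpos hp hσ hm hc (equilibrium_pos hp hσ hm θ)
    (field_equilibrium hp hσ hm θ) ?_
  have : σ * (θ - c ^ p) * c ≤ 0 :=
    mul_nonpos_of_nonpos_of_nonneg (mul_nonpos_of_nonneg_of_nonpos hσ.le (by linarith)) hc.le
  simp only [field]; linarith

lemma strictMono_equilibrium (hp : 0 < p) (hσ : 0 < σ) (hm : 0 < m) :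
    StrictMono (equilibrium p σ m) := by
  intro θ θ' hlt
  have hy := equilibrium_pos hp hσ hm θ
  have hf := field_equilibrium hp hσ hm θ
  have hpos : 0 < field p σ m (equilibrium p σ m θ) θ' := by
    have : 0 < σ * (θ' - θ) * equilibrium p σ m θ :=
      mul_pos (mul_pos hσ (sub_pos.mpr hlt)) hy
    simp only [field] at hf ⊢; linarith
  refine lt_of_le_of_ne (le_zero_of_field_nonneg hp hσ hm hy (equilibrium_pos hp hσ hm θ')
    (field_equilibrium hp hσ hm θ') hpos.le) fun h => ?_
  rw [h, field_equilibrium hp hσ hm θ'] at hpos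
  exact hpos.false

/-- Lipschitz dependence of the zeros of the velocity field on the mean and the conviction. -/
lemma mul_abs_sub_zero_le (hp : 0 < p) (hσ : 0 < σ) {m' θ' y y' : ℝ} (hm' : 0 < m')
    (hy : 0 < y) (hy' : 0 < y') (h : field p σ m y θ = 0) (h' : field p σ m' y' θ' = 0) :
    m' * |y - y'| ≤ y' * (|m - m'| + σ * y * |θ - θ'|) := by
  -- The first zero almost solves the second equation. Testing this defect with `y - y'` and
  -- dropping the nonnegative power term leaves the linear dissipation `m' / y'`.
  have e : field p σ m y θ = (m - m') + σ * y * (θ - θ') + field p σ m' y θ' := by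
    simp only [field]; ring
  rw [h, field_eq_of_zero hy' h'] at e
  have h1 := mul_nonneg (mul_pos hσ hy).le (rpow_sub_mul_sub_nonneg hp hy hy')
  have h2 : m' / y' * (y - y') ^ 2 ≤ ((m - m') + σ * y * (θ - θ')) * (y - y') := by
    nlinarith
  have h3 : ((m - m') + σ * y * (θ - θ')) * (y - y') ≤
      (|m - m'| + σ * y * |θ - θ'|) * |y - y'| := by
    refine (le_abs_self _).trans ?_
    rw [abs_mul]
    gcongr
    refine (abs_add_le _ _).trans ?_
    rw [abs_mul (σ * y), abs_of_pos (mul_pos hσ hy)]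
  rcases eq_or_ne y y' with rfl | hne
  · simp only [sub_self, abs_zero, mul_zero]
    positivity
  · have hpos : 0 < |y - y'| := abs_pos.mpr (sub_ne_zero.mpr hne)
    rw [← sq_abs] at h2
    have h4 : m' / y' * |y - y'| ≤ |m - m'| + σ * y * |θ - θ'| := by
      refine le_of_mul_le_mul_right ?_ hpos
      calc _ = m' / y' * |y - y'| ^ 2 := by ring
        _ ≤ _ := h2.trans h3
    rw [div_mul_eq_mul_div, div_le_iff₀ hy'] at h4
    linarith

/-- Solved for `θ`, the equation for a zero reads `θ = h y` with `h' > 0`. The equilibrium is the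
inverse of `h`; uniqueness of positive zeros identifies it with the smooth local inverse. -/
lemma contDiff_equilibrium (hp : 0 < p) (hσ : 0 < σ) (hm : 0 < m) :
    ContDiff ℝ ∞ (equilibrium p σ m) := by
  set h : ℝ → ℝ := fun y => y ^ p + 1 / σ - m / (σ * y) with hh
  have key {y θ : ℝ} (hy : 0 < y) (hyθ : h y = θ) : y = equilibrium p σ m θ := by
    refine eq_equilibrium hp hσ hm hy ?_
    rw [← hyθ, hh, field]
    field_simp
    ring
  have key' (θ : ℝ) : h (equilibrium p σ m θ) = θ := by
    have h1 := equilibrium_pos hp hσ hm θ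
    have h2 := field_equilibrium hp hσ hm θ
    simp only [field] at h2
    simp only [hh]
    field_simp
    linarith
  rw [contDiff_iff_contDiffAt]
  intro θ₀
  set y₀ := equilibrium p σ m θ₀
  have hpos : 0 < y₀ := equilibrium_pos hp hσ hm θ₀
  have hcd : ContDiffAt ℝ ∞ h y₀ := by
    refine ((Real.contDiffAt_rpow_const_of_ne hpos.ne').add contDiffAt_const).sub ?_
    exact contDiffAt_const.div (contDiffAt_const.mul contDiffAt_id) (mul_pos hσ hpos).ne'
  have hd : HasDerivAt h (p * y₀ ^ (p - 1) + m / (σ * y₀ ^ 2)) y₀ := by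
    have h1 := (Real.hasDerivAt_rpow_const (p := p) (Or.inl hpos.ne')).add_const (1 / σ)
    have h2 := (hasDerivAt_const y₀ m).fun_div ((hasDerivAt_id y₀).const_mul σ)
      (mul_pos hσ hpos).ne'
    refine (h1.sub h2).congr_deriv ?_
    simp only [id]
    field_simp
    ring
  have hne : p * y₀ ^ (p - 1) + m / (σ * y₀ ^ 2) ≠ 0 := by positivity
  set e := ContinuousLinearEquiv.unitsEquivAut ℝ (Units.mk0 _ hne) with he
  have hfd : HasFDerivAt h (e : ℝ →L[ℝ] ℝ) y₀ := by
    refine hd.hasFDerivAt.congr_fderiv ?_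
    ext
    simp [he]
  have hn : (∞ : WithTop ℕ∞) ≠ 0 := by simp
  have hinv := hcd.to_localInverse hfd hn
  have hstr := hcd.hasStrictFDerivAt' hfd hn
  have hy₀θ : h y₀ = θ₀ := key' θ₀
  have himg : hcd.localInverse hfd hn (h y₀) = y₀ := hstr.localInverse_apply_image
  have hev1 : ∀ᶠ θ in 𝓝 (h y₀), h (hcd.localInverse hfd hn θ) = θ :=
    hstr.eventually_right_inverse
  have hev2 : ∀ᶠ θ in 𝓝 (h y₀), 0 < hcd.localInverse hfd hn θ := by
    refine hinv.continuousAt.eventually_const_lt ?_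
    rw [himg]; exact hpos
  rw [← hy₀θ]
  refine hinv.congr_of_eventuallyEq ?_
  filter_upwards [hev1, hev2] with θ h1 h2 using (key h2 h1).symm

/-- Two-sided bound for the difference quotients of a power on a compact interval. -/
lemma exists_rpow_sub_bounds (hp : 0 < p) {a b : ℝ} (ha : 0 < a) (hab : a ≤ b) :
    ∃ c C : ℝ, 0 < c ∧ 0 < C ∧ ∀ x ∈ Icc a b, ∀ y ∈ Icc a b, x ≤ y →
      c * (y - x) ≤ y ^ p - x ^ p ∧ y ^ p - x ^ p ≤ C * (y - x) := by
  have hc : ContinuousOn (fun x : ℝ => p * x ^ (p - 1)) (Icc a b) := by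
    refine continuousOn_const.mul (continuousOn_id.rpow_const fun x hx => Or.inl ?_)
    exact (ha.trans_le hx.1).ne'
  obtain ⟨z, hz, hzmin⟩ := isCompact_Icc.exists_isMinOn (nonempty_Icc.mpr hab) hc
  obtain ⟨w, hw, hwmax⟩ := isCompact_Icc.exists_isMaxOn (nonempty_Icc.mpr hab) hc
  have hz0 := ha.trans_le hz.1
  have hw0 := ha.trans_le hw.1
  refine ⟨p * z ^ (p - 1), p * w ^ (p - 1), by positivity, by positivity, ?_⟩
  intro x hx y hy hxy
  rcases hxy.eq_or_lt with rfl | hlt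
  · simp
  obtain ⟨ξ, hξ, hs⟩ := exists_hasDerivAt_eq_slope (fun x : ℝ => x ^ p)
    (fun x => p * x ^ (p - 1)) hlt
    (continuousOn_id.rpow_const fun x hx' => Or.inl (ha.trans_le (hx.1.trans hx'.1)).ne')
    (fun u hu => Real.hasDerivAt_rpow_const (Or.inl (ha.trans_le (hx.1.trans hu.1.le)).ne'))
  have hξ' : ξ ∈ Icc a b := ⟨hx.1.trans hξ.1.le, hξ.2.le.trans hy.2⟩
  have h0 : 0 < y - x := sub_pos.mpr hlt
  rw [eq_div_iff h0.ne'] at hs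
  rw [← hs]
  exact ⟨mul_le_mul_of_nonneg_right (hzmin hξ') h0.le,
    mul_le_mul_of_nonneg_right (hwmax hξ') h0.le⟩

/-- Strong monotonicity of the power term away from zero. It is the source of the decay rate of the
mean. -/
lemma exists_sq_le_mul_rpow_sub (hp : 0 < p) {a b : ℝ} (ha : 0 < a) (hab : a ≤ b) :
    ∃ c : ℝ, 0 < c ∧ ∀ y ∈ Icc a b, ∀ g ∈ Icc a b,
      c * (y - g) ^ 2 ≤ y * (y ^ p - g ^ p) * (y - g) := by
  obtain ⟨c, C, hc, -, h⟩ := exists_rpow_sub_bounds hp ha hab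
  refine ⟨a * c, mul_pos ha hc, fun y hy g hg => ?_⟩
  have h1 : c * (y - g) ^ 2 ≤ (y ^ p - g ^ p) * (y - g) := by
    rcases le_total g y with hgy | hgy
    · nlinarith [(h g hg y hy hgy).1]
    · nlinarith [(h y hy g hg hgy).1]
  have h2 : 0 ≤ c * (y - g) ^ 2 := by positivity
  calc a * c * (y - g) ^ 2 = a * (c * (y - g) ^ 2) := by ring
    _ ≤ y * (c * (y - g) ^ 2) := mul_le_mul_of_nonneg_right hy.1 h2
    _ ≤ y * ((y ^ p - g ^ p) * (y - g)) := mul_le_mul_of_nonneg_left h1 (ha.le.trans hy.1)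
    _ = _ := by ring

/-- The ratio of the equilibrium to the mean decreases in the mean, at a uniform rate. -/
lemma exists_equilibrium_div_le (hp : 0 < p) (hσ : 0 < σ) {lo hi : ℝ} (hlo : 0 < lo)
    (hlohi : lo ≤ hi) : ∃ δ : ℝ, 0 < δ ∧ ∀ θ ∈ Icc (lo ^ p) (hi ^ p), ∀ m ∈ Icc lo hi,
      ∀ m' ∈ Icc lo hi, m ≤ m' →
      equilibrium p σ m' θ / m' + δ * (m' - m) ≤ equilibrium p σ m θ / m := by
  have hhi := hlo.trans_le hlohi
  -- The point `z` below is a product of two numbers at most `hi` divided by one at least `lo`, so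
  -- `hi ^ 2 / lo` bounds it.
  have hM : lo ≤ hi ^ 2 / lo := by
    rw [le_div_iff₀ hlo]; nlinarith
  obtain ⟨c, C, hc, hC, hb⟩ := exists_rpow_sub_bounds hp hlo hM
  set M := hi ^ 2 / lo with hMdef
  -- `Λ` bounds the slope of the field with mean `m'` between its zero `y'` and `z`.
  set Λ := hi / lo + σ * M * C with hΛ
  have hM0 : 0 < M := hlo.trans_le hM
  have hΛ0 : 0 < Λ := by positivity
  have hhiM : hi ≤ M := by rw [hMdef, le_div_iff₀ hlo]; nlinarith
  refine ⟨σ * lo * c * (lo / hi) / Λ / hi, by positivity, ?_⟩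
  intro θ hθ m hm m' hm' hmm
  have hm0 := hlo.trans_le hm.1
  have hm0' := hlo.trans_le hm'.1
  have hy : equilibrium p σ m θ ∈ Icc lo hi :=
    ⟨le_equilibrium hp hσ hm0 hlo hm.1 hθ.1, equilibrium_le hp hσ hm0 hhi hm.2 hθ.2⟩
  have hy' : equilibrium p σ m' θ ∈ Icc lo hi :=
    ⟨le_equilibrium hp hσ hm0' hlo hm'.1 hθ.1, equilibrium_le hp hσ hm0' hhi hm'.2 hθ.2⟩
  have hf := field_equilibrium hp hσ hm0 θ
  have hf' := field_equilibrium hp hσ hm0' θ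
  set y := equilibrium p σ m θ
  set y' := equilibrium p σ m' θ
  have hy0 := hlo.trans_le hy.1
  have hy0' := hlo.trans_le hy'.1
  -- The claim compares `y / m = z / m'` with `y' / m'`. Apart from the power, the field is
  -- homogeneous of degree one in mean and opinion, so at `z` only the defect of `y ^ p` against `z
  -- ^ p` survives. Its sign gives `y' ≤ z`, and its size, divided by `Λ`, bounds `z - y'` from
  -- below.
  set z := y * m' / m with hz
  have hyz : y ≤ z := by rw [hz, le_div_iff₀ hm0]; exact mul_le_mul_of_nonneg_left hmm hy0.le
  have hz0 := hy0.trans_le hyz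
  have hzM : z ≤ M := by
    rw [hz, hMdef, sq]
    exact div_le_div₀ (by positivity) (mul_le_mul hy.2 hm'.2 hm0'.le hhi.le) hlo hm.1
  have e1 : field p σ m' z θ = m' / m * σ * y * (y ^ p - z ^ p) := by
    have : field p σ m' z θ = m' / m * (m - y + σ * (θ - z ^ p) * y) := by
      rw [field, hz]; field_simp
    rw [this]
    simp only [field] at hf
    linear_combination (m' / m) * hf
  have hyzp : y ^ p ≤ z ^ p := Real.rpow_le_rpow hy0.le hyz hp.le
  have hneg : field p σ m' z θ ≤ 0 := by
    rw [e1]; exact mul_nonpos_of_nonneg_of_nonpos (by positivity) (by linarith)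
  have hy'z : y' ≤ z := zero_le_of_field_nonpos hp hσ hm0' hz0 hy0' hf' hneg
  rw [field_eq_of_zero hy0' hf'] at e1
  have hzI : z ∈ Icc lo M := ⟨hy.1.trans hyz, hzM⟩
  have hyI : y ∈ Icc lo M := ⟨hy.1, hy.2.trans hhiM⟩
  have hyI' : y' ∈ Icc lo M := ⟨hy'.1, hy'.2.trans hhiM⟩
  have h1 : z ^ p - y' ^ p ≤ C * (z - y') := (hb y' hyI' z hzI hy'z).2
  have h2 : c * (z - y) ≤ z ^ p - y ^ p := (hb y hyI z hzI hyz).1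
  have h3 : m' / y' * (z - y') ≤ hi / lo * (z - y') := mul_le_mul_of_nonneg_right
    (div_le_div₀ hhi.le hm'.2 hlo hy'.1) (sub_nonneg.mpr hy'z)
  have h4 : σ * z * (z ^ p - y' ^ p) ≤ σ * M * (C * (z - y')) :=
    mul_le_mul (mul_le_mul_of_nonneg_left hzM hσ.le) h1
      (sub_nonneg.mpr (Real.rpow_le_rpow hy0'.le hy'z hp.le)) (by positivity)
  have h5 : σ * lo * (c * (z - y)) ≤ m' / m * σ * y * (z ^ p - y ^ p) := by
    refine mul_le_mul ?_ h2 (mul_nonneg hc.le (by linarith)) (by positivity)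
    have : 1 ≤ m' / m := by rw [le_div_iff₀ hm0]; linarith
    calc σ * lo ≤ σ * y := mul_le_mul_of_nonneg_left hy.1 hσ.le
      _ = 1 * (σ * y) := by ring
      _ ≤ m' / m * (σ * y) := mul_le_mul_of_nonneg_right this (by positivity)
      _ = _ := by ring
  have h6 : lo / hi * (m' - m) ≤ z - y := by
    have : z - y = y / m * (m' - m) := by rw [hz]; field_simp
    rw [this]
    exact mul_le_mul_of_nonneg_right (div_le_div₀ hy0.le hy.1 hm0 hm.2) (by linarith)
  have h7 : σ * lo * c * (lo / hi) * (m' - m) ≤ Λ * (z - y') := by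
    calc σ * lo * c * (lo / hi) * (m' - m) = σ * lo * c * (lo / hi * (m' - m)) := by ring
      _ ≤ σ * lo * c * (z - y) := mul_le_mul_of_nonneg_left h6 (by positivity)
      _ ≤ Λ * (z - y') := by rw [hΛ]; linarith
  have h8 : σ * lo * c * (lo / hi) / Λ * (m' - m) ≤ z - y' := by
    rw [div_mul_eq_mul_div, div_le_iff₀ hΛ0]; linarith
  have h9 : σ * lo * c * (lo / hi) / Λ / hi * (m' - m) ≤ (z - y') / m' := by
    rw [le_div_iff₀ hm0']
    refine le_trans ?_ h8
    calc _ = σ * lo * c * (lo / hi) / Λ * (m' - m) * (m' / hi) := by ring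
      _ ≤ σ * lo * c * (lo / hi) / Λ * (m' - m) * 1 := by
        refine mul_le_mul_of_nonneg_left ((div_le_one hhi).mpr hm'.2) ?_
        exact mul_nonneg (by positivity) (by linarith)
      _ = _ := mul_one _
  have h10 : (z - y') / m' = y / m - y' / m' := by rw [hz]; field_simp
  linarith

lemma rpow_inv_rpow_self {x : ℝ} (hp : 0 < p) (hx : 0 < x) : (x ^ p⁻¹) ^ p = x :=
  Real.rpow_inv_rpow hx.le hp.ne'

/-- The self-consistent mean. -/
lemma exists_integral_equilibrium_eq (hp : 0 < p) (hσ : 0 < σ) {lo hi : ℝ} (hlo : 0 < lo)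
    (hlohi : lo ≤ hi) (π : Measure ℝ) [IsProbabilityMeasure π]
    (hπ : ∀ᵐ θ ∂π, θ ∈ Icc (lo ^ p) (hi ^ p)) :
    ∃ m ∈ Icc lo hi, ∫ θ, equilibrium p σ m θ ∂π = m := by
  have hhi := hlo.trans_le hlohi
  have hbd (m : ℝ) (hm : m ∈ Icc lo hi) : ∀ᵐ θ ∂π, equilibrium p σ m θ ∈ Icc lo hi := by
    filter_upwards [hπ] with θ hθ
    exact ⟨le_equilibrium hp hσ (hlo.trans_le hm.1) hlo hm.1 hθ.1,
      equilibrium_le hp hσ (hlo.trans_le hm.1) hhi hm.2 hθ.2⟩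
  have hmeas (m : ℝ) (hm : m ∈ Icc lo hi) : AEStronglyMeasurable (equilibrium p σ m) π :=
    (contDiff_equilibrium hp hσ (hlo.trans_le hm.1)).continuous.aestronglyMeasurable
  have hint (m : ℝ) (hm : m ∈ Icc lo hi) : Integrable (equilibrium p σ m) π := by
    refine Integrable.of_bound (hmeas m hm) hi ?_
    filter_upwards [hbd m hm] with θ hθ
    rw [Real.norm_of_nonneg (hlo.le.trans hθ.1)]
    exact hθ.2
  have hcont : ContinuousOn (fun m => ∫ θ, equilibrium p σ m θ ∂π) (Icc lo hi) := by
    refine continuousOn_of_dominated hmeas (bound := fun _ => hi) (fun m hm => ?_)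
      (integrable_const _) (Eventually.of_forall fun θ => ?_)
    · filter_upwards [hbd m hm] with θ hθ
      rw [Real.norm_of_nonneg (hlo.le.trans hθ.1)]
      exact hθ.2
    · intro m hm
      have hm0 := hlo.trans_le hm.1
      have hy := equilibrium_pos hp hσ hm0 θ
      refine ContinuousAt.continuousWithinAt ?_
      rw [ContinuousAt, tendsto_iff_dist_tendsto_zero]
      have hlim : Tendsto (fun m' => equilibrium p σ m θ / m * |m' - m|) (𝓝 m) (𝓝 0) := by
        have : Continuous fun m' => equilibrium p σ m θ / m * |m' - m| := by fun_prop
        simpa using this.tendsto m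
      refine squeeze_zero' (Eventually.of_forall fun _ => dist_nonneg) ?_ hlim
      filter_upwards [lt_mem_nhds hm0] with m' hm'
      have := mul_abs_sub_zero_le hp hσ hm0 (equilibrium_pos hp hσ hm' θ) hy
        (field_equilibrium hp hσ hm' θ) (field_equilibrium hp hσ hm0 θ)
      rw [sub_self, abs_zero, mul_zero, add_zero] at this
      rw [Real.dist_eq, div_mul_eq_mul_div, le_div_iff₀ hm0]
      linarith
  -- The averaged equilibrium maps `[lo, hi]` to itself, so subtracting the identity changes sign
  -- between the end points.
  have h1 : lo ≤ ∫ θ, equilibrium p σ lo θ ∂π := by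
    have := integral_mono_ae (integrable_const lo) (hint lo ⟨le_rfl, hlohi⟩)
      ((hbd lo ⟨le_rfl, hlohi⟩).mono fun θ h => h.1)
    simpa using this
  have h2 : ∫ θ, equilibrium p σ hi θ ∂π ≤ hi := by
    have := integral_mono_ae (hint hi ⟨hlohi, le_rfl⟩) (integrable_const hi)
      ((hbd hi ⟨hlohi, le_rfl⟩).mono fun θ h => h.2)
    simpa using this
  obtain ⟨m, hm, hm0⟩ := intermediate_value_Icc' hlohi (hcont.sub continuousOn_id)
    (show (0 : ℝ) ∈ _ from ⟨by simpa using h2, by simpa using h1⟩)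
  exact ⟨m, hm, by simpa [sub_eq_zero] using hm0⟩

/-! ### Differential inequalities -/

lemma le_mul_exp_of_deriv_le {f f' : ℝ → ℝ} {k : ℝ} (hf : ContinuousOn f (Ici 0))
    (hf' : ∀ t, 0 ≤ t → HasDerivWithinAt f (f' t) (Ici t) t)
    (hle : ∀ t, 0 ≤ t → f' t ≤ -k * f t) {t : ℝ} (ht : 0 ≤ t) :
    f t ≤ f 0 * Real.exp (-k * t) := by
  have := le_gronwallBound_of_liminf_deriv_right_le (f := f) (f' := f') (δ := f 0) (K := -k)
    (ε := 0) (a := 0) (b := t) (hf.mono Icc_subset_Ici_self)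
    (fun x hx r hr => (hf' x hx.1).liminf_right_slope_le hr) le_rfl
    (fun x hx => by simpa using hle x hx.1) t ⟨ht, le_rfl⟩
  simpa [gronwallBound_ε0] using this

/-- With `B = 2 A / k` and `2 c ≤ k` one has `(k - c) B ≥ A`, so `B e ^ (-c t)` is a supersolution.
Subtracting it reduces to the unforced inequality. -/
lemma le_mul_exp_of_deriv_le_add {f f' : ℝ → ℝ} {k c A : ℝ} (hf : ContinuousOn f (Ici 0))
    (hf' : ∀ t, 0 ≤ t → HasDerivWithinAt f (f' t) (Ici t) t) (hk : 0 < k) (hck : 2 * c ≤ k)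
    (hA : 0 ≤ A) (h0 : 0 ≤ f 0)
    (hle : ∀ t, 0 ≤ t → f' t ≤ -k * f t + A * Real.exp (-c * t)) {t : ℝ} (ht : 0 ≤ t) :
    f t ≤ (f 0 + 2 * A / k) * Real.exp (-c * t) := by
  set B := 2 * A / k with hB
  have hB0 : 0 ≤ B := by positivity
  have hkB : k * B = 2 * A := by rw [hB]; field_simp
  have hd (t : ℝ) : HasDerivAt (fun t => B * Real.exp (-c * t))
      (B * (Real.exp (-c * t) * (-c))) t := by
    have : HasDerivAt (fun t : ℝ => -c * t) (-c) t := by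
      simpa using (hasDerivAt_id t).const_mul (-c)
    exact this.exp.const_mul B
  have h1 := le_mul_exp_of_deriv_le (f := fun t => f t - B * Real.exp (-c * t))
    (f' := fun t => f' t - B * (Real.exp (-c * t) * (-c))) (k := k)
    (hf.sub (by fun_prop)) (fun t ht => (hf' t ht).sub (hd t).hasDerivWithinAt) (fun t ht => by
      have h2 := hle t ht
      have h3 : 2 * (c * B) ≤ k * B := by nlinarith
      have h4 : 0 < Real.exp (-c * t) := Real.exp_pos _
      nlinarith) ht
  simp only [mul_zero, Real.exp_zero, mul_one] at h1
  have h2 : Real.exp (-k * t) ≤ Real.exp (-c * t) := by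
    apply Real.exp_le_exp.mpr
    nlinarith
  have h3 : (f 0 - B) * Real.exp (-k * t) ≤ f 0 * Real.exp (-c * t) := by
    have h4 : 0 < Real.exp (-k * t) := Real.exp_pos _
    nlinarith
  linarith

/-! ### The solution as a transport with self-consistent mean -/

/-- The interaction is linear in the other opinion and the total mass is one, so only the mean
remains. -/
lemma velocity_eq_field {p σ : ℝ} {ρ : Measure (ℝ × ℝ)} [IsProbabilityMeasure ρ]
    (hρ : Integrable (fun z : ℝ × ℝ => z.1) ρ) (y θ : ℝ) :
    velocity p σ ρ y θ = field p σ (∫ z, z.1 ∂ρ) y θ := by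
  rw [velocity, field, integral_sub hρ (integrable_const _)]
  simp

lemma IsSolution.velocity_eq {p σ : ℝ} {μ₀ : Measure (ℝ × ℝ)} {μ : ℝ → Measure (ℝ × ℝ)}
    (h : IsSolution p σ μ₀ μ) {t : ℝ} (ht : 0 ≤ t) (y θ : ℝ) :
    velocity p σ (μ t) y θ = field p σ (∫ z, z.1 ∂(μ t)) y θ := by
  have := h.prob t ht
  obtain ⟨K, h1, h2, h3⟩ := h.supp t
  refine velocity_eq_field ?_ y θ
  have hi := (continuous_fst.continuousOn (s := K)).integrableOn_compact (μ := μ t) h1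
  rwa [IntegrableOn, Measure.restrict_eq_self_of_ae_mem
    (ae_mem_of_support_subset (h3 t ⟨ht, le_rfl⟩))] at hi

/-- Regarding the mean as a given coefficient makes the equation linear. Only its values at
nonnegative times matter, which leaves freedom to extend it. -/
lemma IsSolution.isTransport {p σ : ℝ} {μ₀ : Measure (ℝ × ℝ)} {μ : ℝ → Measure (ℝ × ℝ)}
    (h : IsSolution p σ μ₀ μ) {m : ℝ → ℝ} (hm : ∀ t, 0 ≤ t → m t = ∫ z, z.1 ∂(μ t)) :
    IsTransport p σ m μ where
  prob := h.prob
  supp := h.supp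
  weakStar := h.weakStar
  weak φ h1 h2 h3 t ht := by
    rw [h.weak φ h1 h2 h3 t ht, h.initial]
    congr 1
    refine intervalIntegral.integral_congr fun s hs => ?_
    rw [uIcc_of_le ht.le] at hs
    simp only [h.velocity_eq hs.1, hm s hs.1]

/-! ### A priori bounds -/

/-- If the moments of a nonnegative function grow at most linearly in their order, the function
is at most one almost everywhere. -/
lemma ae_le_one_of_integral_pow_le {Ω : Type*} [MeasurableSpace Ω] {μ : Measure Ω}
    [IsFiniteMeasure μ] {f : Ω → ℝ} {A : ℝ} (hf : ∀ᵐ x ∂μ, 0 ≤ f x)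
    (hi : ∀ k : ℕ, Integrable (fun x => f x ^ k) μ)
    (hle : ∀ k : ℕ, 1 ≤ k → ∫ x, f x ^ k ∂μ ≤ 1 + A * k) : ∀ᵐ x ∂μ, f x ≤ 1 := by
  -- By Chebyshev the mass of `{r ≤ f}` is at most `(1 + A k) / r ^ k`, which tends to zero.
  have key (r : ℝ) (hr : 1 < r) : μ.real {x | r ≤ f x} = 0 := by
    have h1 (k : ℕ) (hk : 1 ≤ k) : μ.real {x | r ≤ f x} ≤ (1 + A * k) * r⁻¹ ^ k := by
      have h2 := mul_meas_ge_le_integral_of_nonneg (μ := μ) (f := fun x => f x ^ k)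
        (by filter_upwards [hf] with x hx using pow_nonneg hx k) (hi k) (r ^ k)
      have h3 : μ.real {x | r ≤ f x} ≤ μ.real {x | r ^ k ≤ f x ^ k} :=
        measureReal_mono fun x (hx : r ≤ f x) => pow_le_pow_left₀ (zero_le_one.trans hr.le) hx k
      have h4 : 0 < r ^ k := by positivity
      rw [inv_pow, ← div_eq_mul_inv, le_div_iff₀ h4]
      calc _ ≤ μ.real {x | r ^ k ≤ f x ^ k} * r ^ k := by gcongr
        _ ≤ _ := by rw [mul_comm]; exact h2.trans (hle k hk)
    have hlim : Tendsto (fun k : ℕ => (1 + A * k) * r⁻¹ ^ k) atTop (𝓝 0) := by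
      have hr1 : |r⁻¹| < 1 := by
        rw [abs_of_pos (by positivity)]; exact inv_lt_one_of_one_lt₀ hr
      have e1 := tendsto_pow_atTop_nhds_zero_of_abs_lt_one hr1
      have e2 := (tendsto_self_mul_const_pow_of_abs_lt_one hr1).const_mul A
      have := e1.add e2
      simp only [mul_zero, add_zero] at this
      refine this.congr fun k => by ring
    exact le_antisymm (ge_of_tendsto hlim (by
      filter_upwards [eventually_ge_atTop 1] with k hk using h1 k hk)) measureReal_nonneg
  have h2 (n : ℕ) : ∀ᵐ x ∂μ, f x < 1 + 1 / ((n : ℝ) + 1) := by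
    have h3 : (1 : ℝ) < 1 + 1 / ((n : ℝ) + 1) := lt_add_of_pos_right _ (by positivity)
    have h4 := key _ h3
    rw [measureReal_eq_zero_iff] at h4
    rw [ae_iff]
    simpa only [not_lt] using h4
  filter_upwards [ae_all_iff.mpr h2] with x hx
  refine ge_of_tendsto (x := atTop) (f := fun n : ℕ => 1 + 1 / ((n : ℝ) + 1)) ?_
    (Eventually.of_forall fun n => (hx n).le)
  simpa using (tendsto_one_div_add_atTop_nhds_zero_nat (𝕜 := ℝ)).const_add 1

namespace IsTransport

variable {p σ : ℝ} {m : ℝ → ℝ} {ρ : ℝ → Measure (ℝ × ℝ)}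

lemma integral_comp_snd (h : IsTransport p σ m ρ) {f : ℝ → ℝ} (hf : ContDiff ℝ ∞ f) {t : ℝ}
    (ht : 0 ≤ t) : ∫ x, f x.2 ∂(ρ t) = ∫ x, f x.2 ∂(ρ 0) := by
  have := h.integral_eq (ψ := fun x => f x.2) (ψ' := fun _ => 0)
    (hf.comp contDiff_snd).contDiffOn (fun x _ => hasDerivAt_const x.1 (f x.2)) ht
  simpa using this

lemma ae_snd_mem (h : IsTransport p σ m ρ) {θ₁ θ₂ : ℝ} (h0 : ∀ᵐ x ∂(ρ 0), x.2 ∈ Icc θ₁ θ₂)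
    {t : ℝ} (ht : 0 ≤ t) : ∀ᵐ x ∂(ρ t), x.2 ∈ Icc θ₁ θ₂ := by
  -- A smooth nonnegative function whose zero set is exactly `[θ₁, θ₂]`; its integral is conserved
  -- because convictions do not move.
  set f : ℝ → ℝ := fun θ => expNegInvGlue (θ - θ₂) + expNegInvGlue (θ₁ - θ) with hf
  have hfc : ContDiff ℝ ∞ f :=
    (expNegInvGlue.contDiff.comp (contDiff_id.sub contDiff_const)).add
      (expNegInvGlue.contDiff.comp (contDiff_const.sub contDiff_id))
  have hf0 (θ : ℝ) : 0 ≤ f θ := add_nonneg (expNegInvGlue.nonneg _) (expNegInvGlue.nonneg _)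
  have hz : ∫ x, f x.2 ∂(ρ 0) = 0 := by
    refine integral_eq_zero_of_ae ?_
    filter_upwards [h0] with x hx
    simp [hf, expNegInvGlue.zero_of_nonpos (sub_nonpos.mpr hx.1),
      expNegInvGlue.zero_of_nonpos (sub_nonpos.mpr hx.2)]
  have hi := h.integrable (f := fun x => f x.2)
    (hfc.continuous.comp continuous_snd).continuousOn ht
  rw [← h.integral_comp_snd hfc ht,
    integral_eq_zero_iff_of_nonneg (f := fun x : ℝ × ℝ => f x.2) (fun x => hf0 x.2) hi] at hz
  filter_upwards [hz] with x hx
  have hx' : f x.2 = 0 := hx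
  have e1 : expNegInvGlue (x.2 - θ₂) = 0 := le_antisymm
    (by linarith [expNegInvGlue.nonneg (θ₁ - x.2)]) (expNegInvGlue.nonneg _)
  have e2 : expNegInvGlue (θ₁ - x.2) = 0 := by linarith
  rw [expNegInvGlue.zero_iff_nonpos] at e1 e2
  exact ⟨by linarith, by linarith⟩

/-- For these exponents `y ^ α` is convex, so attraction to the mean cannot increase its integral.
Growth comes only from the confinement term, which is bounded by `B`. -/
lemma integral_rpow_le (h : IsTransport p σ m ρ)
    (hm : ∀ t, 0 ≤ t → m t = ∫ x, x.1 ∂(ρ t)) {α c B : ℝ}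
    (hα : 1 ≤ α ∨ α ≤ 0) {t : ℝ} (ht : 0 ≤ t)
    (h0 : ∀ᵐ x ∂(ρ 0), x.1 ^ α ≤ c ^ α)
    (hB : ∀ s ∈ Icc 0 t, ∀ᵐ x ∂(ρ s), α * (x.2 - x.1 ^ p) * x.1 ^ α ≤ B) (hσ : 0 < σ) :
    ∫ x, x.1 ^ α ∂(ρ t) ≤ c ^ α + t * (σ * B) := by
  have hrpow (β : ℝ) : ContinuousOn (fun x : ℝ × ℝ => x.1 ^ β) Quadrant :=
    continuousOn_fst.rpow_const fun x hx => Or.inl (ne_of_gt hx.1)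
  have hmc : ContinuousOn m (Ici 0) :=
    (h.continuousOn_integral continuousOn_fst).congr fun t ht => hm t ht
  have hψ : ContDiffOn ℝ ∞ (fun x : ℝ × ℝ => x.1 ^ α) Quadrant := fun x hx =>
    (contDiffAt_fst.rpow_const_of_ne (ne_of_gt hx.1)).contDiffWithinAt
  have hc' : ContinuousOn (fun x : ℝ × ℝ => α * x.1 ^ (α - 1)) Quadrant :=
    continuousOn_const.mul (hrpow _)
  rw [h.integral_eq hψ (ψ' := fun x => α * x.1 ^ (α - 1))
    (fun x hx => Real.hasDerivAt_rpow_const (Or.inl (ne_of_gt hx.1))) ht]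
  have hp0 := h.prob 0 le_rfl
  refine add_le_add ?_ ?_
  · calc ∫ x, x.1 ^ α ∂(ρ 0) ≤ ∫ _, c ^ α ∂(ρ 0) :=
        integral_mono_ae (h.integrable (hrpow α) le_rfl) (integrable_const _) h0
      _ = c ^ α := by simp
  have hJ := h.continuousOn_integral_field_mul hmc hc'
  have hstep (s : ℝ) (hs : s ∈ Icc 0 t) :
      ∫ x, field p σ (m s) x.1 x.2 * (α * x.1 ^ (α - 1)) ∂(ρ s) ≤ σ * B := by
    have := h.prob s hs.1
    have hid : Integrable (fun x : ℝ × ℝ => x.1) (ρ s) := h.integrable continuousOn_fst hs.1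
    have hid' : Integrable (fun x : ℝ × ℝ => m s - x.1) (ρ s) := (integrable_const _).sub hid
    have hmpos : 0 < m s := by
      rw [hm s hs.1]
      refine integral_pos_iff_support_of_nonneg_ae ?_ hid |>.mpr ?_
      · filter_upwards [h.ae_mem_quadrant hs.1] with x hx using le_of_lt hx.1
      · have : Function.support (fun x : ℝ × ℝ => x.1) =ᵐ[ρ s] univ := by
          rw [eventuallyEq_univ]
          filter_upwards [h.ae_mem_quadrant hs.1] with x hx using ne_of_gt hx.1
        rw [measure_congr this]
        simp
    calc _ ≤ ∫ x, ((m s - x.1) * (α * m s ^ (α - 1)) + σ * B) ∂(ρ s) := by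
          refine integral_mono_ae (h.integrable ((continuousOn_field p σ _).mul hc') hs.1)
            ((hid'.mul_const _).add (integrable_const _)) ?_
          filter_upwards [hB s hs, h.ae_mem_quadrant hs.1] with x hx hxq
          have hx0 : 0 < x.1 := hxq.1
          have e1 : x.1 ^ α = x.1 ^ (α - 1) * x.1 := by
            rw [← Real.rpow_add_one hx0.ne']; ring_nf
          -- The derivative `α u ^ (α - 1)` is monotone. Replacing its argument by the mean makes
          -- the right-hand side integrate to zero.
          have e2 : (m s - x.1) * (α * x.1 ^ (α - 1)) ≤ (m s - x.1) * (α * m s ^ (α - 1)) := by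
            have mono : ∀ u v : ℝ, 0 < u → u ≤ v → α * u ^ (α - 1) ≤ α * v ^ (α - 1) := by
              intro u v hu huv
              rcases hα with hα | hα
              · exact mul_le_mul_of_nonneg_left
                  (Real.rpow_le_rpow hu.le huv (by linarith)) (by linarith)
              · exact mul_le_mul_of_nonpos_left
                  (Real.rpow_le_rpow_of_nonpos hu huv (by linarith)) hα
            rcases le_total x.1 (m s) with hle | hle
            · exact mul_le_mul_of_nonneg_left (mono _ _ hx0 hle) (by linarith)
            · exact mul_le_mul_of_nonpos_left (mono _ _ hmpos hle) (by linarith)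
          have e3 : field p σ (m s) x.1 x.2 * (α * x.1 ^ (α - 1)) =
              (m s - x.1) * (α * x.1 ^ (α - 1)) +
              σ * (α * (x.2 - x.1 ^ p) * x.1 ^ α) := by
            rw [field, e1]; ring
          simp only [e3]
          exact add_le_add e2 (mul_le_mul_of_nonneg_left hx hσ.le)
      _ = σ * B := by
          rw [integral_add (hid'.mul_const _) (integrable_const _),
            integral_mul_const, integral_sub (integrable_const _) hid, ← hm s hs.1]
          simp
  calc _ ≤ ∫ _ in (0 : ℝ)..t, σ * B := by
        refine intervalIntegral.integral_mono_on ht ?_ (by simp) hstep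
        exact (hJ.mono (by rw [uIcc_of_le ht]; exact Icc_subset_Ici_self)).intervalIntegrable
    _ = t * (σ * B) := by rw [intervalIntegral.integral_const, smul_eq_mul, sub_zero]

/-- Moments of order `-k`. The confinement term increases them only where `y ^ p` exceeds `θ ≥ a ^
p`, hence where `y ≥ a`. There it is at most `k |M| ^ p a ^ (-k)`, so the moments of `a / y` grow at
most linearly in `k`, which `ae_le_one_of_integral_pow_le` turns into a pointwise bound. -/
lemma ae_le_fst (h : IsTransport p σ m ρ) (hm : ∀ t, 0 ≤ t → m t = ∫ x, x.1 ∂(ρ t))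
    (hp : 0 < p) (hσ : 0 < σ) {a : ℝ} (ha : 0 < a) (h0 : ∀ᵐ x ∂(ρ 0), a ≤ x.1)
    (hθ : ∀ᵐ x ∂(ρ 0), a ^ p ≤ x.2) {t : ℝ} (ht : 0 ≤ t) : ∀ᵐ x ∂(ρ t), a ≤ x.1 := by
  obtain ⟨K, hK, hKQ, hae⟩ := h.ae_mem t
  obtain ⟨N, hN⟩ := (hK.image continuous_snd).bddAbove
  have hθN : ∀ᵐ x ∂(ρ 0), x.2 ∈ Icc (a ^ p) N := by
    filter_upwards [hθ, hae 0 ⟨le_rfl, ht⟩] with x h1 h2 using ⟨h1, hN ⟨x, h2, rfl⟩⟩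
  obtain ⟨M, hM⟩ := (hK.image continuous_fst).bddAbove
  have := h.prob t ht
  have hi (k : ℕ) : Integrable (fun x : ℝ × ℝ => (a / x.1) ^ k) (ρ t) := by
    refine h.integrable ((continuousOn_const.div continuousOn_fst fun x hx => ?_).pow k) ht
    exact ne_of_gt hx.1
  have key := ae_le_one_of_integral_pow_le (μ := ρ t) (f := fun x => a / x.1)
    (A := t * (σ * |M| ^ p)) ?_ hi ?_
  · filter_upwards [key, h.ae_mem_quadrant ht] with x hx hxq
    rwa [div_le_one (show 0 < x.1 from hxq.1)] at hx
  · filter_upwards [h.ae_mem_quadrant ht] with x hxq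
    exact div_nonneg ha.le (le_of_lt hxq.1)
  intro k hk
  have hk1 : (1 : ℝ) ≤ k := by exact_mod_cast hk
  have hk0 : -(k : ℝ) ≤ 0 := by linarith
  have e := h.integral_rpow_le hm (α := -k) (c := a) (B := k * |M| ^ p * a ^ (-(k : ℝ)))
    (Or.inr hk0) ht ?_ ?_ hσ
  · have e1 : ∫ x, (a / x.1) ^ k ∂(ρ t) = a ^ (k : ℝ) * ∫ x, x.1 ^ (-(k : ℝ)) ∂(ρ t) := by
      rw [← integral_const_mul]
      refine integral_congr_ae ?_
      filter_upwards [h.ae_mem_quadrant ht] with x hxq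
      rw [Real.rpow_neg (le_of_lt hxq.1), Real.rpow_natCast, Real.rpow_natCast, div_pow,
        div_eq_mul_inv]
    have e2 : a ^ (k : ℝ) * a ^ (-(k : ℝ)) = 1 := by rw [← Real.rpow_add ha]; simp
    rw [e1]
    calc _ ≤ a ^ (k : ℝ) * (a ^ (-(k : ℝ)) + t * (σ * (k * |M| ^ p * a ^ (-(k : ℝ))))) := by
          gcongr
      _ = a ^ (k : ℝ) * a ^ (-(k : ℝ)) * (1 + t * (σ * (k * |M| ^ p))) := by ring
      _ = _ := by rw [e2]; ring
  · filter_upwards [h0] with x hx using Real.rpow_le_rpow_of_nonpos ha hx hk0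
  · intro s hs
    filter_upwards [h.ae_snd_mem hθN hs.1, hae s hs] with x hxθ hxK
    have hx0 : 0 < x.1 := (hKQ hxK).1
    have hxM : x.1 ≤ |M| := (hM ⟨x, hxK, rfl⟩).trans (le_abs_self M)
    have hpw : 0 < x.1 ^ (-(k : ℝ)) := Real.rpow_pos_of_pos hx0 _
    rcases le_total (x.1 ^ p) x.2 with hle | hle
    · refine le_trans (mul_nonpos_of_nonpos_of_nonneg (mul_nonpos_of_nonpos_of_nonneg hk0
        (by linarith)) hpw.le) (by positivity)
    · have hax : a ≤ x.1 := by
        rw [← Real.rpow_le_rpow_iff ha.le hx0.le hp]; exact hxθ.1.trans hle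
      have h1 : x.1 ^ p - x.2 ≤ |M| ^ p := by
        have := Real.rpow_le_rpow hx0.le hxM hp.le
        have h2 : 0 < a ^ p := by positivity
        linarith [hxθ.1]
      have h2 : x.1 ^ (-(k : ℝ)) ≤ a ^ (-(k : ℝ)) := Real.rpow_le_rpow_of_nonpos ha hax hk0
      calc -(k : ℝ) * (x.2 - x.1 ^ p) * x.1 ^ (-(k : ℝ))
          = k * (x.1 ^ p - x.2) * x.1 ^ (-(k : ℝ)) := by ring
        _ ≤ k * |M| ^ p * a ^ (-(k : ℝ)) := by gcongr

/-- The mirror image, with positive powers: the confinement term increases them only where `y ≤ b`.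
-/
lemma ae_fst_le (h : IsTransport p σ m ρ) (hm : ∀ t, 0 ≤ t → m t = ∫ x, x.1 ∂(ρ t))
    (hp : 0 < p) (hσ : 0 < σ) {b : ℝ} (hb : 0 < b) (h0 : ∀ᵐ x ∂(ρ 0), x.1 ≤ b)
    (hθ : ∀ᵐ x ∂(ρ 0), x.2 ≤ b ^ p) {t : ℝ} (ht : 0 ≤ t) : ∀ᵐ x ∂(ρ t), x.1 ≤ b := by
  have hθN : ∀ᵐ x ∂(ρ 0), x.2 ∈ Icc 0 (b ^ p) := by
    filter_upwards [hθ, h.ae_mem_quadrant le_rfl] with x h1 h2 using ⟨le_of_lt h2.2, h1⟩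
  have := h.prob t ht
  have hi (k : ℕ) : Integrable (fun x : ℝ × ℝ => (x.1 / b) ^ k) (ρ t) :=
    h.integrable ((continuousOn_fst.div_const b).pow k) ht
  have key := ae_le_one_of_integral_pow_le (μ := ρ t) (f := fun x => x.1 / b)
    (A := t * (σ * b ^ p)) ?_ hi ?_
  · filter_upwards [key] with x hx
    rwa [div_le_one hb] at hx
  · filter_upwards [h.ae_mem_quadrant ht] with x hxq
    exact div_nonneg (le_of_lt hxq.1) hb.le
  intro k hk
  have hk1 : (1 : ℝ) ≤ k := by exact_mod_cast hk
  have e := h.integral_rpow_le hm (α := k) (c := b) (B := k * b ^ p * b ^ (k : ℝ))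
    (Or.inl hk1) ht ?_ ?_ hσ
  · have e1 : ∫ x, (x.1 / b) ^ k ∂(ρ t) = (b ^ (k : ℝ))⁻¹ * ∫ x, x.1 ^ (k : ℝ) ∂(ρ t) := by
      rw [← integral_const_mul]
      refine integral_congr_ae (Eventually.of_forall fun x => ?_)
      simp only [Real.rpow_natCast, div_pow]
      rw [div_eq_inv_mul]
    have e2 : (b ^ (k : ℝ))⁻¹ * b ^ (k : ℝ) = 1 := inv_mul_cancel₀ (by positivity)
    rw [e1]
    calc _ ≤ (b ^ (k : ℝ))⁻¹ * (b ^ (k : ℝ) + t * (σ * (k * b ^ p * b ^ (k : ℝ)))) := by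
          gcongr
      _ = (b ^ (k : ℝ))⁻¹ * b ^ (k : ℝ) * (1 + t * (σ * (k * b ^ p))) := by ring
      _ = _ := by rw [e2]; ring
  · filter_upwards [h0, h.ae_mem_quadrant le_rfl] with x hx hxq
    exact Real.rpow_le_rpow (le_of_lt hxq.1) hx (by linarith)
  · intro s hs
    filter_upwards [h.ae_snd_mem hθN hs.1, h.ae_mem_quadrant hs.1] with x hxθ hxq
    have hx0 : 0 < x.1 := hxq.1
    have hpw : 0 < x.1 ^ (k : ℝ) := Real.rpow_pos_of_pos hx0 _
    rcases le_total x.2 (x.1 ^ p) with hle | hle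
    · refine le_trans (mul_nonpos_of_nonpos_of_nonneg (mul_nonpos_of_nonneg_of_nonpos
        (by linarith) (by linarith)) hpw.le) (by positivity)
    · have hbx : x.1 ≤ b := by
        rw [← Real.rpow_le_rpow_iff hx0.le hb.le hp]; exact hle.trans hxθ.2
      have h1 : x.2 - x.1 ^ p ≤ b ^ p := by
        have : 0 < x.1 ^ p := Real.rpow_pos_of_pos hx0 _
        linarith [hxθ.2]
      have h2 : x.1 ^ (k : ℝ) ≤ b ^ (k : ℝ) := Real.rpow_le_rpow hx0.le hbx (by linarith)
      gcongr

end IsTransport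

/-! ### Exponential decay towards the equilibrium profile -/

section Decay

variable {p σ M lo hi a b : ℝ}

/-- The linear dissipation about `g` contributes at least `2 k (y - g) ^ 2`. Half of it absorbs the
error in the mean by Young's inequality. -/
lemma field_mul_two_mul_sub_le (hp : 0 < p) (hσ : 0 < σ) {y g θ m k : ℝ}
    (hy : 0 < y) (hg : 0 < g) (h : field p σ M g θ = 0) (hk : 0 < k) (hkg : k * g ≤ M) :
    field p σ m y θ * (2 * (y - g)) ≤ -k * (y - g) ^ 2 + (m - M) ^ 2 / k := by
  have e : field p σ m y θ = (m - M) + field p σ M y θ := by simp only [field]; ring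
  rw [e, field_eq_of_zero hg h]
  have h1 := mul_nonneg (mul_pos hσ hy).le (rpow_sub_mul_sub_nonneg hp hy hg)
  have h2 : k * (y - g) ^ 2 ≤ M / g * (y - g) ^ 2 :=
    mul_le_mul_of_nonneg_right ((le_div_iff₀ hg).mpr hkg) (sq_nonneg _)
  have h3 : 2 * (m - M) * (y - g) ≤ k * (y - g) ^ 2 + (m - M) ^ 2 / k := by
    have h4 : 0 ≤ (k * (y - g) - (m - M)) ^ 2 / k := by positivity
    have h5 : (k * (y - g) - (m - M)) ^ 2 / k =
        k * (y - g) ^ 2 - 2 * (m - M) * (y - g) + (m - M) ^ 2 / k := by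
      field_simp; ring
    linarith
  nlinarith

lemma equilibrium_mem_Icc (hp : 0 < p) (hσ : 0 < σ) (hlo : 0 < lo) (hM : M ∈ Icc lo hi) {θ : ℝ}
    (hθ : θ ∈ Icc (lo ^ p) (hi ^ p)) : equilibrium p σ M θ ∈ Icc lo hi :=
  have hM0 := hlo.trans_le hM.1
  ⟨le_equilibrium hp hσ hM0 hlo hM.1 hθ.1,
    equilibrium_le hp hσ hM0 (hM0.trans_le hM.2) hM.2 hθ.2⟩

/-- This makes `lo / hi` a contraction rate that is uniform in the conviction. -/
lemma div_mul_equilibrium_le (hp : 0 < p) (hσ : 0 < σ) (hlo : 0 < lo) (hM : M ∈ Icc lo hi)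
    {θ : ℝ} (hθ : θ ∈ Icc (lo ^ p) (hi ^ p)) : lo / hi * equilibrium p σ M θ ≤ M := by
  have hhi := hlo.trans_le (hM.1.trans hM.2)
  have h := equilibrium_mem_Icc hp hσ hlo hM hθ
  rw [div_mul_eq_mul_div, div_le_iff₀ hhi]
  exact mul_le_mul hM.1 h.2 (hlo.le.trans h.1) (hlo.le.trans hM.1)

lemma sq_sub_le_sq_sub {y g : ℝ} (hy : y ∈ Icc a b) (hg : g ∈ Icc a b) :
    (y - g) ^ 2 ≤ (b - a) ^ 2 :=
  sq_le_sq.mpr (by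
    rw [abs_of_nonneg (by linarith [hy.1, hy.2] : 0 ≤ b - a)]
    exact abs_sub_le_iff.mpr ⟨by linarith [hy.2, hg.1], by linarith [hy.1, hg.2]⟩)

namespace IsTransport

variable {m : ℝ → ℝ} {ρ : ℝ → Measure (ℝ × ℝ)}

lemma hasDerivWithinAt_integral_sq_sub (h : IsTransport p σ m ρ) (hm : ContinuousOn m (Ici 0))
    {g : ℝ → ℝ} (hg : ContDiff ℝ ∞ g) {t : ℝ} (ht : 0 ≤ t) :
    HasDerivWithinAt (fun t => ∫ x, (x.1 - g x.2) ^ 2 ∂(ρ t))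
      (∫ x, field p σ (m t) x.1 x.2 * (2 * (x.1 - g x.2)) ∂(ρ t)) (Ici t) t := by
  have hgc := hg.continuous
  refine h.hasDerivWithinAt_integral hm (ψ := fun x => (x.1 - g x.2) ^ 2)
    (ψ' := fun x => 2 * (x.1 - g x.2))
    ((contDiff_fst.sub (hg.comp contDiff_snd)).pow 2).contDiffOn
    (by fun_prop) (fun x _ => ?_) ht
  have := ((hasDerivAt_id x.1).sub_const (g x.2)).fun_pow 2
  simpa using this

lemma integral_sq_sub_zero_le (h : IsTransport p σ m ρ) {g : ℝ → ℝ} (hg : Continuous g)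
    (h0 : ∀ᵐ x ∂(ρ 0), x.1 ∈ Icc a b) (hg0 : ∀ᵐ x ∂(ρ 0), g x.2 ∈ Icc a b) :
    ∫ x, (x.1 - g x.2) ^ 2 ∂(ρ 0) ≤ (b - a) ^ 2 := by
  have := h.prob 0 le_rfl
  calc _ ≤ ∫ _, (b - a) ^ 2 ∂(ρ 0) := by
        refine integral_mono_ae (h.integrable (by fun_prop) le_rfl) (integrable_const _) ?_
        filter_upwards [h0, hg0] with x hx hgx using sq_sub_le_sq_sub hx hgx
    _ = _ := by simp

/-- Decay of the second moment about the equilibrium profile, for a transport whose mean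
approaches the mean of the profile. -/
lemma integral_sq_sub_le (h : IsTransport p σ m ρ) (hm : ContinuousOn m (Ici 0))
    (hp : 0 < p) (hσ : 0 < σ) (hlo : 0 < lo) (hM : M ∈ Icc lo hi)
    (hlob : Icc lo hi ⊆ Icc a b) (h0 : ∀ᵐ x ∂(ρ 0), x.1 ∈ Icc a b)
    (hθ : ∀ᵐ x ∂(ρ 0), x.2 ∈ Icc (lo ^ p) (hi ^ p)) {A c : ℝ} (hA : 0 ≤ A)
    (hc : 2 * c ≤ lo / hi) (hmM : ∀ t, 0 ≤ t → (m t - M) ^ 2 ≤ A * Real.exp (-c * t))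
    {t : ℝ} (ht : 0 ≤ t) :
    ∫ x, (x.1 - equilibrium p σ M x.2) ^ 2 ∂(ρ t) ≤
      ((b - a) ^ 2 + 2 * (A / (lo / hi)) / (lo / hi)) * Real.exp (-c * t) := by
  have hM0 := hlo.trans_le hM.1
  have hhi := hM0.trans_le hM.2
  have hk : 0 < lo / hi := div_pos hlo hhi
  have hg := contDiff_equilibrium hp hσ hM0
  have hgc := hg.continuous
  have hE0 := h.integral_sq_sub_zero_le hgc h0 (by
    filter_upwards [hθ] with x hx using hlob (equilibrium_mem_Icc hp hσ hlo hM hx))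
  refine (le_mul_exp_of_deriv_le_add (h.continuousOn_integral (by fun_prop))
    (fun t ht => h.hasDerivWithinAt_integral_sq_sub hm hg ht) hk hc
    (div_nonneg hA hk.le) (integral_nonneg fun x => sq_nonneg _) (fun s hs => ?_) ht).trans
    (mul_le_mul_of_nonneg_right (by linarith) (Real.exp_pos _).le)
  have hprob := h.prob s hs
  have hi2 : Integrable (fun x : ℝ × ℝ => (x.1 - equilibrium p σ M x.2) ^ 2) (ρ s) :=
    h.integrable (by fun_prop) hs
  calc _ ≤ ∫ x, (-(lo / hi) * (x.1 - equilibrium p σ M x.2) ^ 2 +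
        (m s - M) ^ 2 / (lo / hi)) ∂(ρ s) := by
        refine integral_mono_ae (h.integrable ((continuousOn_field p σ _).mul (by fun_prop)) hs)
          ((hi2.const_mul _).add (integrable_const _)) ?_
        filter_upwards [h.ae_mem_quadrant hs, h.ae_snd_mem hθ hs] with x hxq hx
        exact field_mul_two_mul_sub_le hp hσ hxq.1 (equilibrium_pos hp hσ hM0 _)
          (field_equilibrium hp hσ hM0 _) hk (div_mul_equilibrium_le hp hσ hlo hM hx)
    _ = -(lo / hi) * ∫ x, (x.1 - equilibrium p σ M x.2) ^ 2 ∂(ρ s) +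
        (m s - M) ^ 2 / (lo / hi) := by
        rw [integral_add (hi2.const_mul _) (integrable_const _), integral_const_mul]
        simp
    _ ≤ _ := by
        rw [div_mul_eq_mul_div A]
        gcongr
        exact hmM s hs

/-- For a self-consistent transport the second moment about the equilibrium profile, and with
it the mean, converges exponentially. -/
lemma sq_mean_sub_le (h : IsTransport p σ m ρ) (hm : ∀ t, 0 ≤ t → m t = ∫ x, x.1 ∂(ρ t))
    (hp : 0 < p) (hσ : 0 < σ) (ha : 0 < a) (hlo : 0 < lo) (hM : M ∈ Icc lo hi)
    (hlob : Icc lo hi ⊆ Icc a b) (h0 : ∀ᵐ x ∂(ρ 0), x.1 ∈ Icc a b)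
    (hθ : ∀ᵐ x ∂(ρ 0), x.2 ∈ Icc (lo ^ p) (hi ^ p))
    (hMeq : ∫ x, equilibrium p σ M x.2 ∂(ρ 0) = M) {c : ℝ}
    (hc : ∀ y ∈ Icc a b, ∀ g ∈ Icc a b, c * (y - g) ^ 2 ≤ y * (y ^ p - g ^ p) * (y - g))
    {t : ℝ} (ht : 0 ≤ t) :
    (m t - M) ^ 2 ≤ (b - a) ^ 2 * Real.exp (-(2 * σ * c) * t) := by
  have hM0 := hlo.trans_le hM.1
  have hhi := hM0.trans_le hM.2
  have hlohi := hM.1.trans hM.2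
  have hal : a ≤ lo := (hlob ⟨le_rfl, hlohi⟩).1
  have hhb : hi ≤ b := (hlob ⟨hlohi, le_rfl⟩).2
  have hg := contDiff_equilibrium hp hσ hM0
  have hgc := hg.continuous
  have hmc : ContinuousOn m (Ici 0) :=
    (h.continuousOn_integral continuousOn_fst).congr fun t ht => hm t ht
  -- The strip `[a, b]` is invariant, which makes the strong monotonicity `hc` available at all
  -- times.
  have hmem (s : ℝ) (hs : 0 ≤ s) : ∀ᵐ x ∂(ρ s), x.1 ∈ Icc a b := by
    filter_upwards [h.ae_le_fst hm hp hσ ha (h0.mono fun x hx => hx.1)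
      (hθ.mono fun x hx => (Real.rpow_le_rpow ha.le hal hp.le).trans hx.1) hs,
      h.ae_fst_le hm hp hσ (hhi.trans_le hhb) (h0.mono fun x hx => hx.2)
      (hθ.mono fun x hx => hx.2.trans (Real.rpow_le_rpow hhi.le hhb hp.le)) hs] with x h1 h2
      using ⟨h1, h2⟩
  have hgint (s : ℝ) (hs : 0 ≤ s) : ∫ x, equilibrium p σ M x.2 ∂(ρ s) = M := by
    rw [h.integral_comp_snd hg hs, hMeq]
  have hi1 (s : ℝ) (hs : 0 ≤ s) :
      Integrable (fun x : ℝ × ℝ => x.1 - equilibrium p σ M x.2) (ρ s) :=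
    h.integrable (by fun_prop) hs
  have hig (s : ℝ) (hs : 0 ≤ s) : Integrable (fun x : ℝ × ℝ => equilibrium p σ M x.2) (ρ s) :=
    h.integrable (by fun_prop) hs
  have hmd (s : ℝ) (hs : 0 ≤ s) : ∫ x, (x.1 - equilibrium p σ M x.2) ∂(ρ s) = m s - M := by
    rw [integral_sub (h.integrable continuousOn_fst hs) (hig s hs), hgint s hs, hm s hs]
  have hi2 (s : ℝ) (hs : 0 ≤ s) :
      Integrable (fun x : ℝ × ℝ => (x.1 - equilibrium p σ M x.2) ^ 2) (ρ s) :=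
    h.integrable (by fun_prop) hs
  have hD : ∫ x, (x.1 - equilibrium p σ M x.2) ^ 2 ∂(ρ t) ≤
      (b - a) ^ 2 * Real.exp (-(2 * σ * c) * t) := by
    have hE0 := h.integral_sq_sub_zero_le hgc h0 (by
      filter_upwards [hθ] with x hx using hlob (equilibrium_mem_Icc hp hσ hlo hM hx))
    refine (le_mul_exp_of_deriv_le (h.continuousOn_integral (by fun_prop))
      (fun t ht => h.hasDerivWithinAt_integral_sq_sub hmc hg ht) (fun s hs => ?_) ht).trans
      (mul_le_mul_of_nonneg_right hE0 (Real.exp_pos _).le)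
    have hprob := h.prob s hs
    set d := m s - M with hd
    have j1 : Integrable (fun x : ℝ × ℝ => -(2 * d) * (x.1 - equilibrium p σ M x.2)) (ρ s) :=
      (hi1 s hs).const_mul _
    have j2 : Integrable (fun x : ℝ × ℝ => 2 * d ^ 2 / M * equilibrium p σ M x.2) (ρ s) :=
      (hig s hs).const_mul _
    have j3 : Integrable (fun x : ℝ × ℝ => -(2 * σ * c) * (x.1 - equilibrium p σ M x.2) ^ 2)
      (ρ s) := (hi2 s hs).const_mul _
    -- A pointwise form of Cauchy–Schwarz. As `∫ (y - g) = d` and `∫ g = M`, the first two terms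
    -- integrate to `-2 d ^ 2 + 2 d ^ 2 = 0`, and only the decay term remains.
    calc _ ≤ ∫ x, (-(2 * d) * (x.1 - equilibrium p σ M x.2) +
          2 * d ^ 2 / M * equilibrium p σ M x.2 +
          -(2 * σ * c) * (x.1 - equilibrium p σ M x.2) ^ 2) ∂(ρ s) := by
          refine integral_mono_ae
            (h.integrable ((continuousOn_field p σ _).mul (by fun_prop)) hs)
            ((j1.add j2).add j3) ?_
          filter_upwards [hmem s hs, h.ae_snd_mem hθ hs] with x hx1 hx2
          have hgx := hlob (equilibrium_mem_Icc hp hσ hlo hM hx2)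
          have hg0 := equilibrium_pos hp hσ hM0 x.2
          have hfg := field_equilibrium hp hσ hM0 x.2
          have hcx := hc _ hx1 _ hgx
          set g := equilibrium p σ M x.2
          have e : field p σ (m s) x.1 x.2 = d + field p σ M x.1 x.2 := by
            simp only [field, hd]; ring
          rw [e, field_eq_of_zero hg0 hfg]
          -- This square is chosen so that its expansion bounds the linear dissipation below by `2 d
          -- (y - g) - d ^ 2 g / M`.
          have h4 : 0 ≤ (M * (x.1 - g) - d * g) ^ 2 / (M * g) := by positivity
          have h5 : (M * (x.1 - g) - d * g) ^ 2 / (M * g) =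
              M / g * (x.1 - g) ^ 2 - 2 * d * (x.1 - g) + d ^ 2 / M * g := by
            field_simp; ring
          have h6 := mul_le_mul_of_nonneg_left hcx hσ.le
          have h7 : 2 * d ^ 2 / M * g = 2 * (d ^ 2 / M * g) := by ring
          rw [h7]
          nlinarith
      _ = _ := by
          have j12 : Integrable (fun x : ℝ × ℝ => -(2 * d) * (x.1 - equilibrium p σ M x.2) +
            2 * d ^ 2 / M * equilibrium p σ M x.2) (ρ s) := j1.add j2
          rw [integral_add j12 j3, integral_add j1 j2, integral_const_mul,
            integral_const_mul, integral_const_mul, hmd s hs, hgint s hs]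
          field_simp
          ring
  refine le_trans ?_ hD
  have hprob := h.prob t ht
  rw [← hmd t ht]
  -- Nonnegativity of the variance of `y - g`, whose mean is `m t - M`.
  have h1 : 0 ≤ ∫ x, (x.1 - equilibrium p σ M x.2 - (m t - M)) ^ 2 ∂(ρ t) :=
    integral_nonneg fun x => sq_nonneg _
  have h2 : ∫ x, (x.1 - equilibrium p σ M x.2 - (m t - M)) ^ 2 ∂(ρ t) =
      ∫ x, (x.1 - equilibrium p σ M x.2) ^ 2 ∂(ρ t) - (m t - M) ^ 2 := by
    have e (x : ℝ × ℝ) : (x.1 - equilibrium p σ M x.2 - (m t - M)) ^ 2 =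
        (x.1 - equilibrium p σ M x.2) ^ 2 - 2 * (m t - M) * (x.1 - equilibrium p σ M x.2)
          + (m t - M) ^ 2 := by ring
    simp only [e]
    have j12 : Integrable (fun x : ℝ × ℝ => (x.1 - equilibrium p σ M x.2) ^ 2 -
      2 * (m t - M) * (x.1 - equilibrium p σ M x.2)) (ρ t) :=
      (hi2 t ht).sub ((hi1 t ht).const_mul _)
    rw [integral_add j12 (integrable_const _),
      integral_sub (hi2 t ht) ((hi1 t ht).const_mul _), integral_const_mul, hmd t ht]
    simp
    ring
  rw [hmd t ht]
  linarith

end IsTransport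

/-- Trajectories of the velocity field converge to the equilibrium. -/
lemma tendsto_equilibrium_of_hasDerivWithinAt {m Y : ℝ → ℝ} {θ : ℝ} (hp : 0 < p) (hσ : 0 < σ)
    (hlo : 0 < lo) (hM : M ∈ Icc lo hi) (hθ : θ ∈ Icc (lo ^ p) (hi ^ p)) {A c : ℝ}
    (hA : 0 ≤ A) (hc0 : 0 < c) (hc : 2 * c ≤ lo / hi)
    (hmM : ∀ t, 0 ≤ t → (m t - M) ^ 2 ≤ A * Real.exp (-c * t))
    (hpos : ∀ t, 0 ≤ t → 0 < Y t)
    (hY : ∀ t, 0 ≤ t → HasDerivWithinAt Y (field p σ (m t) (Y t) θ) (Ici 0) t) :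
    Tendsto Y atTop (𝓝 (equilibrium p σ M θ)) := by
  have hM0 := hlo.trans_le hM.1
  have hk : 0 < lo / hi := div_pos hlo (hM0.trans_le hM.2)
  set g := equilibrium p σ M θ with hg
  have hcont : ContinuousOn Y (Ici 0) := fun t ht => (hY t ht).continuousWithinAt
  have key (t : ℝ) (ht : 0 ≤ t) := le_mul_exp_of_deriv_le_add (f := fun t => (Y t - g) ^ 2)
    (f' := fun t => field p σ (m t) (Y t) θ * (2 * (Y t - g))) (k := lo / hi) (c := c)
    (A := A / (lo / hi)) (by fun_prop) (fun t ht => by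
      have := (((hY t ht).mono (Ici_subset_Ici.mpr ht)).sub_const g).fun_pow 2
      refine this.congr_deriv ?_
      simp
      ring) hk hc (div_nonneg hA hk.le) (sq_nonneg _) (fun t ht => by
      refine (field_mul_two_mul_sub_le hp hσ (hpos t ht) (equilibrium_pos hp hσ hM0 θ)
        (field_equilibrium hp hσ hM0 θ) hk (div_mul_equilibrium_le hp hσ hlo hM hθ)).trans ?_
      rw [div_mul_eq_mul_div A]
      gcongr
      exact hmM t ht) ht
  have hexp : Tendsto (fun t : ℝ => Real.exp (-c * t)) atTop (𝓝 0) :=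
    Real.tendsto_exp_atBot.comp (tendsto_id.const_mul_atTop_of_neg (neg_lt_zero.mpr hc0))
  have hsq : Tendsto (fun t => (Y t - g) ^ 2) atTop (𝓝 0) := by
    refine squeeze_zero' (Eventually.of_forall fun t => sq_nonneg _)
      (by filter_upwards [eventually_ge_atTop 0] with t ht using key t ht) ?_
    simpa using hexp.const_mul _
  have habs : Tendsto (fun t => |Y t - g|) atTop (𝓝 0) := by
    have := (Real.continuous_sqrt.tendsto 0).comp hsq
    simpa [Function.comp_def, Real.sqrt_sq_eq_abs] using this
  rw [tendsto_iff_dist_tendsto_zero]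
  simpa [Real.dist_eq] using habs

end Decay

/-! ### Wasserstein distances -/

lemma W1_dirac_le (κ : Measure ℝ) [IsProbabilityMeasure κ] (g : ℝ) :
    W1 κ (Measure.dirac g) ≤ ∫⁻ y, edist y g ∂κ := by
  have hmeas : Measurable fun y : ℝ => (y, g) := by fun_prop
  refine (iInf_le _ (κ.map fun y => (y, g))).trans ((iInf_le _ ?_).trans
    ((iInf_le _ ?_).trans ?_))
  · rw [Measure.map_map measurable_fst hmeas]
    exact Measure.map_id
  · rw [Measure.map_map measurable_snd hmeas]
    change κ.map (fun _ => g) = _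
    simp [Measure.map_const]
  · rw [lintegral_map (by fun_prop) hmeas]

lemma W1_dirac_le_of_integral_sq_le {κ : Measure ℝ} [IsProbabilityMeasure κ] {g C : ℝ}
    (hC : 0 < C) (hi : Integrable (fun y => (y - g) ^ 2) κ)
    (h : ∫ y, (y - g) ^ 2 ∂κ ≤ C ^ 2) : W1 κ (Measure.dirac g) ≤ ENNReal.ofReal C := by
  refine (W1_dirac_le κ g).trans ?_
  -- The weight `C` is the one for which both terms integrate to at most `C / 2`.
  have hpt (y : ℝ) : |y - g| ≤ (y - g) ^ 2 / (2 * C) + C / 2 := by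
    have h1 : 0 ≤ (|y - g| - C) ^ 2 / (2 * C) := by positivity
    have h2 : (|y - g| - C) ^ 2 / (2 * C) = (y - g) ^ 2 / (2 * C) + C / 2 - |y - g| := by
      rw [sub_sq, sq_abs]; field_simp; ring
    linarith
  have hi' : Integrable (fun y => (y - g) ^ 2 / (2 * C) + C / 2) κ :=
    (hi.div_const _).add (integrable_const _)
  calc ∫⁻ y, edist y g ∂κ ≤ ∫⁻ y, ENNReal.ofReal ((y - g) ^ 2 / (2 * C) + C / 2) ∂κ := by
        refine lintegral_mono fun y => ?_
        rw [edist_dist, Real.dist_eq]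
        exact ENNReal.ofReal_le_ofReal (hpt y)
    _ = ENNReal.ofReal (∫ y, ((y - g) ^ 2 / (2 * C) + C / 2) ∂κ) :=
        (ofReal_integral_eq_lintegral_ofReal hi'
          (Eventually.of_forall fun y => (abs_nonneg _).trans (hpt y))).symm
    _ ≤ ENNReal.ofReal C := by
        refine ENNReal.ofReal_le_ofReal ?_
        rw [integral_add (hi.div_const _) (integrable_const _), integral_div]
        simp only [integral_const, probReal_univ, one_smul]
        have : (∫ y, (y - g) ^ 2 ∂κ) / (2 * C) ≤ C ^ 2 / (2 * C) := by gcongr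
        have e : C ^ 2 / (2 * C) = C / 2 := by field_simp
        linarith

/-- One half of the Kantorovich–Rubinstein duality. -/
lemma ofReal_integral_sub_le_W1 {π π' : Measure ℝ} [IsProbabilityMeasure π]
    [IsProbabilityMeasure π'] {f : ℝ → ℝ} {L B : ℝ} (hL : 0 < L) (hfm : Continuous f)
    (hB : ∀ x, |f x| ≤ B) (hf : ∀ x y, |f x - f y| ≤ L * |x - y|) :
    ENNReal.ofReal (∫ x, f x ∂π - ∫ x, f x ∂π') ≤ ENNReal.ofReal L * W1 π π' := by
  simp only [W1]
  have hL0 : ENNReal.ofReal L ≠ 0 := by simpa using hL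
  rw [ENNReal.mul_iInf_of_ne hL0 (by simp)]
  refine le_iInf fun γ => ?_
  -- If a marginal of `γ` is wrong, the inner infimum is over an empty family and equals `⊤`; as `L
  -- > 0` the product is still `⊤`.
  by_cases h1 : γ.map Prod.fst = π
  swap
  · simp [h1, ENNReal.mul_top hL0]
  by_cases h2 : γ.map Prod.snd = π'
  swap
  · simp [h1, h2, ENNReal.mul_top hL0]
  simp only [h1, h2, iInf_pos]
  have hγ : IsProbabilityMeasure γ := by
    have : IsProbabilityMeasure (γ.map Prod.fst) := h1 ▸ inferInstance
    have h3 := measure_univ (μ := γ.map Prod.fst)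
    rw [Measure.map_apply measurable_fst .univ, preimage_univ] at h3
    exact ⟨h3⟩
  have i1 : Integrable (fun z : ℝ × ℝ => f z.1) γ := Integrable.of_bound
    (hfm.comp continuous_fst).aestronglyMeasurable B (Eventually.of_forall fun z => hB _)
  have i2 : Integrable (fun z : ℝ × ℝ => f z.2) γ := Integrable.of_bound
    (hfm.comp continuous_snd).aestronglyMeasurable B (Eventually.of_forall fun z => hB _)
  rw [← h1, ← h2, integral_map measurable_fst.aemeasurable hfm.aestronglyMeasurable,
    integral_map measurable_snd.aemeasurable hfm.aestronglyMeasurable, ← integral_sub i1 i2]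
  calc _ ≤ ‖∫ z, (f z.1 - f z.2) ∂γ‖ₑ := by
        rw [← ofReal_norm]
        exact ENNReal.ofReal_le_ofReal (le_abs_self _)
    _ ≤ ∫⁻ z, ‖f z.1 - f z.2‖ₑ ∂γ := enorm_integral_le_lintegral_enorm _
    _ ≤ ∫⁻ z, ENNReal.ofReal L * edist z.1 z.2 ∂γ := by
        refine lintegral_mono fun z => ?_
        rw [← ofReal_norm, edist_dist, Real.dist_eq, ← ENNReal.ofReal_mul hL.le]
        exact ENNReal.ofReal_le_ofReal (hf _ _)
    _ = _ := lintegral_const_mul _ (by fun_prop)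

/-! ### Uniqueness of the transport -/

/-- Compactly supported probability measures on the plane are determined by their moments. -/
lemma eq_of_integral_pow_mul_pow_eq {μ ν : Measure (ℝ × ℝ)} [IsProbabilityMeasure μ]
    [IsProbabilityMeasure ν] {K : Set (ℝ × ℝ)} (hK : IsCompact K) (hμ : ∀ᵐ x ∂μ, x ∈ K)
    (hν : ∀ᵐ x ∂ν, x ∈ K)
    (h : ∀ i j : ℕ, ∫ x, x.1 ^ i * x.2 ^ j ∂μ = ∫ x, x.1 ^ i * x.2 ^ j ∂ν) : μ = ν := by
  have hcs : CompactSpace K := isCompact_iff_compactSpace.mp hK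
  have hKm := hK.measurableSet
  set μ' : Measure K := μ.comap Subtype.val with hμ'
  set ν' : Measure K := ν.comap Subtype.val with hν'
  have tr (ρ : Measure (ℝ × ℝ)) (hρ : ∀ᵐ x ∂ρ, x ∈ K) (f : ℝ × ℝ → ℝ) :
      ∫ x : K, f x ∂(ρ.comap Subtype.val) = ∫ x, f x ∂ρ := by
    rw [integral_subtype_comap hKm, Measure.restrict_eq_self_of_ae_mem hρ]
  have prob (ρ : Measure (ℝ × ℝ)) [IsProbabilityMeasure ρ] (hρ : ∀ᵐ x ∂ρ, x ∈ K) :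
      IsProbabilityMeasure (ρ.comap (Subtype.val : K → ℝ × ℝ)) := by
    constructor
    rw [(MeasurableEmbedding.subtype_coe hKm).comap_apply, image_univ, Subtype.range_coe]
    exact (prob_compl_eq_zero_iff hKm).mp hρ
  have hpμ : IsProbabilityMeasure μ' := prob μ hμ
  have hpν : IsProbabilityMeasure ν' := prob ν hν
  have hint (ρ : Measure K) [IsProbabilityMeasure ρ] (f : C(K, ℝ)) : Integrable f ρ :=
    Integrable.of_bound f.continuous.aestronglyMeasurable ‖f‖
      (Eventually.of_forall fun x => f.norm_coe_le_norm x)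
  let X : C(K, ℝ) := ⟨fun x => x.1.1, by fun_prop⟩
  let Y : C(K, ℝ) := ⟨fun x => x.1.2, by fun_prop⟩
  -- The coordinates separate points, so Stone–Weierstrass makes the polynomials dense in `C(K, ℝ)`.
  set A : Subalgebra ℝ C(K, ℝ) := Algebra.adjoin ℝ {X, Y} with hA
  have hsep : A.SeparatesPoints := by
    intro x y hxy
    by_cases h1 : x.1.1 = y.1.1
    · refine ⟨Y, ⟨Y, Algebra.subset_adjoin (by simp), rfl⟩, fun h2 => hxy ?_⟩
      exact Subtype.ext (Prod.ext h1 h2)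
    · exact ⟨X, ⟨X, Algebra.subset_adjoin (by simp), rfl⟩, h1⟩
  have hAeq (f : C(K, ℝ)) (hf : f ∈ A) : ∫ x, f x ∂μ' = ∫ x, f x ∂ν' := by
    rw [← Subalgebra.mem_toSubmodule, hA, Algebra.adjoin_eq_span] at hf
    induction hf using Submodule.span_induction with
    | mem f hf =>
      obtain ⟨i, j, rfl⟩ := (Submonoid.mem_closure_pair X Y f).mp hf
      have e1 := tr μ hμ fun x => x.1 ^ i * x.2 ^ j
      have e2 := tr ν hν fun x => x.1 ^ i * x.2 ^ j
      exact e1.trans ((h i j).trans e2.symm)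
    | zero => simp
    | add f g _ _ hf hg =>
      simp only [ContinuousMap.add_apply]
      rw [integral_add (hint _ f) (hint _ g), integral_add (hint _ f) (hint _ g), hf, hg]
    | smul c f _ hf =>
      simp only [ContinuousMap.smul_apply, smul_eq_mul, integral_const_mul, hf]
  refine ext_of_forall_integral_eq_of_IsFiniteMeasure fun f => ?_
  let f' : C(K, ℝ) := ⟨fun x => f x.1, by fun_prop⟩
  have hf' : f' ∈ closure (A : Set C(K, ℝ)) := by
    have := ContinuousMap.subalgebra_topologicalClosure_eq_top_of_separatesPoints A hsep
    rw [← Subalgebra.topologicalClosure_coe, this]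
    trivial
  rw [← tr μ hμ, ← tr ν hν]
  change ∫ x, f' x ∂μ' = ∫ x, f' x ∂ν'
  refine eq_of_forall_dist_le fun ε hε => ?_
  obtain ⟨g, hg, hfg⟩ := Metric.mem_closure_iff.mp hf' (ε / 2) (by positivity)
  have hb (ρ : Measure K) [IsProbabilityMeasure ρ] :
      ‖∫ x, f' x ∂ρ - ∫ x, g x ∂ρ‖ ≤ ε / 2 := by
    rw [← integral_sub (hint ρ f') (hint ρ g)]
    have := norm_integral_le_of_norm_le_const (μ := ρ) (f := fun x => f' x - g x) (C := ε / 2)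
      (Eventually.of_forall fun x => by
        rw [← dist_eq_norm]
        exact (ContinuousMap.dist_apply_le_dist x).trans hfg.le)
    simpa using this
  have h1 := hb μ'
  have h2 := hb ν'
  rw [hAeq g hg] at h1
  rw [Real.norm_eq_abs] at h1 h2
  rw [Real.dist_eq]
  calc _ = |(∫ x, f' x ∂μ' - ∫ x, g x ∂ν') - (∫ x, f' x ∂ν' - ∫ x, g x ∂ν')| := by ring_nf
    _ ≤ _ := (abs_sub _ _).trans (by linarith)

/-- The majorant for the `n`-th iterate of the moment hierarchy. -/
noncomputable def hierarchyBound (R Q q : ℝ) (n : ℕ) (a w : ℝ) : ℝ :=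
  2 * R ^ a * (Q ^ n * (w ^ n / n.factorial) * ∏ i ∈ Finset.range n, (a + i * q))

lemma hierarchyBound_mono {R Q q : ℝ} (hR : 1 ≤ R) (hQ : 0 ≤ Q) (hq : 0 ≤ q) (n : ℕ) {a b w : ℝ}
    (ha : 0 ≤ a) (hab : a ≤ b) (hw : 0 ≤ w) :
    hierarchyBound R Q q n a w ≤ hierarchyBound R Q q n b w := by
  have hR0 : 0 < R := by linarith
  unfold hierarchyBound
  have h1 : R ^ a ≤ R ^ b := Real.rpow_le_rpow_of_exponent_le hR hab
  have h2 : ∏ i ∈ Finset.range n, (a + i * q) ≤ ∏ i ∈ Finset.range n, (b + i * q) :=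
    Finset.prod_le_prod (fun i _ => by positivity) fun i _ => by linarith
  have h3 : 0 ≤ ∏ i ∈ Finset.range n, (a + i * q) :=
    Finset.prod_nonneg fun i _ => by positivity
  gcongr

/-- The product grows like `q ^ n n!` up to a factor `2 ^ (N + n)`. The factorial cancels the one
from iterated integration, leaving a geometric sequence of ratio `2 q Q w`. -/
lemma tendsto_hierarchyBound {R Q q : ℝ} (hR : 1 ≤ R) (hQ : 0 ≤ Q) (hq : 1 ≤ q) {a w : ℝ}
    (ha : 0 ≤ a) (hw : 0 ≤ w) (hs : 2 * q * Q * w < 1) :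
    Tendsto (fun n => hierarchyBound R Q q n a w) atTop (𝓝 0) := by
  have hR0 : 0 < R := by linarith
  set N := ⌈a⌉₊ with hN
  have hb (n : ℕ) : hierarchyBound R Q q n a w ≤
      2 * R ^ a * 2 ^ N * (2 * q * Q * w) ^ n := by
    have h1 : ∏ i ∈ Finset.range n, (a + i * q) ≤ q ^ n * (n.factorial * 2 ^ (N + n)) := by
      calc ∏ i ∈ Finset.range n, (a + i * q)
          ≤ ∏ i ∈ Finset.range n, (q * ((N + i : ℕ) : ℝ)) := by
            refine Finset.prod_le_prod (fun i _ => by positivity) fun i _ => ?_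
            have : a ≤ N := Nat.le_ceil a
            have h2 : (N : ℝ) ≤ q * N := by
              have : (0 : ℝ) ≤ N := by positivity
              nlinarith
            push_cast
            linarith
        _ = q ^ n * ((N.ascFactorial n : ℕ) : ℝ) := by
            rw [Finset.prod_mul_distrib, Nat.ascFactorial_eq_prod_range]
            simp
        _ ≤ _ := by
            gcongr
            rw [Nat.ascFactorial_eq_factorial_mul_choose']
            push_cast
            gcongr
            have h3 : (N + n - 1).choose n ≤ 2 ^ (N + n) :=
              (Nat.choose_le_two_pow _ _).trans (Nat.pow_le_pow_right (by norm_num) (by omega))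
            exact_mod_cast h3
    calc hierarchyBound R Q q n a w
        ≤ 2 * R ^ a * (Q ^ n * (w ^ n / n.factorial) *
          (q ^ n * (n.factorial * 2 ^ (N + n)))) := by
          unfold hierarchyBound
          gcongr
      _ = _ := by
          have : (n.factorial : ℝ) ≠ 0 := by positivity
          field_simp
          ring
  have h0 (n : ℕ) : 0 ≤ hierarchyBound R Q q n a w := by
    unfold hierarchyBound
    have h3 : 0 ≤ ∏ i ∈ Finset.range n, (a + i * q) :=
      Finset.prod_nonneg fun i _ => by positivity
    positivity
  refine squeeze_zero h0 hb ?_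
  have := (tendsto_pow_atTop_nhds_zero_of_lt_one (by positivity) hs).const_mul
    (2 * R ^ a * 2 ^ N)
  simpa using this

/-- A bounded solution of the linear moment hierarchy that starts at zero vanishes for a short
time, whose length only depends on the bounds. -/
lemma hierarchy_eq_zero {p σ B R : ℝ} (hp : 0 < p) (hσ : 0 < σ) (hB : 0 ≤ B) (hR : 1 ≤ R)
    {t₀ T : ℝ} {m : ℝ → ℝ} (hm : ∀ s ∈ Icc t₀ T, |m s| ≤ B) {d : ℝ → ℕ → ℝ → ℝ}
    (hd : ∀ α j, ∀ t ∈ Icc t₀ T, d α j t = ∫ s in t₀..t, α * (m s * d (α - 1) j s - d α j s +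
      σ * d α (j + 1) s - σ * d (α + p) j s))
    (hbd : ∀ α j, ∀ t ∈ Icc t₀ T, |d α j t| ≤ 2 * R ^ (|α| + j)) {t : ℝ} (ht : t ∈ Icc t₀ T)
    (hshort : 2 * max 1 p * ((B + 1 + 2 * σ) * R ^ (max 1 p + 1)) * (t - t₀) < 1)
    (α : ℝ) (j : ℕ) : d α j t = 0 := by
  -- One step of the hierarchy raises `|α|` by at most `q` and `j` by at most one, at the cost of a
  -- factor `R ^ (q + 1)`; `Q` collects this and the coefficients.
  set q := max 1 p with hq
  set Q := (B + 1 + 2 * σ) * R ^ (q + 1) with hQ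
  have hR0 : 0 < R := by linarith
  have hq1 : 1 ≤ q := le_max_left _ _
  have hqp : p ≤ q := le_max_right _ _
  have hQ0 : 0 ≤ Q := by positivity
  set b : ℕ → ℝ → ℕ → ℝ → ℝ := fun n α j s => R ^ (j : ℝ) * hierarchyBound R Q q n |α| (s - t₀)
  have key (n : ℕ) : ∀ α j, ∀ t ∈ Icc t₀ T, |d α j t| ≤ b n α j t := by
    induction n with
    | zero =>
      intro α j t ht
      refine (hbd α j t ht).trans_eq ?_
      simp only [b, hierarchyBound, pow_zero, Nat.factorial_zero, Finset.range_zero,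
        Finset.prod_empty, Real.rpow_add hR0]
      ring
    | succ n ih =>
      intro α j t ht
      have hpt (s : ℝ) (hs : s ∈ Icc t₀ T) : |α * (m s * d (α - 1) j s - d α j s +
          σ * d α (j + 1) s - σ * d (α + p) j s)| ≤
          |α| * ((B + 1 + 2 * σ) *
            (R ^ ((j : ℝ) + 1) * hierarchyBound R Q q n (|α| + q) (s - t₀))) := by
        have hs0 : 0 ≤ s - t₀ := sub_nonneg.mpr hs.1
        have h1 (α' : ℝ) (j' : ℕ) (hα' : |α'| ≤ |α| + q) (hj : (j' : ℝ) ≤ j + 1) :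
            |d α' j' s| ≤ R ^ ((j : ℝ) + 1) * hierarchyBound R Q q n (|α| + q) (s - t₀) := by
          refine (ih α' j' s hs).trans ?_
          have e1 := hierarchyBound_mono hR hQ0 (by linarith : 0 ≤ q) n (abs_nonneg α') hα' hs0
          have e2 : R ^ (j' : ℝ) ≤ R ^ ((j : ℝ) + 1) :=
            Real.rpow_le_rpow_of_exponent_le hR hj
          have e3 : 0 ≤ hierarchyBound R Q q n |α'| (s - t₀) := by
            unfold hierarchyBound
            have h3 : 0 ≤ ∏ i ∈ Finset.range n, (|α'| + i * q) :=
              Finset.prod_nonneg fun i _ => by positivity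
            positivity
          exact mul_le_mul e2 e1 e3 (by positivity)
        have a1 := h1 (α - 1) j ((abs_sub _ _).trans (by rw [abs_one]; linarith)) (by linarith)
        have a2 := h1 α j (by linarith) (by linarith)
        have a3 := h1 α (j + 1) (by linarith) (by push_cast; linarith)
        have a4 := h1 (α + p) j ((abs_add_le _ _).trans (by rw [abs_of_pos hp]; linarith))
          (by linarith)
        set X := R ^ ((j : ℝ) + 1) * hierarchyBound R Q q n (|α| + q) (s - t₀)
        have hX : 0 ≤ X := (abs_nonneg _).trans a2
        rw [abs_mul]
        refine mul_le_mul_of_nonneg_left ?_ (abs_nonneg _)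
        have c1 : |m s * d (α - 1) j s| ≤ B * X := by
          rw [abs_mul]; exact mul_le_mul (hm s hs) a1 (abs_nonneg _) hB
        have c3 : |σ * d α (j + 1) s| ≤ σ * X := by
          rw [abs_mul, abs_of_pos hσ]; exact mul_le_mul_of_nonneg_left a3 hσ.le
        have c4 : |σ * d (α + p) j s| ≤ σ * X := by
          rw [abs_mul, abs_of_pos hσ]; exact mul_le_mul_of_nonneg_left a4 hσ.le
        calc _ ≤ |m s * d (α - 1) j s - d α j s + σ * d α (j + 1) s| + |σ * d (α + p) j s| :=
              abs_sub _ _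
          _ ≤ |m s * d (α - 1) j s - d α j s| + |σ * d α (j + 1) s| + |σ * d (α + p) j s| := by
              gcongr; exact abs_add_le _ _
          _ ≤ |m s * d (α - 1) j s| + |d α j s| + |σ * d α (j + 1) s| +
              |σ * d (α + p) j s| := by
              gcongr; exact abs_sub _ _
          _ ≤ B * X + X + σ * X + σ * X := by gcongr
          _ = _ := by ring
      rw [hd α j t ht]
      have hcont : Continuous fun s => |α| * ((B + 1 + 2 * σ) *
          (R ^ ((j : ℝ) + 1) * hierarchyBound R Q q n (|α| + q) (s - t₀))) := by
        unfold hierarchyBound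
        fun_prop
      refine (intervalIntegral.norm_integral_le_of_norm_le (f := fun s => α * (m s *
        d (α - 1) j s - d α j s + σ * d α (j + 1) s - σ * d (α + p) j s)) ht.1
        (Eventually.of_forall fun s hs => hpt s ⟨hs.1.le, hs.2.trans ht.2⟩)
        (hcont.intervalIntegrable _ _)).trans_eq ?_
      set P := ∏ i ∈ Finset.range n, (|α| + q + i * q) with hP
      have e1 : ∀ s, |α| * ((B + 1 + 2 * σ) *
          (R ^ ((j : ℝ) + 1) * hierarchyBound R Q q n (|α| + q) (s - t₀))) =
          (|α| * ((B + 1 + 2 * σ) * (R ^ ((j : ℝ) + 1) * (2 * R ^ (|α| + q) * (Q ^ n * P))))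
            / n.factorial) * (s - t₀) ^ n := by
        intro s
        unfold hierarchyBound
        ring
      simp only [e1, intervalIntegral.integral_const_mul]
      rw [intervalIntegral.integral_comp_sub_right (fun s => s ^ n), integral_pow, sub_self,
        zero_pow (by omega), sub_zero]
      -- The factor `|α|` in front of the integrand is the new `i = 0` factor; the others come from
      -- the shift of `|α|` to `|α| + q`.
      have e2 : ∏ i ∈ Finset.range (n + 1), (|α| + i * q) = P * |α| := by
        rw [Finset.prod_range_succ', hP]
        congr 1
        · refine Finset.prod_congr rfl fun i _ => ?_
          push_cast; ring
        · simp
      simp only [b, hierarchyBound, e2, Nat.factorial_succ]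
      have e3 : R ^ ((j : ℝ) + 1) * R ^ (|α| + q) = R ^ (j : ℝ) * R ^ |α| * R ^ (q + 1) := by
        rw [← Real.rpow_add hR0, ← Real.rpow_add hR0, ← Real.rpow_add hR0]
        ring_nf
      have e4 : Q ^ (n + 1) = Q ^ n * ((B + 1 + 2 * σ) * R ^ (q + 1)) := by rw [pow_succ]
      have hn0 : (n.factorial : ℝ) ≠ 0 := by positivity
      rw [e4]
      push_cast
      field_simp
      linear_combination |α| * (Q ^ n * P) * (t - t₀) ^ (n + 1) * e3
  have hlim : Tendsto (fun n => b n α j t) atTop (𝓝 0) := by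
    have := (tendsto_hierarchyBound (a := |α|) hR hQ0 hq1 (abs_nonneg α)
      (sub_nonneg.mpr ht.1) hshort).const_mul (R ^ (j : ℝ))
    rwa [mul_zero] at this
  exact abs_nonpos_iff.mp (ge_of_tendsto' hlim fun n => key n α j t ht)

namespace IsTransport

variable {p σ : ℝ} {m : ℝ → ℝ} {ρ ρ' : ℝ → Measure (ℝ × ℝ)}

lemma continuousOn_rpow_mul_pow (α : ℝ) (j : ℕ) :
    ContinuousOn (fun x : ℝ × ℝ => x.1 ^ α * x.2 ^ j) Quadrant :=
  (continuousOn_fst.rpow_const fun _ hx => Or.inl (ne_of_gt hx.1)).mul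
    (continuousOn_snd.pow j)

/-- The field is a sum of monomials in `y`, `y ^ p` and `θ`, so the moments with real exponent in
`y` form a closed linear hierarchy. -/
lemma integral_moment_eq (h : IsTransport p σ m ρ) (α : ℝ) (j : ℕ) {t : ℝ} (ht : 0 ≤ t) :
    ∫ x, x.1 ^ α * x.2 ^ j ∂(ρ t) = ∫ x, x.1 ^ α * x.2 ^ j ∂(ρ 0) +
      ∫ s in (0 : ℝ)..t, α * (m s * ∫ x, x.1 ^ (α - 1) * x.2 ^ j ∂(ρ s) -
        ∫ x, x.1 ^ α * x.2 ^ j ∂(ρ s) + σ * ∫ x, x.1 ^ α * x.2 ^ (j + 1) ∂(ρ s) -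
        σ * ∫ x, x.1 ^ (α + p) * x.2 ^ j ∂(ρ s)) := by
  have hψ : ContDiffOn ℝ ∞ (fun x : ℝ × ℝ => x.1 ^ α * x.2 ^ j) Quadrant := fun x hx =>
    ((contDiffAt_fst.rpow_const_of_ne (ne_of_gt hx.1)).mul
      (contDiffAt_snd.pow j)).contDiffWithinAt
  rw [h.integral_eq hψ (ψ' := fun x => α * x.1 ^ (α - 1) * x.2 ^ j) (fun x hx =>
    (Real.hasDerivAt_rpow_const (Or.inl (ne_of_gt hx.1))).mul_const (x.2 ^ j)) ht]
  congr 1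
  refine intervalIntegral.integral_congr fun s hs => ?_
  rw [uIcc_of_le ht] at hs
  have i1 := (h.integrable (continuousOn_rpow_mul_pow (α - 1) j) hs.1).const_mul (m s)
  have i2 := h.integrable (continuousOn_rpow_mul_pow α j) hs.1
  have i3 := (h.integrable (continuousOn_rpow_mul_pow α (j + 1)) hs.1).const_mul σ
  have i4 := (h.integrable (continuousOn_rpow_mul_pow (α + p) j) hs.1).const_mul σ
  simp only [← integral_const_mul]
  have i12 : Integrable (fun x : ℝ × ℝ => m s * (x.1 ^ (α - 1) * x.2 ^ j) - x.1 ^ α * x.2 ^ j)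
    (ρ s) := i1.sub i2
  have i123 : Integrable (fun x : ℝ × ℝ => m s * (x.1 ^ (α - 1) * x.2 ^ j) - x.1 ^ α * x.2 ^ j +
    σ * (x.1 ^ α * x.2 ^ (j + 1))) (ρ s) := i12.add i3
  rw [← integral_sub i1 i2, ← integral_add i12 i3, ← integral_sub i123 i4,
    ← integral_const_mul]
  refine integral_congr_ae ?_
  filter_upwards [h.ae_mem_quadrant hs.1] with x hx
  have hx0 : 0 < x.1 := hx.1
  have e1 : x.1 ^ α = x.1 ^ (α - 1) * x.1 := by
    rw [← Real.rpow_add_one hx0.ne']; ring_nf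
  have e2 : x.1 ^ (α + p) = x.1 ^ (α - 1) * x.1 * x.1 ^ p := by
    rw [Real.rpow_add hx0, e1]
  simp only [field, e2, e1]
  ring

lemma abs_moment_le (h : IsTransport p σ m ρ) {R t : ℝ} (hR : 1 ≤ R) (ht : 0 ≤ t)
    (hbd : ∀ᵐ x ∂(ρ t), x.1 ∈ Icc R⁻¹ R ∧ x.2 ∈ Icc 0 R) (α : ℝ) (j : ℕ) :
    |∫ x, x.1 ^ α * x.2 ^ j ∂(ρ t)| ≤ R ^ (|α| + j) := by
  have hprob := h.prob t ht
  have hR0 : 0 < R := by linarith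
  have := norm_integral_le_of_norm_le_const (μ := ρ t)
    (f := fun x : ℝ × ℝ => x.1 ^ α * x.2 ^ j) (C := R ^ (|α| + j)) (by
      filter_upwards [hbd] with x hx
      have hx0 : 0 < x.1 := (inv_pos.mpr hR0).trans_le hx.1.1
      have h1 : x.1 ^ α ≤ R ^ |α| := by
        rcases le_total 0 α with hα | hα
        · rw [abs_of_nonneg hα]; exact Real.rpow_le_rpow hx0.le hx.1.2 hα
        · rw [abs_of_nonpos hα, Real.rpow_neg hR0.le, ← Real.inv_rpow hR0.le]
          exact Real.rpow_le_rpow_of_nonpos (inv_pos.mpr hR0) hx.1.1 hα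
      have h2 : x.2 ^ j ≤ R ^ j := pow_le_pow_left₀ hx.2.1 hx.2.2 j
      have h3 : 0 < x.1 ^ α := Real.rpow_pos_of_pos hx0 α
      have h4 : 0 ≤ x.2 ^ j := pow_nonneg hx.2.1 j
      rw [Real.norm_of_nonneg (by positivity), Real.rpow_add hR0, Real.rpow_natCast]
      gcongr)
  simpa using this

/-- Transports with the same mean and the same initial measure coincide. -/
lemma eq_of_initial_eq (h : IsTransport p σ m ρ) (h' : IsTransport p σ m ρ')
    (hm : ContinuousOn m (Ici 0)) (hp : 0 < p) (hσ : 0 < σ) (h0 : ρ 0 = ρ' 0) {T : ℝ}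
    (hT : 0 ≤ T) : ρ T = ρ' T := by
  obtain ⟨K₁, hK₁, hKQ₁, hae₁⟩ := h.ae_mem T
  obtain ⟨K₂, hK₂, hKQ₂, hae₂⟩ := h'.ae_mem T
  have hK := hK₁.union hK₂
  have hKQ : K₁ ∪ K₂ ⊆ Quadrant := union_subset hKQ₁ hKQ₂
  obtain ⟨B, hB⟩ := isCompact_Icc.exists_bound_of_continuousOn
    (hm.mono (show Icc 0 T ⊆ Ici 0 from Icc_subset_Ici_self))
  have hB0 : 0 ≤ B := (norm_nonneg _).trans (hB 0 ⟨le_rfl, hT⟩)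
  obtain ⟨R₁, hR₁⟩ := hK.exists_bound_of_continuousOn (f := fun x : ℝ × ℝ => x.1)
    continuousOn_fst
  obtain ⟨R₂, hR₂⟩ := hK.exists_bound_of_continuousOn (f := fun x : ℝ × ℝ => x.1⁻¹)
    (continuousOn_fst.inv₀ fun x hx => ne_of_gt (hKQ hx).1)
  obtain ⟨R₃, hR₃⟩ := hK.exists_bound_of_continuousOn (f := fun x : ℝ × ℝ => x.2)
    continuousOn_snd
  -- `R` bounds `y`, `1 / y` and `θ` on the supports, hence controls moments of either sign.
  set R := max 1 (max R₁ (max R₂ R₃)) with hR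
  have hR1 : 1 ≤ R := le_max_left _ _
  have hmemR (x : ℝ × ℝ) (hx : x ∈ K₁ ∪ K₂) : x.1 ∈ Icc R⁻¹ R ∧ x.2 ∈ Icc 0 R := by
    have hxq := hKQ hx
    have hx0 : 0 < x.1 := hxq.1
    have a1 : x.1 ≤ R := (le_abs_self _).trans ((hR₁ x hx).trans (by simp [hR]))
    have a2 : x.1⁻¹ ≤ R := (le_abs_self _).trans ((hR₂ x hx).trans (by simp [hR]))
    have a3 : x.2 ≤ R := (le_abs_self _).trans ((hR₃ x hx).trans (by simp [hR]))
    exact ⟨⟨inv_le_of_inv_le₀ hx0 a2, a1⟩, le_of_lt hxq.2, a3⟩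
  set d : ℝ → ℕ → ℝ → ℝ := fun α j t =>
    ∫ x, x.1 ^ α * x.2 ^ j ∂(ρ t) - ∫ x, x.1 ^ α * x.2 ^ j ∂(ρ' t) with hd
  have hdcont (α : ℝ) (j : ℕ) : ContinuousOn (d α j) (Ici 0) :=
    (h.continuousOn_integral (continuousOn_rpow_mul_pow α j)).sub
      (h'.continuousOn_integral (continuousOn_rpow_mul_pow α j))
  have hIcont (r : ℝ → Measure (ℝ × ℝ)) (hr : IsTransport p σ m r) (α : ℝ) (j : ℕ) :
      ContinuousOn (fun s => α * (m s * ∫ x, x.1 ^ (α - 1) * x.2 ^ j ∂(r s) -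
        ∫ x, x.1 ^ α * x.2 ^ j ∂(r s) + σ * ∫ x, x.1 ^ α * x.2 ^ (j + 1) ∂(r s) -
        σ * ∫ x, x.1 ^ (α + p) * x.2 ^ j ∂(r s))) (Ici 0) := by
    have c1 := hr.continuousOn_integral (continuousOn_rpow_mul_pow (α - 1) j)
    have c2 := hr.continuousOn_integral (continuousOn_rpow_mul_pow α j)
    have c3 := hr.continuousOn_integral (continuousOn_rpow_mul_pow α (j + 1))
    have c4 := hr.continuousOn_integral (continuousOn_rpow_mul_pow (α + p) j)
    exact continuousOn_const.mul ((((hm.mul c1).sub c2).add (continuousOn_const.mul c3)).sub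
      (continuousOn_const.mul c4))
  set F : ℝ → ℕ → ℝ → ℝ := fun α j s => α * (m s * d (α - 1) j s - d α j s +
      σ * d α (j + 1) s - σ * d (α + p) j s) with hF
  have hFint (α : ℝ) (j : ℕ) {u v : ℝ} (hu : 0 ≤ u) (hv : 0 ≤ v) :
      IntervalIntegrable (F α j) volume u v := by
    have : ContinuousOn (F α j) (Ici 0) := continuousOn_const.mul
      ((((hm.mul (hdcont _ _)).sub (hdcont _ _)).add (continuousOn_const.mul (hdcont _ _))).sub
      (continuousOn_const.mul (hdcont _ _)))
    exact (this.mono fun x hx => (le_min hu hv).trans hx.1).intervalIntegrable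
  have hd0 (α : ℝ) (j : ℕ) {t : ℝ} (ht : 0 ≤ t) : d α j t = ∫ s in (0 : ℝ)..t, F α j s := by
    have hint (r : ℝ → Measure (ℝ × ℝ)) (hr : IsTransport p σ m r) :=
      ((hIcont r hr α j).mono (show uIcc 0 t ⊆ Ici 0 by
        rw [uIcc_of_le ht]; exact Icc_subset_Ici_self)).intervalIntegrable (μ := volume)
    simp only [hd]
    rw [h.integral_moment_eq α j ht, h'.integral_moment_eq α j ht, h0, add_sub_add_left_eq_sub,
      ← intervalIntegral.integral_sub (hint ρ h) (hint ρ' h')]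
    refine intervalIntegral.integral_congr fun s _ => ?_
    simp only [hF, hd]
    ring
  set D := 2 * max 1 p * ((B + 1 + 2 * σ) * R ^ (max 1 p + 1)) with hD
  have hD0 : 0 < D := by positivity
  -- The vanishing time depends only on `B`, `R` and the parameters, so steps of length `(2 * D)⁻¹`
  -- reach `T`.
  have key (k : ℕ) : ∀ t ∈ Icc 0 T, t ≤ k * (2 * D)⁻¹ → ∀ α j, d α j t = 0 := by
    induction k with
    | zero =>
      intro t ht htk α j
      have : t = 0 := le_antisymm (by simpa using htk) ht.1
      simp [hd, this, h0]
    | succ k ih =>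
      intro t ht htk α j
      rcases le_total t (k * (2 * D)⁻¹) with hle | hle
      · exact ih t ht hle α j
      set t₀ := (k : ℝ) * (2 * D)⁻¹ with ht₀
      have ht₀0 : 0 ≤ t₀ := by positivity
      refine hierarchy_eq_zero (t₀ := t₀) (T := T) (m := m) hp hσ hB0 hR1
        (fun s hs => hB s ⟨ht₀0.trans hs.1, hs.2⟩) (d := d) ?_ ?_ ⟨hle, ht.2⟩ ?_ α j
      · intro α j s hs
        have hs0 : 0 ≤ s := ht₀0.trans hs.1
        have e1 := ih t₀ ⟨ht₀0, hle.trans ht.2⟩ le_rfl α j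
        rw [hd0 α j ht₀0] at e1
        rw [hd0 α j hs0, ← intervalIntegral.integral_add_adjacent_intervals
          (hFint α j le_rfl ht₀0) (hFint α j ht₀0 hs0), e1, zero_add]
      · intro α j s hs
        have hs' : s ∈ Icc 0 T := ⟨ht₀0.trans hs.1, hs.2⟩
        have b1 := h.abs_moment_le hR1 hs'.1 (by
          filter_upwards [hae₁ s hs'] with x hx using hmemR x (Or.inl hx)) α j
        have b2 := h'.abs_moment_le hR1 hs'.1 (by
          filter_upwards [hae₂ s hs'] with x hx using hmemR x (Or.inr hx)) α j
        exact (abs_sub _ _).trans (by linarith)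
      · have e1 : t - t₀ ≤ (2 * D)⁻¹ := by
          push_cast at htk
          rw [ht₀]; linarith
        calc D * (t - t₀) ≤ D * (2 * D)⁻¹ := mul_le_mul_of_nonneg_left e1 hD0.le
          _ = 1 / 2 := by field_simp
          _ < 1 := by norm_num
  obtain ⟨k, hk⟩ := exists_nat_ge (T * (2 * D))
  have hTk : T ≤ k * (2 * D)⁻¹ := by
    rw [← div_eq_mul_inv, le_div_iff₀ (by positivity)]; exact hk
  have hpr := h.prob T hT
  have hpr' := h'.prob T hT
  refine eq_of_integral_pow_mul_pow_eq hK
    ((hae₁ T ⟨hT, le_rfl⟩).mono fun x hx => Or.inl hx)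
    ((hae₂ T ⟨hT, le_rfl⟩).mono fun x hx => Or.inr hx) fun i j => ?_
  have := key k T ⟨hT, le_rfl⟩ hTk i j
  simp only [hd, sub_eq_zero, Real.rpow_natCast] at this
  exact this

end IsTransport

/-! ### The flow of the velocity field -/

open scoped NNReal BoundedContinuousFunction in
/-- Global solutions of an ordinary differential equation with a bounded, uniformly Lipschitz
vector field. -/
lemma exists_global_ode_solution {E : Type*} [NormedAddCommGroup E] [NormedSpace ℝ E]
    [CompleteSpace E] {N : ℝ → E → E} {K L : ℝ≥0} (hLip : ∀ t, LipschitzWith K (N t))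
    (hcont : ∀ x, Continuous fun t => N t x) (hbd : ∀ t x, ‖N t x‖ ≤ L) (x₀ : E) :
    ∃ Φ : ℝ → E, Φ 0 = x₀ ∧ ∀ t, HasDerivAt Φ (N t (Φ t)) t := by
  have hloc (n : ℕ) : ∃ Φ : ℝ → E, Φ 0 = x₀ ∧
      ∀ t ∈ Ioo (-((n : ℝ) + 1)) (n + 1), HasDerivAt Φ (N t (Φ t)) t := by
    have hn : (0 : ℝ) ≤ n := n.cast_nonneg
    have hP : IsPicardLindelof N (tmin := -((n : ℝ) + 1)) (tmax := n + 1)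
        -- Within time `n + 1` a field bounded by `L` moves a point by at most `L (n + 1)`, so this
        -- radius makes the whole interval admissible.
        ⟨0, by linarith, by linarith⟩ x₀ (L * (n + 1)) 0 L K := by
      refine ⟨fun t _ => (hLip t).lipschitzOnWith, fun x _ => (hcont x).continuousOn,
        fun t _ x _ => hbd t x, ?_⟩
      simp
    obtain ⟨Φ, h0, h⟩ := hP.exists_eq_forall_mem_Icc_hasDerivWithinAt₀
    exact ⟨Φ, h0, fun t ht => (h t ⟨ht.1.le, ht.2.le⟩).hasDerivAt (Icc_mem_nhds ht.1 ht.2)⟩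
  choose Ψ hΨ0 hΨ using hloc
  have huniq {n k : ℕ} (hnk : n ≤ k) :
      EqOn (Ψ n) (Ψ k) (Ioo (-((n : ℝ) + 1)) (n + 1)) := by
    have hn : (0 : ℝ) ≤ n := n.cast_nonneg
    have hnk' : (n : ℝ) ≤ k := by exact_mod_cast hnk
    exact ODE_solution_unique_of_mem_Ioo (v := N) (s := fun _ => univ) (t₀ := 0)
      (fun t _ => (hLip t).lipschitzOnWith) ⟨by linarith, by linarith⟩
      (fun t ht => ⟨hΨ n t ht, trivial⟩)
      (fun t ht => ⟨hΨ k t ⟨by linarith [ht.1], by linarith [ht.2]⟩, trivial⟩)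
      ((hΨ0 n).trans (hΨ0 k).symm)
  have hmem (t : ℝ) : t ∈ Ioo (-((⌈|t|⌉₊ : ℝ) + 1)) (⌈|t|⌉₊ + 1) := by
    have := Nat.le_ceil |t|
    exact ⟨by linarith [neg_abs_le t], by linarith [le_abs_self t]⟩
  have hEq (n : ℕ) {t : ℝ} (ht : t ∈ Ioo (-((n : ℝ) + 1)) (n + 1)) :
      Ψ ⌈|t|⌉₊ t = Ψ n t := by
    rcases le_total ⌈|t|⌉₊ n with h | h
    · exact huniq h (hmem t)
    · exact (huniq h ht).symm
  -- Uniqueness makes the local solutions agree on overlaps, so they glue to a global one.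
  refine ⟨fun t => Ψ ⌈|t|⌉₊ t, by simp [hΨ0], fun t => ?_⟩
  refine (hΨ _ t (hmem t)).congr_of_eventuallyEq ?_
  filter_upwards [Ioo_mem_nhds (hmem t).1 (hmem t).2] with s hs using hEq _ hs

/-- A function that decreases wherever it is positive stays nonpositive. -/
lemma nonpos_of_deriv_nonpos_of_pos {f f' : ℝ → ℝ} (h0 : f 0 ≤ 0)
    (hf : ∀ t, HasDerivAt f (f' t) t) (h : ∀ t, 0 ≤ t → 0 < f t → f' t ≤ 0) {t : ℝ}
    (ht : 0 ≤ t) : f t ≤ 0 := by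
  refine le_of_forall_pos_le_add fun ε hε => ?_
  have ht1 : 0 < t + 1 := by linarith
  -- The barrier `ε / (t + 1) * (x + 1)` is positive with positive slope and equals `ε` at `x = t`.
  have hδ : 0 < ε / (t + 1) := by positivity
  have hB (x : ℝ) : HasDerivAt (fun x => ε / (t + 1) * (x + 1)) (ε / (t + 1)) x := by
    simpa using ((hasDerivAt_id x).add_const 1).const_mul (ε / (t + 1))
  have := image_le_of_deriv_right_lt_deriv_boundary (a := 0) (b := t)
    (fun x _ => (hf x).continuousAt.continuousWithinAt) (fun x _ => (hf x).hasDerivWithinAt)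
    (by linarith) hB (fun x hx hfx => by
      have hpos : 0 < f x := by
        rw [hfx]; exact mul_pos hδ (by linarith [hx.1])
      exact (h x hx.1 hpos).trans_lt hδ) (⟨ht, le_rfl⟩ : t ∈ Icc 0 t)
  rw [div_mul_cancel₀ _ ht1.ne'] at this
  linarith

section Flow

variable {p σ a b θ₁ θ₂ : ℝ}

lemma exists_field_bounds (hp : 0 < p) (hσ : 0 < σ) (ha : 0 < a) (hab : a ≤ b) (hθ₁ : 0 ≤ θ₁) :
    ∃ K L : ℝ, 0 ≤ K ∧ 0 ≤ L ∧ ∀ m ∈ Icc a b, ∀ θ ∈ Icc θ₁ θ₂, ∀ y ∈ Icc a b,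
      |field p σ m y θ| ≤ L ∧
      ∀ y' ∈ Icc a b, |field p σ m y θ - field p σ m y' θ| ≤ K * |y - y'| := by
  -- The exponent `p + 1` is that of the product `y * y ^ p`.
  obtain ⟨c, C, -, hC, hb⟩ := exists_rpow_sub_bounds (p := p + 1) (by linarith) ha hab
  have hb0 := ha.trans_le hab
  refine ⟨1 + σ * |θ₂| + σ * C, b + σ * (|θ₂| + b ^ p) * b, by positivity, by positivity, ?_⟩
  intro m hm θ hθ y hy
  have hθ2 : |θ| ≤ |θ₂| := abs_le_abs_of_nonneg (hθ₁.trans hθ.1) hθ.2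
  have hy0 := ha.trans_le hy.1
  constructor
  · have h1 : |m - y| ≤ b := abs_sub_le_iff.mpr
      ⟨by linarith [hm.2], by linarith [hy.2, ha.trans_le hm.1]⟩
    have h2 : |θ - y ^ p| ≤ |θ₂| + b ^ p := by
      refine (abs_sub _ _).trans (add_le_add hθ2 ?_)
      rw [abs_of_pos (Real.rpow_pos_of_pos hy0 p)]
      exact Real.rpow_le_rpow hy0.le hy.2 hp.le
    refine (abs_add_le _ _).trans (add_le_add h1 ?_)
    rw [abs_mul, abs_mul, abs_of_pos hσ, abs_of_pos hy0]
    exact mul_le_mul (mul_le_mul_of_nonneg_left h2 hσ.le) hy.2 hy0.le (by positivity)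
  · intro y' hy'
    have hy0' := ha.trans_le hy'.1
    have h3 : |y ^ (p + 1) - y' ^ (p + 1)| ≤ C * |y - y'| := by
      rcases le_total y' y with h | h
      · rw [abs_of_nonneg (sub_nonneg.mpr (Real.rpow_le_rpow hy0'.le h (by linarith))),
          abs_of_nonneg (sub_nonneg.mpr h)]
        exact (hb y' hy' y hy h).2
      · rw [abs_sub_comm, abs_sub_comm y,
          abs_of_nonneg (sub_nonneg.mpr (Real.rpow_le_rpow hy0.le h (by linarith))),
          abs_of_nonneg (sub_nonneg.mpr h)]
        exact (hb y hy y' hy' h).2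
    have e : field p σ m y θ - field p σ m y' θ =
        -(y - y') + σ * θ * (y - y') - σ * (y ^ (p + 1) - y' ^ (p + 1)) := by
      rw [Real.rpow_add_one hy0.ne', Real.rpow_add_one hy0'.ne', field, field]; ring
    rw [e]
    calc _ ≤ |-(y - y') + σ * θ * (y - y')| + |σ * (y ^ (p + 1) - y' ^ (p + 1))| := abs_sub _ _
      _ ≤ |-(y - y')| + |σ * θ * (y - y')| + |σ * (y ^ (p + 1) - y' ^ (p + 1))| := by
          gcongr; exact abs_add_le _ _
      _ ≤ |y - y'| + σ * |θ₂| * |y - y'| + σ * (C * |y - y'|) := by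
          rw [abs_neg, abs_mul, abs_mul, abs_mul, abs_of_pos hσ]
          gcongr
      _ = _ := by ring

lemma continuous_field (hp : 0 < p) : Continuous fun z : ℝ × ℝ × ℝ => field p σ z.1 z.2.1 z.2.2 := by
  have h1 : Continuous fun z : ℝ × ℝ × ℝ => z.2.1 ^ p :=
    (Real.continuous_rpow_const hp.le).comp (continuous_fst.comp continuous_snd)
  unfold field
  fun_prop

open scoped NNReal BoundedContinuousFunction in
/-- The flow of the velocity field with mean `m`, on the invariant strip `[a, b] × [θ₁, θ₂]`. -/
lemma exists_flow (hp : 0 < p) (hσ : 0 < σ) (ha : 0 < a) (hab : a ≤ b) (hθ : θ₁ ≤ θ₂)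
    (haθ : a ^ p ≤ θ₁) (hbθ : θ₂ ≤ b ^ p) {m : ℝ → ℝ} (hm : Continuous m)
    (hmab : ∀ t, m t ∈ Icc a b) :
    ∃ Φ : ℝ → ℝ × ℝ → ℝ, Continuous (fun z : ℝ × ℝ × ℝ => Φ z.1 z.2) ∧
      (∀ x : ℝ × ℝ, x.1 ∈ Icc a b → Φ 0 x = x.1) ∧
      (∀ t, 0 ≤ t → ∀ x, Φ t x ∈ Icc a b) ∧
      ∀ t, 0 ≤ t → ∀ x : ℝ × ℝ, x.2 ∈ Icc θ₁ θ₂ →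
        HasDerivAt (fun s => Φ s x) (field p σ (m t) (Φ t x) x.2) t := by
  have hθ₁ : 0 ≤ θ₁ := (Real.rpow_nonneg ha.le p).trans haθ
  obtain ⟨K, L, hK, hL, hKL⟩ := exists_field_bounds (θ₂ := θ₂) hp hσ ha hab hθ₁
  -- Clamping opinion and conviction makes the field bounded and uniformly Lipschitz in the opinion.
  -- The barriers `hlow` and `hupp` show afterwards that the opinion clamp is inactive at
  -- nonnegative times.
  set cy : ℝ → ℝ := fun y => projIcc a b hab y with hcy
  set cθ : ℝ → ℝ := fun θ => projIcc θ₁ θ₂ hθ θ with hcθ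
  have hcyc : Continuous cy := continuous_subtype_val.comp continuous_projIcc
  have hcθc : Continuous cθ := continuous_subtype_val.comp continuous_projIcc
  have hcym (y : ℝ) : cy y ∈ Icc a b := (projIcc a b hab y).2
  have hcθm (θ : ℝ) : cθ θ ∈ Icc θ₁ θ₂ := (projIcc θ₁ θ₂ hθ θ).2
  have hcyid {y : ℝ} (hy : y ∈ Icc a b) : cy y = y := by simp [hcy, projIcc_of_mem hab hy]
  have hcθid {θ : ℝ} (h : θ ∈ Icc θ₁ θ₂) : cθ θ = θ := by simp [hcθ, projIcc_of_mem hθ h]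
  have hcylip (y y' : ℝ) : |cy y - cy y'| ≤ |y - y'| := by
    have := (LipschitzWith.projIcc hab).dist_le_mul y y'
    simpa [Subtype.dist_eq, Real.dist_eq] using this
  have hNc (t : ℝ) (Y : ℝ × ℝ →ᵇ ℝ) :
      Continuous fun x : ℝ × ℝ => field p σ (m t) (cy (Y x)) (cθ x.2) :=
    (continuous_field hp).comp (continuous_const.prodMk ((hcyc.comp Y.continuous).prodMk
      (hcθc.comp continuous_snd)))
  -- The equation is solved for all starting points at once, in the Banach space of bounded
  -- continuous functions of the starting point. Joint continuity of the flow then comes for free.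
  set N : ℝ → (ℝ × ℝ →ᵇ ℝ) → (ℝ × ℝ →ᵇ ℝ) := fun t Y =>
    BoundedContinuousFunction.ofNormedAddCommGroup _ (hNc t Y) L fun x =>
      (hKL _ (hmab t) _ (hcθm x.2) _ (hcym (Y x))).1 with hN
  have hNapp (t : ℝ) (Y : ℝ × ℝ →ᵇ ℝ) (x : ℝ × ℝ) :
      N t Y x = field p σ (m t) (cy (Y x)) (cθ x.2) := rfl
  have hLip (t : ℝ) : LipschitzWith K.toNNReal (N t) := by
    refine LipschitzWith.of_dist_le_mul fun Y Z => ?_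
    rw [Real.coe_toNNReal K hK, BoundedContinuousFunction.dist_le (by positivity)]
    intro x
    rw [hNapp, hNapp, Real.dist_eq]
    refine ((hKL _ (hmab t) _ (hcθm x.2) _ (hcym (Y x))).2 _ (hcym (Z x))).trans ?_
    refine mul_le_mul_of_nonneg_left ((hcylip _ _).trans ?_) hK
    rw [← Real.dist_eq]
    exact BoundedContinuousFunction.dist_coe_le_dist x
  have hcont (Y : ℝ × ℝ →ᵇ ℝ) : Continuous fun t => N t Y := by
    rw [continuous_iff_continuousAt]
    intro t
    rw [ContinuousAt, tendsto_iff_dist_tendsto_zero]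
    refine squeeze_zero (fun _ => dist_nonneg) (fun s => ?_)
      (tendsto_iff_dist_tendsto_zero.mp (hm.tendsto t))
    rw [BoundedContinuousFunction.dist_le dist_nonneg]
    intro x
    rw [hNapp, hNapp, Real.dist_eq, Real.dist_eq]
    simp only [field]
    rw [show ∀ u v w z : ℝ, u - w + z - (v - w + z) = u - v by intros; ring]
  have hbd (t : ℝ) (Y : ℝ × ℝ →ᵇ ℝ) : ‖N t Y‖ ≤ L.toNNReal := by
    rw [Real.coe_toNNReal L hL]
    exact BoundedContinuousFunction.norm_ofNormedAddCommGroup_le _ hL _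
  obtain ⟨Φ, hΦ0, hΦ⟩ := exists_global_ode_solution hLip hcont hbd
    (BoundedContinuousFunction.ofNormedAddCommGroup (fun x : ℝ × ℝ => cy x.1)
      (hcyc.comp continuous_fst) b fun x => by
        rw [Real.norm_of_nonneg (ha.le.trans (hcym x.1).1)]; exact (hcym x.1).2)
  have hΦ0x (x : ℝ × ℝ) : Φ 0 x = cy x.1 := by rw [hΦ0]; rfl
  have hd (x : ℝ × ℝ) (t : ℝ) :
      HasDerivAt (fun s => Φ s x) (field p σ (m t) (cy (Φ t x)) (cθ x.2)) t := by
    have := (BoundedContinuousFunction.evalCLM ℝ x :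
      (ℝ × ℝ →ᵇ ℝ) →L[ℝ] ℝ).hasFDerivAt.comp_hasDerivAt t (hΦ t)
    exact this
  have hΦc : Continuous Φ := continuous_iff_continuousAt.mpr fun t => (hΦ t).continuousAt
  -- Below `a` the clamped field takes its value at `y = a`, which is nonnegative because `m ≥ a`
  -- and `θ ≥ a ^ p`.
  have hlow (x : ℝ × ℝ) {t : ℝ} (ht : 0 ≤ t) : a ≤ Φ t x := by
    have := nonpos_of_deriv_nonpos_of_pos (f := fun t => a - Φ t x)
      (by simpa [hΦ0x] using (hcym x.1).1) (fun t => (hd x t).const_sub a)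
      (fun s hs hpos => by
        have e : cy (Φ s x) = a := by
          simp [hcy, projIcc_of_le_left hab (by linarith : Φ s x ≤ a)]
        rw [e, neg_nonpos, field]
        have h1 : 0 ≤ σ * (cθ x.2 - a ^ p) * a :=
          mul_nonneg (mul_nonneg hσ.le (by linarith [(hcθm x.2).1])) ha.le
        linarith [(hmab s).1]) ht
    linarith
  have hupp (x : ℝ × ℝ) {t : ℝ} (ht : 0 ≤ t) : Φ t x ≤ b := by
    have := nonpos_of_deriv_nonpos_of_pos (f := fun t => Φ t x - b)
      (by simpa [hΦ0x] using (hcym x.1).2) (fun t => (hd x t).sub_const b)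
      (fun s hs hpos => by
        have e : cy (Φ s x) = b := by
          simp [hcy, projIcc_of_right_le hab (by linarith : b ≤ Φ s x)]
        rw [e, field]
        have h1 : σ * (cθ x.2 - b ^ p) * b ≤ 0 :=
          mul_nonpos_of_nonpos_of_nonneg (mul_nonpos_of_nonneg_of_nonpos hσ.le
            (by linarith [(hcθm x.2).2])) (ha.le.trans hab)
        linarith [(hmab s).2]) ht
    linarith
  refine ⟨fun t x => Φ t x, ?_, fun x hx => (hΦ0x x).trans (hcyid hx),
    fun t ht x => ⟨hlow x ht, hupp x ht⟩, fun t ht x hx => ?_⟩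
  · exact continuous_eval.comp ((hΦc.comp continuous_fst).prodMk continuous_snd)
  · have := hd x t
    rwa [hcyid ⟨hlow x ht, hupp x ht⟩, hcθid hx] at this

/-- Pushing an initial measure forward along the flow gives a transport. -/
lemma isTransport_map_flow (hp : 0 < p) (ha : 0 < a) (hθ₁ : 0 < θ₁)
    {m : ℝ → ℝ} (hm : Continuous m) {Φ : ℝ → ℝ × ℝ → ℝ}
    (hΦc : Continuous (fun z : ℝ × ℝ × ℝ => Φ z.1 z.2))
    (hΦ0 : ∀ x : ℝ × ℝ, x.1 ∈ Icc a b → Φ 0 x = x.1)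
    (hΦab : ∀ t, 0 ≤ t → ∀ x, Φ t x ∈ Icc a b)
    (hΦd : ∀ t, 0 ≤ t → ∀ x : ℝ × ℝ, x.2 ∈ Icc θ₁ θ₂ →
        HasDerivAt (fun s => Φ s x) (field p σ (m t) (Φ t x) x.2) t)
    {ρ₀ : Measure (ℝ × ℝ)} [IsProbabilityMeasure ρ₀]
    (h0 : ∀ᵐ x ∂ρ₀, x ∈ Icc a b ×ˢ Icc θ₁ θ₂) :
    IsTransport p σ m (fun t => ρ₀.map fun x => (Φ t x, x.2)) ∧
      ρ₀.map (fun x => (Φ 0 x, x.2)) = ρ₀ := by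
  have hc (t : ℝ) : Continuous fun x : ℝ × ℝ => (Φ t x, x.2) :=
    (hΦc.comp (continuous_const.prodMk continuous_id)).prodMk continuous_snd
  have hbox : Icc a b ×ˢ Icc θ₁ θ₂ ⊆ Quadrant := prod_mono
    (fun y hy => ha.trans_le hy.1) (fun θ hθ => hθ₁.trans_le hθ.1)
  have hbc : IsCompact (Icc a b ×ˢ Icc θ₁ θ₂) := isCompact_Icc.prod isCompact_Icc
  have hini : ρ₀.map (fun x => (Φ 0 x, x.2)) = ρ₀ := by
    rw [Measure.map_congr (g := id), Measure.map_id]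
    filter_upwards [h0] with x hx
    simp [hΦ0 x hx.1]
  refine ⟨⟨?_, ?_, ?_, ?_⟩, hini⟩
  · exact fun t _ => Measure.isProbabilityMeasure_map (hc t).aemeasurable
  · refine fun T => ⟨_, hbc, hbox, fun t ht => ?_⟩
    refine Measure.support_subset_of_isClosed hbc.isClosed ?_
    rw [mem_ae_map_iff (hc t).aemeasurable hbc.measurableSet]
    filter_upwards [h0] with x hx using ⟨hΦab t ht.1 x, hx.2⟩
  · intro φ hφ hφc _
    refine Continuous.continuousOn ?_
    have e (t : ℝ) : ∫ x, φ x ∂(ρ₀.map fun x => (Φ t x, x.2)) = ∫ x, φ (Φ t x, x.2) ∂ρ₀ :=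
      integral_map (hc t).aemeasurable hφ.aestronglyMeasurable
    simp only [e]
    obtain ⟨C, hC⟩ := hφ.bounded_above_of_compact_support hφc
    refine continuous_of_dominated (fun t => (hφ.comp (hc t)).aestronglyMeasurable)
      (fun t => Eventually.of_forall fun x => hC _) (integrable_const C)
      (Eventually.of_forall fun x => ?_)
    exact hφ.comp ((hΦc.comp (continuous_id.prodMk continuous_const)).prodMk continuous_const)
  · intro φ hφ hφc _ t ht
    have hdiff : Differentiable ℝ φ := hφ.differentiable (by simp)
    have hfc : Continuous (fderiv ℝ φ) := hφ.continuous_fderiv (by simp)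
    have d1 (s : ℝ) (x : ℝ × ℝ) :
        deriv (fun r => φ (r, x.1, x.2)) s = fderiv ℝ φ (s, x) (1, 0, 0) := by
      have h2 : HasDerivAt (fun r : ℝ => ((r, x.1, x.2) : ℝ × ℝ × ℝ)) (1, 0, 0) s :=
        (hasDerivAt_id s).prodMk ((hasDerivAt_const _ _).prodMk (hasDerivAt_const _ _))
      exact ((hdiff (s, x)).hasFDerivAt.comp_hasDerivAt
        (f := fun r : ℝ => ((r, x.1, x.2) : ℝ × ℝ × ℝ)) s h2).deriv
    have d2 (s : ℝ) (x : ℝ × ℝ) :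
        deriv (fun y => φ (s, y, x.2)) x.1 = fderiv ℝ φ (s, x) (0, 1, 0) := by
      have h2 : HasDerivAt (fun y : ℝ => ((s, y, x.2) : ℝ × ℝ × ℝ)) (0, 1, 0) x.1 :=
        (hasDerivAt_const _ _).prodMk ((hasDerivAt_id x.1).prodMk (hasDerivAt_const _ _))
      exact ((hdiff (s, x)).hasFDerivAt.comp_hasDerivAt
        (f := fun y : ℝ => ((s, y, x.2) : ℝ × ℝ × ℝ)) x.1 h2).deriv
    simp only [d1, d2, Prod.mk.eta]
    set H : ℝ → ℝ × ℝ → ℝ := fun s x => fderiv ℝ φ (s, x) (1, 0, 0) +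
      field p σ (m s) x.1 x.2 * fderiv ℝ φ (s, x) (0, 1, 0) with hH
    have hHc : Continuous fun z : ℝ × ℝ × ℝ => H z.1 z.2 := by
      have c1 : Continuous fun z : ℝ × ℝ × ℝ => field p σ (m z.1) z.2.1 z.2.2 :=
        (continuous_field hp).comp ((hm.comp continuous_fst).prodMk continuous_snd)
      exact ((hfc.clm_apply continuous_const).add (c1.mul (hfc.clm_apply continuous_const)))
    set G : ℝ → ℝ × ℝ → ℝ := fun s x => H s (Φ s x, x.2) with hG
    have hGc : Continuous fun z : ℝ × ℝ × ℝ => G z.1 z.2 :=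
      hHc.comp (continuous_fst.prodMk (hΦc.prodMk (continuous_snd.comp continuous_snd)))
    have eφ (s : ℝ) : ∫ x, φ (s, x) ∂(ρ₀.map fun x => (Φ s x, x.2)) =
        ∫ x, φ (s, Φ s x, x.2) ∂ρ₀ :=
      integral_map (hc s).aemeasurable
        (hφ.continuous.comp (continuous_const.prodMk continuous_id)).aestronglyMeasurable
    have eH (s : ℝ) : ∫ x, H s x ∂(ρ₀.map fun x => (Φ s x, x.2)) = ∫ x, G s x ∂ρ₀ :=
      integral_map (hc s).aemeasurable
        (hHc.comp (continuous_const.prodMk continuous_id)).aestronglyMeasurable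
    change ∫ x, φ (t, x) ∂(ρ₀.map fun x => (Φ t x, x.2)) =
      ∫ x, φ (0, x) ∂(ρ₀.map fun x => (Φ 0 x, x.2)) +
        ∫ s in (0 : ℝ)..t, ∫ x, H s x ∂(ρ₀.map fun x => (Φ s x, x.2))
    simp only [eφ, eH]
    have hint : Integrable (Function.uncurry G) ((volume.restrict (uIoc 0 t)).prod ρ₀) := by
      rw [← Measure.restrict_eq_self_of_ae_mem h0, Measure.prod_restrict]
      have hcomp : IsCompact (Icc 0 t ×ˢ (Icc a b ×ˢ Icc θ₁ θ₂)) := isCompact_Icc.prod hbc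
      refine IntegrableOn.mono_set (hGc.continuousOn.integrableOn_compact hcomp) ?_
      rw [uIoc_of_le ht.le]
      exact prod_mono Ioc_subset_Icc_self le_rfl
    -- After Fubini the weak form is, for each starting point, the fundamental theorem of calculus
    -- along its trajectory.
    rw [intervalIntegral_integral_swap hint]
    obtain ⟨C, hC⟩ := hφ.continuous.bounded_above_of_compact_support hφc
    have hiφ (s : ℝ) : Integrable (fun x => φ (s, Φ s x, x.2)) ρ₀ :=
      Integrable.of_bound (hφ.continuous.comp
        (continuous_const.prodMk (hc s))).aestronglyMeasurable C
        (Eventually.of_forall fun x => hC _)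
    rw [← sub_eq_iff_eq_add', ← integral_sub (hiφ t) (hiφ 0)]
    refine integral_congr_ae ?_
    filter_upwards [h0] with x hx
    rw [intervalIntegral.integral_eq_sub_of_hasDerivAt (f := fun s => φ (s, Φ s x, x.2))
      (f' := fun s => G s x)]
    · intro s hs
      rw [uIcc_of_le ht.le] at hs
      have h1 : HasDerivAt (fun s : ℝ => ((s, Φ s x, x.2) : ℝ × ℝ × ℝ))
          (1, field p σ (m s) (Φ s x) x.2, 0) s :=
        (hasDerivAt_id s).prodMk ((hΦd s hs.1 x hx.2).prodMk (hasDerivAt_const _ _))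
      have h2 := (hdiff (s, Φ s x, x.2)).hasFDerivAt.comp_hasDerivAt
        (f := fun s : ℝ => ((s, Φ s x, x.2) : ℝ × ℝ × ℝ)) s h1
      refine h2.congr_deriv ?_
      have e : ((1, field p σ (m s) (Φ s x) x.2, 0) : ℝ × ℝ × ℝ) =
          (1, 0, 0) + field p σ (m s) (Φ s x) x.2 • (0, 1, 0) := by simp
      rw [e, map_add, map_smul, smul_eq_mul]
    · exact (hGc.comp (continuous_id.prodMk continuous_const)).intervalIntegrable _ _

end Flow

/-! ### Slices -/

lemma isClosedEmbedding_prodMk_left (θ : ℝ) : IsClosedEmbedding fun y : ℝ => (y, θ) :=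
  (Isometry.of_dist_eq fun y y' => by simp [Prod.dist_eq]).isClosedEmbedding

lemma isClosedEmbedding_prodMk_prodMk_left (θ : ℝ) :
    IsClosedEmbedding fun z : ℝ × ℝ => (z.1, z.2, θ) :=
  (Isometry.of_dist_eq fun y y' => by simp [Prod.dist_eq]).isClosedEmbedding

section Slices

variable {p σ : ℝ} {μ₀ : Measure (ℝ × ℝ)} {μ : ℝ → Measure (ℝ × ℝ)} {θ : ℝ} {ν : ℝ → Measure ℝ}

lemma integral_map_prodMk_left (κ : Measure ℝ) (θ : ℝ) (f : ℝ × ℝ → ℝ) :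
    ∫ x, f x ∂(κ.map fun y => (y, θ)) = ∫ y, f (y, θ) ∂κ :=
  (isClosedEmbedding_prodMk_left θ).measurableEmbedding.integral_map f

/-- A solution of the slice equation is a transport concentrated on a single conviction. -/
lemma IsSliceSolution.isTransport (h : IsSolution p σ μ₀ μ) (hθ : 0 < θ)
    (hν : IsSliceSolution p σ μ θ ν) :
    IsTransport p σ (fun t => ∫ z, z.1 ∂(μ t)) (fun t => (ν t).map fun y => (y, θ)) where
  prob t ht := by
    have := hν.prob t ht
    exact Measure.isProbabilityMeasure_map (by fun_prop)
  supp T := by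
    obtain ⟨K, hK, hK0, hs⟩ := hν.supp T
    refine ⟨K ×ˢ {θ}, hK.prod isCompact_singleton, ?_, fun t ht => ?_⟩
    · rintro ⟨y, θ'⟩ ⟨hy, hθ'⟩
      exact ⟨hK0 hy, by rw [mem_singleton_iff.mp hθ']; exact hθ⟩
    · refine Measure.support_subset_of_isClosed (hK.prod isCompact_singleton).isClosed ?_
      rw [mem_ae_map_iff (by fun_prop) (hK.prod isCompact_singleton).measurableSet]
      filter_upwards [ae_mem_of_support_subset (hs t ht)] with y hy using ⟨hy, rfl⟩
  weakStar φ hφ hφc hφs := by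
    simp only [integral_map_prodMk_left]
    have hc : Continuous fun y : ℝ => (y, θ) := by fun_prop
    exact hν.weakStar (φ ∘ fun y => (y, θ)) (hφ.comp hc)
      (hφc.comp_isClosedEmbedding (isClosedEmbedding_prodMk_left θ))
      ((tsupport_comp_subset_preimage φ hc).trans fun y hy => (hφs hy).1)
  weak φ hφ hφc hφs t ht := by
    simp only [integral_map_prodMk_left]
    have hc : Continuous fun z : ℝ × ℝ => (z.1, z.2, θ) := by fun_prop
    have := hν.weak (φ ∘ fun z : ℝ × ℝ => (z.1, z.2, θ)) (hφ.comp (by fun_prop))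
      (hφc.comp_isClosedEmbedding (isClosedEmbedding_prodMk_prodMk_left θ))
      ((tsupport_comp_subset_preimage φ hc).trans fun z hz => ⟨trivial, (hφs hz).2.1⟩) t ht
    simp only [Function.comp_apply] at this
    rw [this]
    congr 1
    refine intervalIntegral.integral_congr fun s hs => ?_
    rw [uIcc_of_le ht.le] at hs
    simp only [h.velocity_eq hs.1]

/-- A test function of time and opinion is extended to the quadrant by a cutoff in the conviction
that is one at `θ`. -/
lemma isSliceSolution_of_isTransport (h : IsSolution p σ μ₀ μ) (hθ : 0 < θ) {m : ℝ → ℝ}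
    (hm : ∀ t, 0 ≤ t → m t = ∫ z, z.1 ∂(μ t)) (hν : ∀ t, 0 ≤ t → IsProbabilityMeasure (ν t))
    (hT : IsTransport p σ m (fun t => (ν t).map fun y => (y, θ))) :
    IsSliceSolution p σ μ θ ν := by
  obtain ⟨χ, hχ, hχc, hχs, hχ1⟩ := exists_smooth_cutoff (isCompact_singleton (x := θ))
    isOpen_Ioi (singleton_subset_iff.mpr hθ : {θ} ⊆ Ioi (0 : ℝ))
  have hχθ : χ θ = 1 := hχ1.self_of_nhdsSet θ rfl
  refine ⟨hν, fun T => ?_, fun φ hφ hφc hφs => ?_, fun φ hφ hφc hφs t ht => ?_⟩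
  · obtain ⟨K, hK, hKQ, hs⟩ := hT.supp T
    have hK' := hK.image continuous_fst
    refine ⟨Prod.fst '' K, hK', ?_, fun t ht => ?_⟩
    · rintro _ ⟨x, hx, rfl⟩
      exact (hKQ hx).1
    · refine Measure.support_subset_of_isClosed hK'.isClosed ?_
      have hae : K ∈ ae ((ν t).map fun y => (y, θ)) := ae_mem_of_support_subset (hs t ht)
      rw [mem_ae_map_iff (by fun_prop) hK.measurableSet] at hae
      filter_upwards [hae] with y hy using ⟨_, hy, rfl⟩
  · have hts : tsupport (fun x : ℝ × ℝ => φ x.1 * χ x.2) ⊆ tsupport φ ×ˢ tsupport χ := by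
      refine closure_minimal ?_ ((isClosed_tsupport _).prod (isClosed_tsupport _))
      rintro ⟨u, v⟩ hz
      have hz' := mul_ne_zero_iff.mp hz
      exact ⟨subset_tsupport _ hz'.1, subset_tsupport _ hz'.2⟩
    have := hT.weakStar (fun x => φ x.1 * χ x.2)
      ((hφ.comp continuous_fst).mul (hχ.continuous.comp continuous_snd))
      ((hφc.prod hχc).of_isClosed_subset (isClosed_tsupport _) hts)
      (hts.trans (prod_mono hφs hχs))
    simpa only [integral_map_prodMk_left, hχθ, mul_one] using this
  · have hts : tsupport (fun z : ℝ × ℝ × ℝ => φ (z.1, z.2.1) * χ z.2.2) ⊆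
        (fun z : ℝ × ℝ × ℝ => ((z.1, z.2.1), z.2.2)) ⁻¹' (tsupport φ ×ˢ tsupport χ) := by
      refine closure_minimal ?_ (((isClosed_tsupport _).prod (isClosed_tsupport _)).preimage
        (by fun_prop))
      rintro ⟨u, v, w⟩ hz
      have hz' := mul_ne_zero_iff.mp hz
      exact ⟨subset_tsupport _ hz'.1, subset_tsupport _ hz'.2⟩
    have hcomp : IsCompact ((fun z : ℝ × ℝ × ℝ => ((z.1, z.2.1), z.2.2)) ⁻¹'
        (tsupport φ ×ˢ tsupport χ)) :=
      (Homeomorph.prodAssoc ℝ ℝ ℝ).symm.isCompact_preimage.mpr (hφc.isCompact.prod hχc)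
    have := hT.weak (fun z => φ (z.1, z.2.1) * χ z.2.2)
      ((hφ.comp (by fun_prop : ContDiff ℝ ∞ fun z : ℝ × ℝ × ℝ => (z.1, z.2.1))).mul
        (hχ.comp (by fun_prop : ContDiff ℝ ∞ fun z : ℝ × ℝ × ℝ => z.2.2)))
      (hcomp.of_isClosed_subset (isClosed_tsupport _) hts)
      (hts.trans fun z hz => ⟨trivial, (hφs hz.1).2, hχs hz.2⟩) t ht
    simp only [integral_map_prodMk_left, hχθ, mul_one] at this
    rw [this]
    congr 1
    refine intervalIntegral.integral_congr fun s hs => ?_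
    rw [uIcc_of_le ht.le] at hs
    simp only [h.velocity_eq hs.1, hm s hs.1]

end Slices

/-! ### The flow of a solution -/

section SolutionFlow

variable {p σ ymin ymax θmin θmax lo hi : ℝ} {μ₀ : Measure (ℝ × ℝ)} {μ : ℝ → Measure (ℝ × ℝ)}

/-- Every solution is the push-forward of its initial measure along a flow of characteristics,
which is defined for all convictions. -/
lemma IsSolution.exists_flow [IsProbabilityMeasure μ₀] (h : IsSolution p σ μ₀ μ) (hp : 0 < p)
    (hσ : 0 < σ) (hymin : 0 < ymin) (hlo : 0 < lo) (hlohi : lo ≤ hi)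
    (h0 : ∀ᵐ x ∂μ₀, x ∈ Icc ymin ymax ×ˢ Icc (lo ^ p) (hi ^ p)) :
    ∃ (m : ℝ → ℝ) (Φ : ℝ → ℝ × ℝ → ℝ), (∀ t, 0 ≤ t → m t = ∫ z, z.1 ∂(μ t)) ∧
      Continuous (fun z : ℝ × ℝ × ℝ => Φ z.1 z.2) ∧
      (∀ x : ℝ × ℝ, x.1 ∈ Icc ymin ymax → Φ 0 x = x.1) ∧
      (∀ t, 0 ≤ t → ∀ x, 0 < Φ t x) ∧
      (∀ t, 0 ≤ t → ∀ x : ℝ × ℝ, x.2 ∈ Icc (lo ^ p) (hi ^ p) →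
        HasDerivAt (fun s => Φ s x) (field p σ (m t) (Φ t x) x.2) t) ∧
      (∀ ρ₀ : Measure (ℝ × ℝ), IsProbabilityMeasure ρ₀ →
        (∀ᵐ x ∂ρ₀, x ∈ Icc ymin ymax ×ˢ Icc (lo ^ p) (hi ^ p)) →
        IsTransport p σ m (fun t => ρ₀.map fun x => (Φ t x, x.2))) ∧
      ∀ t, 0 ≤ t → μ t = μ₀.map fun x => (Φ t x, x.2) := by
  -- The interval contains both the initial opinions and `[lo, hi]`, and is therefore invariant for
  -- all convictions involved.
  set a := min ymin lo with ha_def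
  set b := max ymax hi with hb_def
  have ha : 0 < a := lt_min hymin hlo
  have hhi := hlo.trans_le hlohi
  have hb : 0 < b := hhi.trans_le (le_max_right _ _)
  have hab : a ≤ b := (min_le_right _ _).trans (hlohi.trans (le_max_right _ _))
  have haθ : a ^ p ≤ lo ^ p := Real.rpow_le_rpow ha.le (min_le_right _ _) hp.le
  have hbθ : hi ^ p ≤ b ^ p := Real.rpow_le_rpow hhi.le (le_max_right _ _) hp.le
  have hθ : lo ^ p ≤ hi ^ p := Real.rpow_le_rpow hlo.le hlohi hp.le
  have hθ0 : 0 < lo ^ p := Real.rpow_pos_of_pos hlo p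
  have hyab : Icc ymin ymax ⊆ Icc a b := Icc_subset_Icc (min_le_left _ _) (le_max_left _ _)
  -- Freezing the mean at negative times gives a coefficient that is continuous on the whole line.
  set m : ℝ → ℝ := fun t => ∫ z, z.1 ∂(μ (max t 0)) with hm_def
  have hm (t : ℝ) (ht : 0 ≤ t) : m t = ∫ z, z.1 ∂(μ t) := by simp only [hm_def, max_eq_left ht]
  have hT := h.isTransport hm
  have hmc : Continuous m := by
    have h1 := hT.continuousOn_integral (f := fun x => x.1) continuousOn_fst
    exact h1.comp_continuous (by fun_prop) fun t => le_max_right t 0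
  have h0' : ∀ᵐ x ∂(μ 0), x ∈ Icc ymin ymax ×ˢ Icc (lo ^ p) (hi ^ p) := by rwa [h.initial]
  have hmab (t : ℝ) : m t ∈ Icc a b := by
    have ht : 0 ≤ max t 0 := le_max_right _ _
    have hprob := h.prob _ ht
    have hint : Integrable (fun x : ℝ × ℝ => x.1) (μ (max t 0)) :=
      hT.integrable continuousOn_fst ht
    have h1 := hT.ae_le_fst hm hp hσ ha (h0'.mono fun x hx => (hyab hx.1).1)
      (h0'.mono fun x hx => haθ.trans hx.2.1) ht
    have h2 := hT.ae_fst_le hm hp hσ hb (h0'.mono fun x hx => (hyab hx.1).2)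
      (h0'.mono fun x hx => hx.2.2.trans hbθ) ht
    constructor
    · simpa using integral_mono_ae (integrable_const a) hint h1
    · simpa using integral_mono_ae hint (integrable_const b) h2
  obtain ⟨Φ, hΦc, hΦ0, hΦab, hΦd⟩ := OpinionModel.exists_flow hp hσ ha hab hθ haθ hbθ hmc hmab
  have hpush (ρ₀ : Measure (ℝ × ℝ)) (hρ : IsProbabilityMeasure ρ₀)
      (hρ0 : ∀ᵐ x ∂ρ₀, x ∈ Icc ymin ymax ×ˢ Icc (lo ^ p) (hi ^ p)) :=
    isTransport_map_flow (ρ₀ := ρ₀) hp ha hθ0 hmc hΦc hΦ0 hΦab hΦd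
      (hρ0.mono fun x hx => ⟨hyab hx.1, hx.2⟩)
  refine ⟨m, Φ, hm, hΦc, fun x hx => hΦ0 x (hyab hx), fun t ht x => ha.trans_le (hΦab t ht x).1,
    hΦd, fun ρ₀ hρ hρ0 => (hpush ρ₀ hρ hρ0).1, fun t ht => ?_⟩
  obtain ⟨hT', hT0⟩ := hpush μ₀ inferInstance h0
  exact hT.eq_of_initial_eq hT' hmc.continuousOn hp hσ (by rw [h.initial]; exact hT0.symm) ht

/-- Without a characteristic for each conviction `IsLimitProfile` could be vacuous and would not
determine `g`. -/
lemma IsSolution.exists_isCharacteristic [IsProbabilityMeasure μ₀] (h : IsSolution p σ μ₀ μ)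
    (hp : 0 < p) (hσ : 0 < σ) (hymin : 0 < ymin) (hy : ymin ≤ ymax) (hlo : 0 < lo)
    (hlohi : lo ≤ hi) (h0 : ∀ᵐ x ∂μ₀, x ∈ Icc ymin ymax ×ˢ Icc (lo ^ p) (hi ^ p)) {θ : ℝ}
    (hθ : θ ∈ Icc (lo ^ p) (hi ^ p)) :
    ∃ Y, IsCharacteristic p σ μ θ Y ∧ Y 0 ∈ Icc ymin ymax := by
  obtain ⟨m, Φ, hm, -, hΦ0, hΦpos, hΦd, -, -⟩ := h.exists_flow hp hσ hymin hlo hlohi h0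
  refine ⟨fun t => Φ t (ymin, θ), ⟨fun t ht => hΦpos t ht _, fun t ht => ?_⟩, ?_⟩
  · rw [h.velocity_eq ht, ← hm t ht]
    exact (hΦd t ht (ymin, θ) hθ).hasDerivWithinAt
  · simp only [hΦ0 (ymin, θ) ⟨le_rfl, hy⟩]
    exact ⟨le_rfl, hy⟩

/-- A disintegration of a measure on a strip all of whose slices are supported in the strip. -/
lemma exists_isDisintegration [IsProbabilityMeasure μ₀] (hy : ymin ≤ ymax)
    (h0 : ∀ᵐ x ∂μ₀, x.1 ∈ Icc ymin ymax) :
    ∃ κ : Kernel ℝ ℝ, IsDisintegration μ₀ μ₀.snd κ ∧ ∀ θ, ∀ᵐ y ∂(κ θ), y ∈ Icc ymin ymax := by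
  classical
  have hpr : IsProbabilityMeasure (μ₀.map Prod.swap) :=
    Measure.isProbabilityMeasure_map (by fun_prop)
  set κ₀ := (μ₀.map Prod.swap).condKernel with hκ₀
  have hdis : μ₀.snd ⊗ₘ κ₀ = μ₀.map Prod.swap := by
    rw [← Measure.fst_map_swap]
    exact Measure.disintegrate _ _
  -- Off this set of full measure, the slices are replaced by a Dirac mass in the strip.
  set S : Set ℝ := {θ | κ₀ θ (Icc ymin ymax)ᶜ = 0} with hS
  have hSm : MeasurableSet S :=
    Kernel.measurable_coe κ₀ measurableSet_Icc.compl (measurableSet_singleton 0)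
  have hSae : ∀ᵐ θ ∂μ₀.snd, θ ∈ S := by
    have h1 : ∀ᵐ z ∂(μ₀.snd ⊗ₘ κ₀), z.2 ∈ Icc ymin ymax := by
      rw [hdis, ae_map_iff (by fun_prop) (measurable_snd measurableSet_Icc)]
      exact h0
    exact Measure.ae_ae_of_ae_compProd h1
  set κ := Kernel.piecewise hSm κ₀ (Kernel.const ℝ (Measure.dirac ymin)) with hκ
  refine ⟨κ, ⟨inferInstance, ?_⟩, fun θ => ?_⟩
  · rw [← hdis]
    refine Measure.compProd_congr ?_
    filter_upwards [hSae] with θ hθ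
    rw [hκ, Kernel.piecewise_apply, if_pos hθ]
  · by_cases hθ : θ ∈ S
    · rw [hκ, Kernel.piecewise_apply, if_pos hθ]
      exact hθ
    · rw [hκ, Kernel.piecewise_apply, if_neg hθ, Kernel.const_apply]
      exact (ae_dirac_iff (p := fun y => y ∈ Icc ymin ymax) measurableSet_Icc).mpr ⟨le_rfl, hy⟩

/-- Initial slices are pushed along the flow with their conviction fixed. The flow covers every
conviction in the interval, so each slice in the support solves its equation, without exceptional
null sets. -/
lemma IsSolution.exists_isTransportedSlicing [IsProbabilityMeasure μ₀]
    (h : IsSolution p σ μ₀ μ) (hp : 0 < p) (hσ : 0 < σ) (hymin : 0 < ymin) (hy : ymin ≤ ymax)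
    (hlo : 0 < lo) (hlohi : lo ≤ hi)
    (h0 : ∀ᵐ x ∂μ₀, x ∈ Icc ymin ymax ×ˢ Icc (lo ^ p) (hi ^ p))
    (hsupp : μ₀.snd.support ⊆ Icc (lo ^ p) (hi ^ p)) :
    ∃ κ : ℝ → Kernel ℝ ℝ, IsTransportedSlicing p σ ymin ymax μ μ₀.snd κ := by
  obtain ⟨m, Φ, hm, hΦc, hΦ0, hΦpos, hΦd, hpush, hμ⟩ := h.exists_flow hp hσ hymin hlo hlohi h0
  obtain ⟨κ₀, ⟨hκ₀, hdis⟩, hκ₀y⟩ := exists_isDisintegration hy (h0.mono fun x hx => hx.1)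
  have hmeas (t : ℝ) : Measurable fun z : ℝ × ℝ => Φ t (z.2, z.1) :=
    (hΦc.comp (continuous_const.prodMk (continuous_snd.prodMk continuous_fst))).measurable
  have hmeas' (t θ : ℝ) : Measurable fun y : ℝ => Φ t (y, θ) :=
    (hmeas t).comp (measurable_const.prodMk measurable_id)
  set κ : ℝ → Kernel ℝ ℝ := fun t => (Kernel.id ×ₖ κ₀).map fun z => Φ t (z.2, z.1) with hκ
  have hκa (t θ : ℝ) : κ t θ = (κ₀ θ).map fun y => Φ t (y, θ) := by
    simp only [hκ]
    rw [Kernel.map_apply _ (hmeas t), Kernel.prod_apply, Kernel.id_apply, Measure.dirac_prod,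
      Measure.map_map (hmeas t) (by fun_prop)]
    rfl
  have hκm (t : ℝ) : IsMarkovKernel (κ t) := Kernel.IsMarkovKernel.map _ (hmeas t)
  refine ⟨κ, fun t ht => ⟨hκm t, ?_⟩, fun θ hθ => ?_, fun θ hθ => ?_⟩
  · have hF : Measurable fun z : ℝ × ℝ => (z.1, Φ t (z.2, z.1)) :=
      measurable_fst.prodMk (hmeas t)
    have hG : Measurable fun x : ℝ × ℝ => (Φ t x, x.2) :=
      (hΦc.comp (continuous_const.prodMk continuous_id)).measurable.prodMk measurable_snd
    have e1 : (μ t).map Prod.swap = (μ₀.snd ⊗ₘ κ₀).map fun z => (z.1, Φ t (z.2, z.1)) := by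
      rw [← hdis, hμ t ht, Measure.map_map measurable_swap hG, Measure.map_map hF measurable_swap]
      rfl
    rw [e1]
    ext s hs
    rw [Measure.map_apply hF hs, Measure.compProd_apply (hF hs), Measure.compProd_apply hs]
    refine lintegral_congr fun θ => ?_
    rw [hκa, Measure.map_apply (hmeas' t θ) (measurable_prodMk_left hs)]
    rfl
  · refine Measure.support_subset_of_isClosed isClosed_Icc ?_
    rw [hκa, mem_ae_map_iff (hmeas' 0 θ).aemeasurable measurableSet_Icc]
    filter_upwards [hκ₀y θ] with y hy'
    rw [mem_preimage, hΦ0 (y, θ) hy']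
    exact hy'
  · have hθ0 : 0 < θ := (Real.rpow_pos_of_pos hlo p).trans_le (hsupp hθ).1
    refine isSliceSolution_of_isTransport h hθ0 hm (fun t _ => inferInstance) ?_
    have hpr : IsProbabilityMeasure ((κ₀ θ).map fun y => (y, θ)) :=
      Measure.isProbabilityMeasure_map (by fun_prop)
    have hT := hpush ((κ₀ θ).map fun y => (y, θ)) hpr (by
      change Icc ymin ymax ×ˢ Icc (lo ^ p) (hi ^ p) ∈ ae _
      rw [mem_ae_map_iff (by fun_prop) (measurableSet_Icc.prod measurableSet_Icc)]
      filter_upwards [hκ₀y θ] with y hy' using ⟨hy', hsupp hθ⟩)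
    have e (t : ℝ) : ((κ₀ θ).map fun y => (y, θ)).map (fun x => (Φ t x, x.2)) =
        (κ t θ).map fun y => (y, θ) := by
      have hG : Measurable fun x : ℝ × ℝ => (Φ t x, x.2) :=
        (hΦc.comp (continuous_const.prodMk continuous_id)).measurable.prodMk measurable_snd
      rw [hκa, Measure.map_map hG (by fun_prop), Measure.map_map (by fun_prop) (hmeas' t θ)]
      rfl
    simpa only [e] using hT

end SolutionFlow

/-! ### Exponential convergence of the mean, the characteristics and the slices. -/

section Convergence

variable {p σ lo hi ymin ymax M : ℝ} {μ₀ : Measure (ℝ × ℝ)} {μ : ℝ → Measure (ℝ × ℝ)}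

lemma ae_snd_measure_mem {s : Set ℝ} (hs : MeasurableSet s) (h : ∀ᵐ x ∂μ₀, x.2 ∈ s) :
    ∀ᵐ θ ∂μ₀.snd, θ ∈ s := by
  change s ∈ ae (μ₀.map Prod.snd)
  rwa [mem_ae_map_iff (by fun_prop) hs]

/-- The mean opinion of every solution approaches the self-consistent mean exponentially fast,
with constants that depend only on the initial data. -/
lemma exists_sq_mean_sub_le (hp : 0 < p) (hσ : 0 < σ) (hymin : 0 < ymin) (hlo : 0 < lo)
    (hM : M ∈ Icc lo hi) (h0 : ∀ᵐ x ∂μ₀, x ∈ Icc ymin ymax ×ˢ Icc (lo ^ p) (hi ^ p))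
    (hMeq : ∫ θ, equilibrium p σ M θ ∂μ₀.snd = M) :
    ∃ A c : ℝ, 0 ≤ A ∧ 0 < c ∧ 2 * c ≤ lo / hi ∧ ∀ μ : ℝ → Measure (ℝ × ℝ),
      IsSolution p σ μ₀ μ → ∀ t, 0 ≤ t →
        (∫ z, z.1 ∂(μ t) - M) ^ 2 ≤ A * Real.exp (-c * t) := by
  have hM0 := hlo.trans_le hM.1
  have hhi := hM0.trans_le hM.2
  have ha : 0 < min ymin lo := lt_min hymin hlo
  have hab : min ymin lo ≤ max ymax hi :=
    (min_le_right _ _).trans ((hM.1.trans hM.2).trans (le_max_right _ _))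
  obtain ⟨c₁, hc₁, hc⟩ := exists_sq_le_mul_rpow_sub hp ha hab
  -- The cap `lo / hi / 2` keeps the rate at most half the contraction rate, as
  -- `le_mul_exp_of_deriv_le_add` requires.
  refine ⟨(max ymax hi - min ymin lo) ^ 2, min (2 * σ * c₁) (lo / hi / 2), sq_nonneg _,
    lt_min (by positivity) (by positivity), ?_, fun μ h t ht => ?_⟩
  · have := min_le_right (2 * σ * c₁) (lo / hi / 2)
    linarith
  · have hM' : ∫ x, equilibrium p σ M x.2 ∂(μ 0) = M := by
      rw [h.initial]
      exact (integral_map measurable_snd.aemeasurable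
        (contDiff_equilibrium hp hσ hM0).continuous.aestronglyMeasurable).symm.trans hMeq
    refine ((h.isTransport fun _ _ => rfl).sq_mean_sub_le (fun _ _ => rfl) hp hσ ha hlo hM
      (Icc_subset_Icc (min_le_right _ _) (le_max_right _ _)) ?_ ?_ hM' hc ht).trans ?_
    · rw [h.initial]
      filter_upwards [h0] with x hx using
        ⟨(min_le_left _ _).trans hx.1.1, hx.1.2.trans (le_max_left _ _)⟩
    · rw [h.initial]
      filter_upwards [h0] with x hx using hx.2
    · gcongr
      exact min_le_left _ _

lemma IsSolution.tendsto_of_isCharacteristic (h : IsSolution p σ μ₀ μ) (hp : 0 < p) (hσ : 0 < σ)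
    (hlo : 0 < lo) (hM : M ∈ Icc lo hi) {A c : ℝ} (hA : 0 ≤ A) (hc0 : 0 < c)
    (hc : 2 * c ≤ lo / hi)
    (hmM : ∀ t, 0 ≤ t → (∫ z, z.1 ∂(μ t) - M) ^ 2 ≤ A * Real.exp (-c * t)) {θ : ℝ}
    (hθ : θ ∈ Icc (lo ^ p) (hi ^ p)) {Y : ℝ → ℝ} (hY : IsCharacteristic p σ μ θ Y) :
    Tendsto Y atTop (𝓝 (equilibrium p σ M θ)) := by
  refine tendsto_equilibrium_of_hasDerivWithinAt hp hσ hlo hM hθ hA hc0 hc hmM hY.pos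
    fun t ht => ?_
  rw [← h.velocity_eq ht]
  exact hY.ode t ht

/-- A slice is a transport on a single conviction, to which the second moment decay applies. The
square root halves the rate, and the `+ 1` keeps the constant positive. -/
lemma IsSliceSolution.W1_dirac_equilibrium_le (h : IsSolution p σ μ₀ μ) (hp : 0 < p) (hσ : 0 < σ)
    (hlo : 0 < lo) (hM : M ∈ Icc lo hi) {A c : ℝ} (hA : 0 ≤ A) (hc : 2 * c ≤ lo / hi)
    (hmM : ∀ t, 0 ≤ t → (∫ z, z.1 ∂(μ t) - M) ^ 2 ≤ A * Real.exp (-c * t)) {θ : ℝ}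
    (hθ : θ ∈ Icc (lo ^ p) (hi ^ p)) {ν : ℝ → Measure ℝ} (hν : IsSliceSolution p σ μ θ ν)
    (hν0 : (ν 0).support ⊆ Icc ymin ymax) {t : ℝ} (ht : 0 ≤ t) :
    W1 (ν t) (Measure.dirac (equilibrium p σ M θ)) ≤ ENNReal.ofReal
      ((√((max ymax hi - min ymin lo) ^ 2 + 2 * (A / (lo / hi)) / (lo / hi)) + 1) *
        Real.exp (-(c / 2) * t)) := by
  have hM0 := hlo.trans_le hM.1
  have hhi := hM0.trans_le hM.2
  have hθ0 : 0 < θ := (Real.rpow_pos_of_pos hlo p).trans_le hθ.1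
  have hT := hν.isTransport h hθ0
  have hpr := hν.prob t ht
  have hemb := (isClosedEmbedding_prodMk_left θ).measurableEmbedding
  set D := (max ymax hi - min ymin lo) ^ 2 + 2 * (A / (lo / hi)) / (lo / hi) with hD
  have hD0 : 0 ≤ D := by positivity
  have hint := hT.integral_sq_sub_le (a := min ymin lo) (b := max ymax hi)
    ((h.isTransport fun _ _ => rfl).continuousOn_integral continuous_fst.continuousOn) hp hσ hlo
    hM (Icc_subset_Icc (min_le_right _ _) (le_max_right _ _)) (by
      rw [hemb.ae_map_iff]
      filter_upwards [ae_mem_of_support_subset hν0] with y hy using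
        ⟨(min_le_left _ _).trans hy.1, hy.2.trans (le_max_left _ _)⟩) (by
      rw [hemb.ae_map_iff]
      exact Eventually.of_forall fun _ => hθ) hA hc hmM ht
  rw [integral_map_prodMk_left, ← hD] at hint
  refine W1_dirac_le_of_integral_sq_le (by positivity) ?_ (hint.trans ?_)
  · have hi' := hT.integrable (f := fun x => (x.1 - equilibrium p σ M θ) ^ 2)
      (by fun_prop) ht
    exact hemb.integrable_map_iff.mp hi'
  · have e : Real.exp (-(c / 2) * t) ^ 2 = Real.exp (-c * t) := by
      rw [← Real.exp_nat_mul]; congr 1; push_cast; ring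
    rw [mul_pow, e]
    gcongr
    nlinarith [Real.sq_sqrt hD0, Real.sqrt_nonneg D]

/-- Two families of slices of the same measure agree for almost every conviction. -/
lemma IsDisintegration.ae_eq {ρ : Measure (ℝ × ℝ)} [IsFiniteMeasure ρ] {π : Measure ℝ}
    [SFinite π] {κ κ' : Kernel ℝ ℝ} (h : IsDisintegration ρ π κ) (h' : IsDisintegration ρ π κ') :
    ∀ᵐ θ ∂π, κ θ = κ' θ := by
  have := h.1
  have := h'.1
  have e : (ρ.map Prod.swap).fst = π := by rw [h.2, Measure.fst_compProd]
  have h1 := eq_condKernel_of_measure_eq_compProd (ρ := ρ.map Prod.swap) κ (by rw [e]; exact h.2)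
  have h2 := eq_condKernel_of_measure_eq_compProd (ρ := ρ.map Prod.swap) κ' (by rw [e]; exact h'.2)
  rw [e] at h1 h2
  filter_upwards [h1, h2] with θ e1 e2 using e1.trans e2.symm

end Convergence

/-! ### Dependence of the self-consistent mean on the conviction marginal. -/

section Stability

variable {p σ lo hi : ℝ}

/-- A bounded Lipschitz function of the conviction that separates two marginals according to
their self-consistent means. -/
lemma exists_lipschitz_mul_sub_le (hp : 0 < p) (hσ : 0 < σ) (hlo : 0 < lo) (hlohi : lo ≤ hi) :
    ∃ δ K B : ℝ, 0 < δ ∧ 0 < K ∧ ∀ M ∈ Icc lo hi, ∀ M' ∈ Icc lo hi, M ≤ M' →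
      ∃ f : ℝ → ℝ, Continuous f ∧ (∀ θ, |f θ| ≤ B) ∧
        (∀ θ θ', |f θ - f θ'| ≤ K * |θ - θ'|) ∧
        ∀ π π' : Measure ℝ, IsProbabilityMeasure π → IsProbabilityMeasure π' →
          (∀ᵐ θ ∂π, θ ∈ Icc (lo ^ p) (hi ^ p)) → (∀ᵐ θ ∂π', θ ∈ Icc (lo ^ p) (hi ^ p)) →
          ∫ θ, equilibrium p σ M θ ∂π = M → ∫ θ, equilibrium p σ M' θ ∂π' = M' →
          δ * (M' - M) ≤ ∫ θ, f θ ∂π' - ∫ θ, f θ ∂π := by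
  have hhi := hlo.trans_le hlohi
  have hle : lo ^ p ≤ hi ^ p := Real.rpow_le_rpow hlo.le hlohi hp.le
  obtain ⟨δ, hδ, H⟩ := exists_equilibrium_div_le hp hσ hlo hlohi
  refine ⟨δ, σ * hi ^ 2 / lo ^ 2, hi / lo, hδ, by positivity, fun M hM M' hM' hMM => ?_⟩
  have hM0 := hlo.trans_le hM.1
  have hM0' := hlo.trans_le hM'.1
  have hr (θ : ℝ) := (projIcc (lo ^ p) (hi ^ p) hle θ).2
  have hg (θ : ℝ) := equilibrium_mem_Icc hp hσ hlo hM (hr θ)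
  have hgc := (contDiff_equilibrium hp hσ hM0).continuous
  -- Self-consistency says that `f` integrates to one against `π`. Against `π'` it exceeds one by at
  -- least `δ (M' - M)`, since passing from `M'` to the smaller mean `M` raises the ratio.
  -- Projecting `θ` to the interval makes `f` bounded and globally Lipschitz.
  set f : ℝ → ℝ := fun θ => equilibrium p σ M (projIcc (lo ^ p) (hi ^ p) hle θ) / M with hf
  have hfc : Continuous f :=
    (hgc.comp (continuous_subtype_val.comp continuous_projIcc)).div_const _
  have hfB (θ : ℝ) : |f θ| ≤ hi / lo := by
    rw [abs_of_nonneg (div_nonneg (hlo.le.trans (hg θ).1) hM0.le)]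
    exact div_le_div₀ hhi.le (hg θ).2 hlo hM.1
  have hfe {θ : ℝ} (hθ : θ ∈ Icc (lo ^ p) (hi ^ p)) : f θ = equilibrium p σ M θ / M := by
    simp only [hf, projIcc_of_mem hle hθ]
  refine ⟨f, hfc, hfB, fun θ θ' => ?_, fun π π' _ _ hπ hπ' e e' => ?_⟩
  · have h1 := mul_abs_sub_zero_le hp hσ hM0 (hlo.trans_le (hg θ).1) (hlo.trans_le (hg θ').1)
      (field_equilibrium hp hσ hM0 _) (field_equilibrium hp hσ hM0 _)
    have h2 := abs_projIcc_sub_projIcc (h := hle) (c := θ) (d := θ')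
    rw [sub_self, abs_zero, zero_add] at h1
    have h3 : equilibrium p σ M (projIcc (lo ^ p) (hi ^ p) hle θ') *
        (σ * equilibrium p σ M (projIcc (lo ^ p) (hi ^ p) hle θ) *
          |(projIcc (lo ^ p) (hi ^ p) hle θ : ℝ) - projIcc (lo ^ p) (hi ^ p) hle θ'|) ≤
        hi * (σ * hi * |θ - θ'|) := by
      have hp1 := hlo.le.trans (hg θ).1
      have hp2 := hlo.le.trans (hg θ').1
      have q1 := (hg θ).2
      have q2 := (hg θ').2
      gcongr
    rw [hf]
    simp only
    rw [← sub_div, abs_div, abs_of_pos hM0, div_le_iff₀ hM0, div_mul_eq_mul_div,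
      div_mul_eq_mul_div, le_div_iff₀ (by positivity)]
    have h4 := mul_le_mul_of_nonneg_right (h1.trans h3) hM0.le
    have h5 : lo ^ 2 ≤ M * M := by rw [sq]; exact mul_le_mul hM.1 hM.1 hlo.le hM0.le
    refine (mul_le_mul_of_nonneg_left h5 (abs_nonneg _)).trans ?_
    linarith
  · have hfi (ρ : Measure ℝ) [IsProbabilityMeasure ρ] : Integrable f ρ :=
      Integrable.of_bound hfc.aestronglyMeasurable (hi / lo) (Eventually.of_forall hfB)
    have hgi' : Integrable (equilibrium p σ M') π' :=
      Integrable.of_bound (contDiff_equilibrium hp hσ hM0').continuous.aestronglyMeasurable hi (by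
        filter_upwards [hπ'] with θ hθ
        have := equilibrium_mem_Icc hp hσ hlo hM' hθ
        rw [Real.norm_of_nonneg (hlo.le.trans this.1)]
        exact this.2)
    have h1 : ∫ θ, f θ ∂π = 1 := by
      rw [integral_congr_ae (hπ.mono fun θ hθ => hfe hθ), integral_div, e, div_self hM0.ne']
    have h2 : ∫ θ, (equilibrium p σ M' θ / M' + δ * (M' - M)) ∂π' ≤ ∫ θ, f θ ∂π' := by
      refine integral_mono_ae ((hgi'.div_const _).add (integrable_const _)) (hfi π') ?_
      filter_upwards [hπ'] with θ hθ
      rw [hfe hθ]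
      exact H θ hθ M hM M' hM' hMM
    rw [integral_add (hgi'.div_const _) (integrable_const _), integral_div, e',
      div_self hM0'.ne'] at h2
    simp only [integral_const, probReal_univ, one_smul] at h2
    linarith

/-- The self-consistent mean is determined by the conviction marginal, in a Lipschitz way. -/
lemma exists_abs_mean_sub_le_W1 (hp : 0 < p) (hσ : 0 < σ) (hlo : 0 < lo) (hlohi : lo ≤ hi) :
    ∃ L : ℝ, 0 < L ∧ ∀ M ∈ Icc lo hi, ∀ M' ∈ Icc lo hi,
      ∀ π π' : Measure ℝ, IsProbabilityMeasure π → IsProbabilityMeasure π' →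
      (∀ᵐ θ ∂π, θ ∈ Icc (lo ^ p) (hi ^ p)) → (∀ᵐ θ ∂π', θ ∈ Icc (lo ^ p) (hi ^ p)) →
      ∫ θ, equilibrium p σ M θ ∂π = M → ∫ θ, equilibrium p σ M' θ ∂π' = M' →
      ENNReal.ofReal |M - M'| ≤ ENNReal.ofReal L * W1 π π' ∧ (π = π' → M = M') := by
  obtain ⟨δ, K, B, hδ, hK, H⟩ := exists_lipschitz_mul_sub_le (p := p) (σ := σ) hp hσ hlo hlohi
  have hδ' : ENNReal.ofReal δ⁻¹ * ENNReal.ofReal K = ENNReal.ofReal (K / δ) := by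
    rw [← ENNReal.ofReal_mul (by positivity)]; congr 1; field_simp
  have scale {x D : ℝ} {w : ℝ≥0∞} (h1 : δ * x ≤ D)
      (h2 : ENNReal.ofReal D ≤ ENNReal.ofReal K * w) :
      ENNReal.ofReal x ≤ ENNReal.ofReal (K / δ) * w := by
    rw [← hδ', mul_assoc]
    refine le_trans ?_ (mul_le_mul_right h2 _)
    rw [← ENNReal.ofReal_mul (by positivity)]
    refine ENNReal.ofReal_le_ofReal ?_
    rwa [← div_eq_inv_mul, le_div_iff₀' hδ]
  refine ⟨K / δ, by positivity, fun M hM M' hM' π π' h h' hπ hπ' e e' => ?_⟩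
  rcases le_total M M' with hMM | hMM
  · obtain ⟨f, hfc, hfB, hfL, hf⟩ := H M hM M' hM' hMM
    have hd := hf π π' h h' hπ hπ' e e'
    refine ⟨?_, ?_⟩
    · rw [abs_sub_comm, abs_of_nonneg (sub_nonneg.mpr hMM)]
      refine scale hd ?_
      have := ofReal_integral_sub_le_W1 (π := π) (π' := π') (f := fun x => -f x) hK
        hfc.neg (fun x => (abs_neg (f x)).trans_le (hfB x)) (fun x y => by
          rw [neg_sub_neg, abs_sub_comm]; exact hfL x y)
      rwa [integral_neg, integral_neg, neg_sub_neg] at this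
    -- For equal marginals the separating inequality itself reads `δ * (M' - M) ≤ 0`.
    · rintro rfl
      rw [sub_self] at hd
      nlinarith
  · obtain ⟨f, hfc, hfB, hfL, hf⟩ := H M' hM' M hM hMM
    have hd := hf π' π h' h hπ' hπ e' e
    refine ⟨?_, ?_⟩
    · rw [abs_of_nonneg (sub_nonneg.mpr hMM)]
      exact scale hd (ofReal_integral_sub_le_W1 hK hfc hfB hfL)
    · rintro rfl
      rw [sub_self] at hd
      nlinarith

lemma abs_equilibrium_sub_le (hp : 0 < p) (hσ : 0 < σ) (hlo : 0 < lo) {M M' θ : ℝ}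
    (hM : M ∈ Icc lo hi) (hM' : M' ∈ Icc lo hi) (hθ : θ ∈ Icc (lo ^ p) (hi ^ p)) :
    |equilibrium p σ M θ - equilibrium p σ M' θ| ≤ hi / lo * |M - M'| := by
  have hM0 := hlo.trans_le hM.1
  have hM0' := hlo.trans_le hM'.1
  have hg := equilibrium_mem_Icc hp hσ hlo hM' hθ
  have h := mul_abs_sub_zero_le hp hσ hM0' (equilibrium_pos hp hσ hM0 θ)
    (equilibrium_pos hp hσ hM0' θ) (field_equilibrium hp hσ hM0 θ) (field_equilibrium hp hσ hM0' θ)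
  rw [sub_self, abs_zero, mul_zero, add_zero] at h
  rw [div_mul_eq_mul_div, le_div_iff₀' hlo]
  calc _ ≤ M' * |equilibrium p σ M θ - equilibrium p σ M' θ| := by gcongr; exact hM'.1
    _ ≤ _ := h
    _ ≤ _ := by gcongr; exact hg.2

end Stability

/-! ### The limit profile: existence, convergence and stability. -/

section Profile

variable {p σ lo hi ymin ymax : ℝ} {μ₀ : Measure (ℝ × ℝ)} {μ : ℝ → Measure (ℝ × ℝ)}

/-- The limit profile is the equilibrium profile of the self-consistent mean. -/
lemma IsLimitProfile.exists_eqOn_equilibrium [IsProbabilityMeasure μ₀] {g : ℝ → ℝ}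
    (h : IsSolution p σ μ₀ μ) (hp : 0 < p) (hσ : 0 < σ) (hymin : 0 < ymin) (hy : ymin ≤ ymax)
    (hlo : 0 < lo) (hlohi : lo ≤ hi)
    (h0 : ∀ᵐ x ∂μ₀, x ∈ Icc ymin ymax ×ˢ Icc (lo ^ p) (hi ^ p))
    (hg : IsLimitProfile p σ ymin ymax (lo ^ p) (hi ^ p) μ g) :
    ∃ M ∈ Icc lo hi, ∫ θ, equilibrium p σ M θ ∂μ₀.snd = M ∧
      EqOn g (equilibrium p σ M) (Icc (lo ^ p) (hi ^ p)) := by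
  obtain ⟨M, hM, hMeq⟩ := exists_integral_equilibrium_eq (σ := σ) hp hσ hlo hlohi μ₀.snd
    (ae_snd_measure_mem measurableSet_Icc (h0.mono fun x hx => hx.2))
  obtain ⟨A, c, hA, hc0, hc, hmM⟩ := exists_sq_mean_sub_le hp hσ hymin hlo hM h0 hMeq
  refine ⟨M, hM, hMeq, fun θ hθ => ?_⟩
  obtain ⟨Y, hY, hY0⟩ := h.exists_isCharacteristic hp hσ hymin hy hlo hlohi h0 hθ
  exact tendsto_nhds_unique (hg θ hθ Y hY hY0)
    (h.tendsto_of_isCharacteristic hp hσ hlo hM hA hc0 hc (hmM μ h) hθ hY)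

/-- The mean `M` and the decay constants are fixed by `μ₀` before a solution is chosen, so they
serve all solutions. Arbitrary slices inherit the bound because they agree almost everywhere with
transported ones. -/
theorem exists_limitProfile [IsProbabilityMeasure μ₀] (hp : 0 < p) (hσ : 0 < σ)
    (hymin : 0 < ymin) (hy : ymin ≤ ymax) (hlo : 0 < lo) (hlohi : lo ≤ hi)
    (h0 : ∀ᵐ x ∂μ₀, x ∈ Icc ymin ymax ×ˢ Icc (lo ^ p) (hi ^ p)) :
    ∃ (g : ℝ → ℝ) (C c : ℝ), 0 < C ∧ 0 < c ∧
      ContDiffOn ℝ ∞ g (Icc (lo ^ p) (hi ^ p)) ∧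
      StrictMonoOn g (Icc (lo ^ p) (hi ^ p)) ∧
      MapsTo g (Icc (lo ^ p) (hi ^ p)) (Ioi 0) ∧
      ∀ μ : ℝ → Measure (ℝ × ℝ), IsSolution p σ μ₀ μ →
        IsLimitProfile p σ ymin ymax (lo ^ p) (hi ^ p) μ g ∧
        (∀ t, 0 < t → ∀ κ : Kernel ℝ ℝ, IsDisintegration (μ t) μ₀.snd κ →
          ∀ᵐ θ ∂μ₀.snd, W1 (κ θ) (Measure.dirac (g θ)) ≤
            ENNReal.ofReal (C * Real.exp (-c * t))) ∧
        (∃ κ : ℝ → Kernel ℝ ℝ, IsTransportedSlicing p σ ymin ymax μ μ₀.snd κ) ∧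
        (∀ κ : ℝ → Kernel ℝ ℝ, IsTransportedSlicing p σ ymin ymax μ μ₀.snd κ →
          ∀ t, 0 < t → (⨆ θ ∈ μ₀.snd.support, W1 (κ t θ) (Measure.dirac (g θ))) ≤
            ENNReal.ofReal (C * Real.exp (-c * t))) := by
  have hπ := ae_snd_measure_mem measurableSet_Icc (h0.mono fun x hx => hx.2)
  have hsupp : μ₀.snd.support ⊆ Icc (lo ^ p) (hi ^ p) :=
    Measure.support_subset_of_isClosed isClosed_Icc hπ
  obtain ⟨M, hM, hMeq⟩ := exists_integral_equilibrium_eq (σ := σ) hp hσ hlo hlohi μ₀.snd hπ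
  obtain ⟨A, c, hA, hc0, hc, hmM⟩ := exists_sq_mean_sub_le hp hσ hymin hlo hM h0 hMeq
  have hM0 := hlo.trans_le hM.1
  refine ⟨equilibrium p σ M,
    √((max ymax hi - min ymin lo) ^ 2 + 2 * (A / (lo / hi)) / (lo / hi)) + 1, c / 2, by positivity,
    half_pos hc0,
    (contDiff_equilibrium hp hσ hM0).contDiffOn, (strictMono_equilibrium hp hσ hM0).strictMonoOn _,
    fun θ _ => equilibrium_pos hp hσ hM0 θ, fun μ h => ?_⟩
  have hslice (κ : ℝ → Kernel ℝ ℝ) (hκ : IsTransportedSlicing p σ ymin ymax μ μ₀.snd κ) {t : ℝ}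
      (ht : 0 < t) {θ : ℝ} (hθ : θ ∈ μ₀.snd.support) :=
    (hκ.slice θ hθ).W1_dirac_equilibrium_le h hp hσ hlo hM hA hc (hmM μ h) (hsupp hθ)
      (hκ.start θ hθ) ht.le
  have hex := h.exists_isTransportedSlicing hp hσ hymin hy hlo hlohi h0 hsupp
  refine ⟨fun θ hθ Y hY _ => h.tendsto_of_isCharacteristic hp hσ hlo hM hA hc0 hc (hmM μ h) hθ hY,
    fun t ht κ hκ => ?_, hex, fun κ hκ t ht => iSup₂_le fun θ hθ => hslice κ hκ ht hθ⟩
  obtain ⟨κ', hκ'⟩ := hex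
  have := h.prob t ht.le
  filter_upwards [hκ.ae_eq (hκ'.disintegration t ht.le), Measure.support_mem_ae] with θ e hθ
  rw [e]
  exact hslice κ' hκ' ht hθ

/-- The map from marginal to profile factors through the self-consistent mean, and both factors are
Lipschitz. -/
theorem exists_limitProfile_lipschitz (hp : 0 < p) (hσ : 0 < σ) (hlo : 0 < lo) (hlohi : lo ≤ hi) :
    ∃ L : ℝ, 0 < L ∧
      ∀ (ymin ymax ymin' ymax' : ℝ) (μ₀ μ₀' : Measure (ℝ × ℝ))
        (μ μ' : ℝ → Measure (ℝ × ℝ)) (g g' : ℝ → ℝ),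
        0 < ymin → 0 < ymin' → ymin ≤ ymax → ymin' ≤ ymax' →
        IsProbabilityMeasure μ₀ → IsProbabilityMeasure μ₀' →
        (∀ᵐ x ∂μ₀, x ∈ Icc ymin ymax ×ˢ Icc (lo ^ p) (hi ^ p)) →
        (∀ᵐ x ∂μ₀', x ∈ Icc ymin' ymax' ×ˢ Icc (lo ^ p) (hi ^ p)) →
        IsSolution p σ μ₀ μ → IsSolution p σ μ₀' μ' →
        IsLimitProfile p σ ymin ymax (lo ^ p) (hi ^ p) μ g →
        IsLimitProfile p σ ymin' ymax' (lo ^ p) (hi ^ p) μ' g' →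
        (⨆ θ ∈ Icc (lo ^ p) (hi ^ p), ENNReal.ofReal |g θ - g' θ|) ≤
            ENNReal.ofReal L * W1 μ₀.snd μ₀'.snd ∧
          (μ₀.snd = μ₀'.snd → EqOn g g' (Icc (lo ^ p) (hi ^ p))) := by
  have hhi := hlo.trans_le hlohi
  obtain ⟨L, hL, H⟩ := exists_abs_mean_sub_le_W1 (p := p) (σ := σ) hp hσ hlo hlohi
  refine ⟨hi / lo * L, by positivity, fun ymin ymax ymin' ymax' μ₀ μ₀' μ μ' g g' h1 h1' h2 h2'
    hpr hpr' h0 h0' h h' hg hg' => ?_⟩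
  obtain ⟨M, hM, hMeq, hgM⟩ := hg.exists_eqOn_equilibrium h hp hσ h1 h2 hlo hlohi h0
  obtain ⟨M', hM', hMeq', hgM'⟩ := hg'.exists_eqOn_equilibrium h' hp hσ h1' h2' hlo hlohi h0'
  obtain ⟨hW, heq⟩ := H M hM M' hM' μ₀.snd μ₀'.snd inferInstance inferInstance
    (ae_snd_measure_mem measurableSet_Icc (h0.mono fun x hx => hx.2))
    (ae_snd_measure_mem measurableSet_Icc (h0'.mono fun x hx => hx.2)) hMeq hMeq'
  refine ⟨iSup₂_le fun θ hθ => ?_, fun e θ hθ => ?_⟩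
  · rw [hgM hθ, hgM' hθ, ENNReal.ofReal_mul (by positivity), mul_assoc]
    refine le_trans ?_ (mul_le_mul_right hW _)
    rw [← ENNReal.ofReal_mul (by positivity)]
    exact ENNReal.ofReal_le_ofReal (abs_equilibrium_sub_le hp hσ hlo hM hM' hθ)
  · rw [hgM hθ, hgM' hθ, heq e]

end Profile

end OpinionModel

theorem theorem1p2 (p σ θmin θmax : ℝ) (hp : 0 < p) (hσ : 0 < σ) (hθmin : 0 < θmin) :
    -- existence of the limiting profile and exponential convergence of the slices
    (∀ (ymin ymax : ℝ) (μ₀ : Measure (ℝ × ℝ)), 0 < ymin → IsProbabilityMeasure μ₀ →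
      μ₀.support ⊆ Icc ymin ymax ×ˢ Icc θmin θmax →
      ∃ (g : ℝ → ℝ) (C c : ℝ), 0 < C ∧ 0 < c ∧
        ContDiffOn ℝ ∞ g (Icc θmin θmax) ∧
        StrictMonoOn g (Icc θmin θmax) ∧
        MapsTo g (Icc θmin θmax) (Ioi 0) ∧
        ∀ μ : ℝ → Measure (ℝ × ℝ), OpinionModel.IsSolution p σ μ₀ μ →
          OpinionModel.IsLimitProfile p σ ymin ymax θmin θmax μ g ∧
          -- arbitrary slices, defined up to null sets of convictions at each time
          (∀ t, 0 < t → ∀ κ : Kernel ℝ ℝ, OpinionModel.IsDisintegration (μ t) μ₀.snd κ →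
            ∀ᵐ θ ∂μ₀.snd, OpinionModel.W1 (κ θ) (Measure.dirac (g θ)) ≤
              ENNReal.ofReal (C * Real.exp (-c * t))) ∧
          -- slices transported by the equation: they exist, and the bound holds everywhere
          (∃ κ : ℝ → Kernel ℝ ℝ,
            OpinionModel.IsTransportedSlicing p σ ymin ymax μ μ₀.snd κ) ∧
          (∀ κ : ℝ → Kernel ℝ ℝ,
            OpinionModel.IsTransportedSlicing p σ ymin ymax μ μ₀.snd κ →
            ∀ t, 0 < t →
              (⨆ θ ∈ μ₀.snd.support, OpinionModel.W1 (κ t θ) (Measure.dirac (g θ))) ≤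
                ENNReal.ofReal (C * Real.exp (-c * t)))) ∧
    -- Lipschitz dependence of the profile on the conviction marginal, and uniqueness
    ((σ * θmin > (p + 1) / p ∨ θmax / θmin < p + 1) →
      ∃ L : ℝ, 0 < L ∧
        ∀ (ymin ymax ymin' ymax' : ℝ) (μ₀ μ₀' : Measure (ℝ × ℝ))
          (μ μ' : ℝ → Measure (ℝ × ℝ)) (g g' : ℝ → ℝ),
          0 < ymin → 0 < ymin' → IsProbabilityMeasure μ₀ → IsProbabilityMeasure μ₀' →
          μ₀.support ⊆ Icc ymin ymax ×ˢ Icc θmin θmax →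
          μ₀'.support ⊆ Icc ymin' ymax' ×ˢ Icc θmin θmax →
          OpinionModel.IsSolution p σ μ₀ μ → OpinionModel.IsSolution p σ μ₀' μ' →
          OpinionModel.IsLimitProfile p σ ymin ymax θmin θmax μ g →
          OpinionModel.IsLimitProfile p σ ymin' ymax' θmin θmax μ' g' →
          (⨆ θ ∈ Icc θmin θmax, ENNReal.ofReal |g θ - g' θ|) ≤
              ENNReal.ofReal L * OpinionModel.W1 μ₀.snd μ₀'.snd ∧
            (μ₀.snd = μ₀'.snd → EqOn g g' (Icc θmin θmax))) := by
  -- A probability measure charges its support, so the box is nonempty and both intervals are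
  -- correctly ordered.
  have hne {ymin ymax : ℝ} {μ₀ : Measure (ℝ × ℝ)} (_ : IsProbabilityMeasure μ₀)
      (hs : μ₀.support ⊆ Icc ymin ymax ×ˢ Icc θmin θmax) : ymin ≤ ymax ∧ θmin ≤ θmax := by
    obtain ⟨x, hx⟩ := (OpinionModel.ae_mem_of_support_subset hs).exists
    exact ⟨hx.1.1.trans hx.1.2, hx.2.1.trans hx.2.2⟩
  by_cases hθ : θmin ≤ θmax
  · obtain ⟨lo, hlo, rfl⟩ : ∃ lo : ℝ, 0 < lo ∧ lo ^ p = θmin :=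
      ⟨θmin ^ p⁻¹, Real.rpow_pos_of_pos hθmin _, OpinionModel.rpow_inv_rpow_self hp hθmin⟩
    have hθmax := hθmin.trans_le hθ
    obtain ⟨hi, hhi, rfl⟩ : ∃ hi : ℝ, 0 < hi ∧ hi ^ p = θmax :=
      ⟨θmax ^ p⁻¹, Real.rpow_pos_of_pos hθmax _, OpinionModel.rpow_inv_rpow_self hp hθmax⟩
    have hlohi : lo ≤ hi := (Real.rpow_le_rpow_iff hlo.le hhi.le hp).mp hθ
    refine ⟨fun ymin ymax μ₀ hymin hpr hs => ?_, fun _ => ?_⟩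
    · exact OpinionModel.exists_limitProfile hp hσ hymin (hne hpr hs).1 hlo hlohi
        (OpinionModel.ae_mem_of_support_subset hs)
    · obtain ⟨L, hL, H⟩ := OpinionModel.exists_limitProfile_lipschitz (σ := σ) hp hσ hlo hlohi
      exact ⟨L, hL, fun ymin ymax ymin' ymax' μ₀ μ₀' μ μ' g g' h1 h1' hpr hpr' hs hs' =>
        H ymin ymax ymin' ymax' μ₀ μ₀' μ μ' g g' h1 h1' (hne hpr hs).1 (hne hpr' hs').1 hpr hpr'
          (OpinionModel.ae_mem_of_support_subset hs) (OpinionModel.ae_mem_of_support_subset hs')⟩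
  · exact ⟨fun _ _ _ _ hpr hs => absurd (hne hpr hs).2 hθ, fun _ => ⟨1, one_pos,
      fun _ _ _ _ _ _ _ _ _ _ _ _ hpr _ hs => absurd (hne hpr hs).2 hθ⟩⟩
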